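/- Let $n\ge 2$ be an integer, $\alpha>1$, $\kappa>0$, and let $\psi:[0,\infty)\to[0,\infty)$ be a model function, i.e. $\psi\in C^\infty([0,\infty))$, $\psi>0$ on $(0,\infty)$, $\psi(0)=0$, $\psi'(0)=1$ and $\psi^{(2k)}(0)=0$ for all $k\in\mathbb N$. Let $\mathbb M^n$ be the associated model manifold, that is $\mathbb R^n$ with the metric which in polar coordinates about the pole $o=0$ reads $g=dr^2+\psi(r)^2 g_{\mathbb S^{n-1}}$, and let $\Delta$ be its Laplace–Beltrami operator. Assume that $\psi(r)\sim\kappa r^\alpha$ as $r\to+\infty$, i.e. $\psi(r)/(\kappa r^\alpha)\to1$. Set $$2^*_\alpha:=\frac{2(\alpha(n-1)+1)}{\alpha(n-1)-1},\qquad q:=2^*_\alpha-1.$$ Let $D^{1,2}_{\mathrm{rad}}(\mathbb M^n)$ be the closure of the radial $C^1_c$ functions on $\mathbb M^n$ with respect to the norm $\left(\int_0^\infty|f'|^2\psi^{n-1}\,dr\right)^{1/2}$ (radial functions being identified with functions of $r$); under the present assumptions it is a space of functions that are locally absolutely continuous on $(0,\infty)$. Put $$R_{\psi,q}(f):=\frac{\left(\int_0^{\infty}|f'|^2\psi^{n-1}\,dr\right)^{1/2}}{\left(\int_0^{\infty}|f|^{q+1}\psi^{n-1}\,dr\right)^{1/(q+1)}},\qquad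 I_{\psi,q}:=\inf_{f\in D^{1,2}_{\mathrm{rad}}(\mathbb M^n)\setminus\{0\}}R_{\psi,q}(f),$$ $$I_\alpha:=\inf_{\varphi\in C^1_c([0,\infty))\setminus\{0\}}\frac{\left(\int_0^{\infty}|\varphi'(r)|^2\kappa^{n-1}r^{\alpha(n-1)}\,dr\right)^{1/2}}{\left(\int_0^{\infty}|\varphi(r)|^{2^*_\alpha}\kappa^{n-1}r^{\alpha(n-1)}\,dr\right)^{1/2^*_\alpha}}.$$ Suppose that $I_{\psi,q}<I_\alpha$. Then there is a radial function $u\in C^2(\mathbb M^n)\cap D^{1,2}_{\mathrm{rad}}(\mathbb M^n)$ with $-\Delta u=u^{q}$ and $u>0$ on all of $\mathbb M^n$, which is also a Sobolev minimizer, i.e. $R_{\psi,q}(u)=I_{\psi,q}$. -/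

import Mathlib

open Set Filter Topology MeasureTheory
open scoped ContDiff ENNReal

/-- Model functions: `ψ : [0,∞) → [0,∞)` smooth up to `0`, positive on `(0,∞)`, with `ψ 0 = 0`,
`ψ' 0 = 1` and all even derivatives vanishing at `0`. Only the values on `[0,∞)` matter. -/
structure IsModelFunction (ψ : ℝ → ℝ) : Prop where
  contDiffOn : ContDiffOn ℝ ∞ ψ (Ici 0)
  pos : ∀ r : ℝ, 0 < r → 0 < ψ r
  map_zero : ψ 0 = 0
  deriv_zero : derivWithin ψ (Ici 0) 0 = 1
  even_deriv_zero : ∀ k : ℕ, iteratedDerivWithin (2 * k) ψ (Ici 0) 0 = 0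

/-- The metric `dr² + ψ(r)² g_{𝕊ⁿ⁻¹}` of the model manifold, written as a matrix in the global
coordinates `x = r θ ∈ ℝⁿ` given by the exponential map at the pole `o = 0`: the radial projection
`x xᵀ / r²` plus `(ψ(r) / r)²` times the complementary projection. At the pole it is the identity,
which is its smooth extension. In these coordinates the geodesic distance from the pole is `‖x‖`. -/
noncomputable def modelMetric (n : ℕ) (ψ : ℝ → ℝ) (x : EuclideanSpace ℝ (Fin n)) :
    Matrix (Fin n) (Fin n) ℝ :=
  open Classical in
  if x = 0 then 1
  else Matrix.of fun i j =>
    x i * x j / ‖x‖ ^ 2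
      + (ψ ‖x‖ / ‖x‖) ^ 2 * ((if i = j then 1 else 0) - x i * x j / ‖x‖ ^ 2)

/-- The `i`-th partial derivative of a function on `ℝⁿ`. -/
noncomputable def partialDeriv {n : ℕ} (i : Fin n) (u : EuclideanSpace ℝ (Fin n) → ℝ)
    (x : EuclideanSpace ℝ (Fin n)) : ℝ :=
  fderiv ℝ u x (EuclideanSpace.single i 1)

/-- The Laplace-Beltrami operator of a Riemannian metric `g` on `ℝⁿ`,
`Δ u = (det g)^{-1/2} ∑ᵢ ∂ᵢ ((det g)^{1/2} ∑ⱼ gⁱʲ ∂ⱼ u)`. -/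
noncomputable def laplaceBeltrami {n : ℕ}
    (g : EuclideanSpace ℝ (Fin n) → Matrix (Fin n) (Fin n) ℝ)
    (u : EuclideanSpace ℝ (Fin n) → ℝ) (x : EuclideanSpace ℝ (Fin n)) : ℝ :=
  (√(g x).det)⁻¹ *
    ∑ i, partialDeriv i (fun y => √(g y).det * ∑ j, (g y)⁻¹ i j * partialDeriv j u y) x

/-- `u` is a (classical) solution of the Lane-Emden equation `-Δ u = u^q`, `u > 0`, on the whole
`n`-dimensional model manifold associated with `ψ`, the pole included. -/
structure IsLaneEmdenSolution (n : ℕ) (ψ : ℝ → ℝ) (q : ℝ)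
    (u : EuclideanSpace ℝ (Fin n) → ℝ) : Prop where
  contDiff : ContDiff ℝ 2 u
  pos : ∀ x, 0 < u x
  equation : ∀ x, -laplaceBeltrami (modelMetric n ψ) u x = u x ^ q

/-- `∫₀^∞ |f'|² w dr`, with values in `[0,∞]`. -/
noncomputable def weightedEnergy (w f : ℝ → ℝ) : ℝ≥0∞ :=
  ∫⁻ r in Ioi (0 : ℝ), ENNReal.ofReal (|deriv f r| ^ 2 * w r)

/-- `∫₀^∞ |f|^p w dr`, with values in `[0,∞]`. -/
noncomputable def weightedMass (w : ℝ → ℝ) (p : ℝ) (f : ℝ → ℝ) : ℝ≥0∞ :=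
  ∫⁻ r in Ioi (0 : ℝ), ENNReal.ofReal (|f r| ^ p * w r)

/-- The quotient `(∫₀^∞ |f'|² w dr)^{1/2} / (∫₀^∞ |f|^p w dr)^{1/p}`. -/
noncomputable def weightedQuotient (w : ℝ → ℝ) (p : ℝ) (f : ℝ → ℝ) : ℝ≥0∞ :=
  weightedEnergy w f ^ (1 / 2 : ℝ) / weightedMass w p f ^ (1 / p)

/-- The profile `φ` defines a radial function `x ↦ φ (r(x))` on the model manifold which is of
class `C¹` with compact support. -/
def IsRadialC1c (n : ℕ) (φ : ℝ → ℝ) : Prop :=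
  ContDiff ℝ 1 (fun x : EuclideanSpace ℝ (Fin n) => φ ‖x‖) ∧
    HasCompactSupport (fun x : EuclideanSpace ℝ (Fin n) => φ ‖x‖)

/-- The space `D^{1,2}_rad` of the model manifold: the closure of the radial `C¹` functions with
compact support in the norm `(∫₀^∞ |f'|² ψ^{n-1} dr)^{1/2}`, as a space of functions. An element is
given by its profile `f` on `(0,∞)` (other values of `f` are irrelevant), taken in its locally
absolutely continuous version, so that `deriv f` is its weak derivative. Convergence `φ k → f` is
convergence of the derivatives in `L²(ψ^{n-1} dr)` together with convergence of the values; the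
latter singles out the limit `f` among the functions `f + const`. -/
def D12rad (n : ℕ) (ψ : ℝ → ℝ) : Set (ℝ → ℝ) :=
  {f | (∀ a b : ℝ, 0 < a → a ≤ b → AbsolutelyContinuousOnInterval f a b) ∧
    ∃ φ : ℕ → ℝ → ℝ, (∀ k, IsRadialC1c n (φ k)) ∧
      Tendsto (fun k => ∫⁻ r in Ioi (0 : ℝ),
        ENNReal.ofReal (|deriv (φ k) r - deriv f r| ^ 2 * ψ r ^ (n - 1))) atTop (𝓝 0) ∧
      ∀ r : ℝ, 0 < r → Tendsto (fun k => φ k r) atTop (𝓝 (f r))}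

/-- The radial Sobolev quotient `R_{ψ,q}`. -/
noncomputable def sobolevQuotient (n : ℕ) (ψ : ℝ → ℝ) (q : ℝ) (f : ℝ → ℝ) : ℝ≥0∞ :=
  weightedQuotient (fun r => ψ r ^ (n - 1)) (q + 1) f

/-- The optimal radial Sobolev quotient `I_{ψ,q}`, the infimum over `D^{1,2}_rad \ {0}`. -/
noncomputable def sobolevInf (n : ℕ) (ψ : ℝ → ℝ) (q : ℝ) : ℝ≥0∞ :=
  ⨅ f ∈ {f : ℝ → ℝ | f ∈ D12rad n ψ ∧ ∃ r, 0 < r ∧ f r ≠ 0}, sobolevQuotient n ψ q f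

/-- `f ∈ D^{1,2}_rad \ {0}` achieves the optimal radial Sobolev quotient. -/
def IsSobolevMinimizer (n : ℕ) (ψ : ℝ → ℝ) (q : ℝ) (f : ℝ → ℝ) : Prop :=
  f ∈ D12rad n ψ ∧ (∃ r, 0 < r ∧ f r ≠ 0) ∧ sobolevQuotient n ψ q f = sobolevInf n ψ q

/-- The critical exponent `2*_α = 2 (α (n - 1) + 1) / (α (n - 1) - 1)`. -/
noncomputable def twoStar (n : ℕ) (α : ℝ) : ℝ :=
  2 * (α * ((n : ℝ) - 1) + 1) / (α * ((n : ℝ) - 1) - 1)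

/-- `φ ∈ C¹_c([0,∞))`. -/
def IsC1cHalfLine (φ : ℝ → ℝ) : Prop :=
  ContDiffOn ℝ 1 φ (Ici 0) ∧ ∃ R : ℝ, ∀ r, R ≤ r → φ r = 0

/-- The asymptotic optimal quotient `I_α`: the infimum over `C¹_c([0,∞)) \ {0}` of the quotient
with weight `κ^{n-1} r^{α(n-1)}` and exponent `2*_α`. -/
noncomputable def asymptoticInf (n : ℕ) (α κ : ℝ) : ℝ≥0∞ :=
  ⨅ φ ∈ {φ : ℝ → ℝ | IsC1cHalfLine φ ∧ ∃ r, 0 ≤ r ∧ φ r ≠ 0},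
    weightedQuotient (fun r => κ ^ (n - 1) * r ^ (α * ((n : ℝ) - 1))) (twoStar n α) φ

/-! Put `w = ψ^(n-1)` and `p = 2*_α`. The proof is a one-dimensional compactness argument in which
mass can be lost only at infinity, and the gap `I_{ψ,q} < I_α` makes that loss too expensive.

By Cauchy–Schwarz, `|f b - f a|²` is at most `∫_a^b 1/w` times the energy, and `1/w` is integrable
at infinity. Hence `D^{1,2}_rad` consists exactly of the locally absolutely continuous functions of
finite energy that vanish at infinity (`mem_D12rad_iff`), and `f ↦ f'√w` identifies it with
`L²(0,∞)`. Weak compactness there gives pointwise convergence and lower semicontinuity of the energy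
on every measurable set (`exists_subseq_tendsto_of_energy_le`). Since `α > 1`, the exponent `p` is
subcritical at the pole: finite energy forces `|f|² ≤ C r^(-b)` with `r^(-bp/2) w` integrable at
`0`, so the mass on bounded intervals passes to the limit (`tendsto_massOn_Ioc`).

Fix `I < c < I_α`, with `I = I_{ψ,q}`. Far out, `w` is close to `κ^(n-1) r^(α(n-1))`, so the outer
mass of a normalized minimizing sequence costs energy at rate at least `c²`
(`exists_radius_mass_le_energy`). If `M ≤ 1` is the mass of the weak limit, then `I² M + c² (1 - M)
≤ I²`, so `M = 1` and the limit is a minimizer (`exists_normalized_minimizer`).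

For a nonnegative minimizer of mass one and energy `lam`, the first variation gives `w f' = -lam
∫_0^r f^(p-1) w`, with no constant of integration because test functions need not vanish at the pole
(`minimizer_hasDerivAt`). Thus `f` is nonincreasing and positive. A bootstrap on the singularity
exponent, started from the decay estimate, shows that `f` is bounded at the pole
(`exists_bound_near_pole`), and scaling removes `lam`. The flux expansion at `0` then makes `x ↦ f
‖x‖` a `C²` solution across the pole (`isLaneEmdenSolution_of_flux`). -/

/-- Local absolute continuity on `(0,∞)`. -/
def LocAC (f : ℝ → ℝ) : Prop :=
  ∀ a b : ℝ, 0 < a → a ≤ b → AbsolutelyContinuousOnInterval f a b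

/-- Positive continuous weights on `(0,∞)` whose inverse is integrable at infinity. -/
structure IsDecayWeight (w : ℝ → ℝ) : Prop where
  continuousOn : ContinuousOn w (Ioi 0)
  pos : ∀ r : ℝ, 0 < r → 0 < w r
  integrableOn_inv : ∀ r : ℝ, 0 < r → IntegrableOn (fun s => (w s)⁻¹) (Ioi r)

/-- The energy on a subset of the half-line. -/
noncomputable def energyOn (w f : ℝ → ℝ) (S : Set ℝ) : ℝ≥0∞ :=
  ∫⁻ r in S, ENNReal.ofReal (|deriv f r| ^ 2 * w r)

/-- The mass on a subset of the half-line. -/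
noncomputable def massOn (w : ℝ → ℝ) (p : ℝ) (f : ℝ → ℝ) (S : Set ℝ) : ℝ≥0∞ :=
  ∫⁻ r in S, ENNReal.ofReal (|f r| ^ p * w r)

/-! ### Calculus of locally absolutely continuous functions. -/

namespace LocAC

variable {f g : ℝ → ℝ}

lemma continuousOn (hf : LocAC f) : ContinuousOn f (Ioi 0) := by
  intro x hx
  have hx : 0 < x := hx
  have h := (hf (x / 2) (2 * x) (by linarith) (by linarith)).continuousOn
  rw [uIcc_of_le (by linarith)] at h
  exact (h.continuousAt (Icc_mem_nhds (by linarith) (by linarith))).continuousWithinAt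

lemma ae_differentiableAt (hf : LocAC f) : ∀ᵐ r, 0 < r → DifferentiableAt ℝ f r := by
  have h : ∀ k : ℕ, ∀ᵐ r, r ∈ uIcc ((k : ℝ) + 1)⁻¹ (k + 1) → DifferentiableAt ℝ f r := fun k =>
    (hf _ _ (by positivity)
      ((inv_le_one_of_one_le₀ (by linarith [k.cast_nonneg (α := ℝ)])).trans
        (by linarith [k.cast_nonneg (α := ℝ)]))).ae_differentiableAt
  filter_upwards [ae_all_iff.2 h] with r hr h0
  obtain ⟨k, hk⟩ := exists_nat_gt (max r r⁻¹)
  refine hr k ?_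
  rw [uIcc_of_le ((inv_le_one_of_one_le₀ (by linarith [k.cast_nonneg (α := ℝ)])).trans
        (by linarith [k.cast_nonneg (α := ℝ)]))]
  have h1 := (le_max_left r r⁻¹).trans_lt hk
  have h2 := (le_max_right r r⁻¹).trans_lt hk
  refine ⟨?_, by linarith⟩
  rw [inv_le_comm₀ (by positivity) h0]
  linarith

lemma add (hf : LocAC f) (hg : LocAC g) : LocAC (fun r => f r + g r) :=
  fun a b ha hab => (hf a b ha hab).add (hg a b ha hab)

lemma sub (hf : LocAC f) (hg : LocAC g) : LocAC (fun r => f r - g r) :=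
  fun a b ha hab => (hf a b ha hab).sub (hg a b ha hab)

lemma const_mul (hf : LocAC f) (c : ℝ) : LocAC (fun r => c * f r) :=
  fun a b ha hab => (hf a b ha hab).const_mul c

lemma abs (hf : LocAC f) : LocAC (fun r => |f r|) := by
  intro a b ha hab
  refine squeeze_zero (fun E => Finset.sum_nonneg fun _ _ => dist_nonneg) (fun E => ?_)
    (hf a b ha hab)
  exact Finset.sum_le_sum fun i _ => by
    simpa [Real.dist_eq] using abs_abs_sub_abs_le _ _

lemma const (c : ℝ) : LocAC (fun _ => c) := fun _ _ _ _ =>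
  (LipschitzWith.const c).lipschitzOnWith.absolutelyContinuousOnInterval

lemma congr (hf : LocAC f) (h : ∀ r, 0 < r → f r = g r) : LocAC g := by
  intro a b ha hab
  have := hf a b ha hab
  rw [absolutelyContinuousOnInterval_iff] at this ⊢
  intro ε hε
  obtain ⟨δ, hδ, H⟩ := this ε hε
  refine ⟨δ, hδ, fun E hE hs => ?_⟩
  refine lt_of_eq_of_lt (Finset.sum_congr rfl fun i hi => ?_) (H E hE hs)
  have h1 := hE.1 i hi
  rw [uIcc_of_le hab] at h1
  rw [h _ (ha.trans_le h1.1.1), h _ (ha.trans_le h1.2.1)]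

lemma of_contDiff (hf : ContDiff ℝ 1 f) : LocAC f := fun _ _ _ _ =>
  hf.contDiffOn.absolutelyContinuousOnInterval

lemma primitive (hg : ∀ a b, 0 < a → a ≤ b → IntervalIntegrable g volume a b) (c : ℝ) :
    LocAC (fun r => c + ∫ t in (1 : ℝ)..r, g t) := by
  refine (LocAC.const c).add fun a b ha hab => ?_
  have h := (hg (min a 1) (max b 1) (by positivity)
    ((min_le_right _ _).trans (le_max_right _ _))).absolutelyContinuousOnInterval_intervalIntegral
      (c := 1) (by
        rw [uIcc_of_le ((min_le_right _ _).trans (le_max_right _ _))]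
        exact ⟨min_le_right _ _, le_max_right _ _⟩)
  refine h.mono ?_
  rw [uIcc_of_le hab, uIcc_of_le ((min_le_right _ _).trans (le_max_right _ _))]
  exact Icc_subset_Icc (min_le_left _ _) (le_max_left _ _)

lemma deriv_primitive (hg : ∀ a b, 0 < a → a ≤ b → IntervalIntegrable g volume a b) (c : ℝ) :
    ∀ᵐ r, 0 < r → deriv (fun r => c + ∫ t in (1 : ℝ)..r, g t) r = g r := by
  have key : ∀ k : ℕ, ((k : ℝ) + 1)⁻¹ ≤ 1 ∧ (1 : ℝ) ≤ k + 1 := fun k =>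
    ⟨inv_le_one_of_one_le₀ (by linarith [k.cast_nonneg (α := ℝ)]),
      by linarith [k.cast_nonneg (α := ℝ)]⟩
  have h := fun k : ℕ => (hg ((k : ℝ) + 1)⁻¹ (k + 1) (by positivity)
    ((key k).1.trans (key k).2)).ae_hasDerivAt_integral
  filter_upwards [ae_all_iff.2 h] with r hr h0
  obtain ⟨k, hk⟩ := exists_nat_gt (max r r⁻¹)
  have h1 := (le_max_left r r⁻¹).trans_lt hk
  have h2 := (le_max_right r r⁻¹).trans_lt hk
  have hmem : r ∈ uIcc ((k : ℝ) + 1)⁻¹ (k + 1) := by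
    rw [uIcc_of_le ((key k).1.trans (key k).2)]
    refine ⟨?_, by linarith⟩
    rw [inv_le_comm₀ (by positivity) h0]
    linarith
  have := hr k hmem 1 (by rw [uIcc_of_le ((key k).1.trans (key k).2)]; exact key k)
  exact (this.const_add c).deriv

end LocAC

/-! ### Pointwise control by the energy. -/

section Bounds

variable {w f : ℝ → ℝ}

lemma IsDecayWeight.aestronglyMeasurable (hw : IsDecayWeight w) :
    AEStronglyMeasurable w (volume.restrict (Ioi 0)) :=
  hw.continuousOn.aestronglyMeasurable measurableSet_Ioi

lemma IsDecayWeight.aemeasurable_energy (hw : IsDecayWeight w) (f : ℝ → ℝ) {S : Set ℝ}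
    (hS : S ⊆ Ioi 0) :
    AEMeasurable (fun r => ENNReal.ofReal (|deriv f r| ^ 2 * w r)) (volume.restrict S) := by
  have h1 : AEMeasurable w (volume.restrict S) :=
    hw.aestronglyMeasurable.aemeasurable.mono_measure (Measure.restrict_mono hS le_rfl)
  have h2 : AEMeasurable (deriv f) (volume.restrict S) := (measurable_deriv f).aemeasurable
  exact ((h2.norm.pow_const 2).mul h1).ennreal_ofReal

/-- Cauchy–Schwarz for `f b - f a = ∫ f'`, with `f'` factored as `(1/√w) · (f'√w)`. -/
lemma ofReal_abs_sub_sq_le (hw : IsDecayWeight w) (hf : LocAC f) {a b : ℝ} (ha : 0 < a)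
    (hab : a ≤ b) :
    ENNReal.ofReal (|f b - f a|) ^ 2 ≤
      (∫⁻ r in Ioc a b, ENNReal.ofReal (w r)⁻¹) * energyOn w f (Ioc a b) := by
  have hS : Ioc a b ⊆ Ioi 0 := fun x hx => ha.trans hx.1
  have hwm : AEMeasurable w (volume.restrict (Ioc a b)) :=
    hw.aestronglyMeasurable.aemeasurable.mono_measure (Measure.restrict_mono hS le_rfl)
  have h2 : AEMeasurable (deriv f) (volume.restrict (Ioc a b)) :=
    (measurable_deriv f).aemeasurable
  have h1 : ENNReal.ofReal (|f b - f a|) ≤ ∫⁻ r in Ioc a b,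
      (ENNReal.ofReal (√(w r))⁻¹) * ENNReal.ofReal (|deriv f r| * √(w r)) := by
    rw [← (hf a b ha hab).integral_deriv_eq_sub, intervalIntegral.integral_of_le hab]
    refine (ENNReal.ofReal_le_ofReal (norm_integral_le_lintegral_norm (deriv f))).trans ?_
    refine ENNReal.ofReal_toReal_le.trans (lintegral_mono_ae ?_)
    filter_upwards [ae_restrict_mem measurableSet_Ioc] with r hr
    have hwr : 0 < √(w r) := Real.sqrt_pos.2 (hw.pos r (hS hr))
    rw [← ENNReal.ofReal_mul (by positivity), Real.norm_eq_abs]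
    refine ENNReal.ofReal_le_ofReal (le_of_eq ?_)
    field_simp
  have h3 := ENNReal.lintegral_mul_le_Lp_mul_Lq (volume.restrict (Ioc a b))
    (Real.HolderConjugate.two_two) (f := fun r => ENNReal.ofReal (√(w r))⁻¹)
    (g := fun r => ENNReal.ofReal (|deriv f r| * √(w r)))
    (hwm.sqrt.inv.ennreal_ofReal) ((h2.norm.mul hwm.sqrt).ennreal_ofReal)
  have h4 := h1.trans h3
  have e1 : ∫⁻ r in Ioc a b, ENNReal.ofReal (√(w r))⁻¹ ^ (2 : ℝ) =
      ∫⁻ r in Ioc a b, ENNReal.ofReal (w r)⁻¹ := by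
    refine setLIntegral_congr_fun measurableSet_Ioc fun r hr => ?_
    have hwr := hw.pos r (hS hr)
    rw [ENNReal.rpow_two]
    rw [← ENNReal.ofReal_pow (by positivity), inv_pow, Real.sq_sqrt hwr.le]
  have e2 : ∫⁻ r in Ioc a b, ENNReal.ofReal (|deriv f r| * √(w r)) ^ (2 : ℝ) =
      energyOn w f (Ioc a b) := by
    refine setLIntegral_congr_fun measurableSet_Ioc fun r hr => ?_
    have hwr := hw.pos r (hS hr)
    rw [ENNReal.rpow_two]
    rw [← ENNReal.ofReal_pow (by positivity), mul_pow, Real.sq_sqrt hwr.le]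
  rw [e1, e2, ← ENNReal.mul_rpow_of_nonneg _ _ (by norm_num)] at h4
  calc _ ≤ _ := pow_le_pow_left₀ (zero_le) h4 2
    _ = _ := by
      rw [← ENNReal.rpow_two, ← ENNReal.rpow_mul]
      norm_num

lemma energyOn_mono {S T : Set ℝ} (h : S ⊆ T) : energyOn w f S ≤ energyOn w f T :=
  lintegral_mono_set h

/-- Letting `b → ∞` in the oscillation estimate: vanishing at infinity turns it into a pointwise
bound. Both the decay at infinity and the growth rate at the pole come from here. -/
lemma ofReal_abs_sq_le (hw : IsDecayWeight w) (hf : LocAC f) (hf0 : Tendsto f atTop (𝓝 0))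
    {a : ℝ} (ha : 0 < a) :
    ENNReal.ofReal (|f a|) ^ 2 ≤
      (∫⁻ r in Ioi a, ENNReal.ofReal (w r)⁻¹) * weightedEnergy w f := by
  have h1 : Tendsto (fun b => ENNReal.ofReal (|f b - f a|) ^ 2) atTop
      (𝓝 (ENNReal.ofReal (|f a|) ^ 2)) := by
    have h2 : Tendsto (fun b => |f b - f a|) atTop (𝓝 (|f a|)) := by
      simpa using (hf0.sub_const (f a)).abs
    exact ENNReal.Tendsto.pow (ENNReal.tendsto_ofReal h2)
  refine le_of_tendsto h1 ?_
  filter_upwards [eventually_ge_atTop a] with b hb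
  refine (ofReal_abs_sub_sq_le hw hf ha hb).trans ?_
  gcongr
  · exact Ioc_subset_Ioi_self
  · exact energyOn_mono fun x hx => ha.trans hx.1

end Bounds

/-! ### Weak compactness in the energy space. -/

section WeakCompactness

/-- Bounded sequences in a separable Hilbert space have weakly convergent subsequences. -/
lemma exists_weakly_convergent_subseq {H : Type*} [NormedAddCommGroup H] [InnerProductSpace ℝ H]
    [CompleteSpace H] [TopologicalSpace.SeparableSpace H] (x : ℕ → H) (B : ℝ)
    (hB : ∀ k, ‖x k‖ ≤ B) :
    ∃ (y : H) (s : ℕ → ℕ), StrictMono s ∧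
      ∀ h, Tendsto (fun k => inner ℝ (x (s k)) h) atTop (𝓝 (inner ℝ y h)) := by
  obtain ⟨a, -, s, hs, ha⟩ := WeakDual.isSeqCompact_closedBall ℝ H 0 B
    (x := fun k => StrongDual.toWeakDual (InnerProductSpace.toDual ℝ H (x k))) (fun k => by
      simpa using hB k)
  refine ⟨(InnerProductSpace.toDual ℝ H).symm (WeakDual.toStrongDual a), s, hs, fun h => ?_⟩
  rw [InnerProductSpace.toDual_symm_apply]
  exact ((WeakDual.eval_continuous h).tendsto a).comp ha

variable {w f : ℝ → ℝ}

lemma sq_abs_mul_sqrt {x y : ℝ} (hy : 0 ≤ y) : (x * √y) ^ 2 = |x| ^ 2 * y := by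
  rw [mul_pow, Real.sq_sqrt hy, sq_abs]

/-- The map `f ↦ f'√w` carries the weighted energy to the unweighted `L²` norm; its inverse is
`tailPrimitive`. -/
lemma IsDecayWeight.memLp_of_energy (hw : IsDecayWeight w) (hE : weightedEnergy w f < ⊤) :
    MemLp (fun r => deriv f r * √(w r)) 2 (volume.restrict (Ioi 0)) := by
  have hm : AEStronglyMeasurable (fun r => deriv f r * √(w r)) (volume.restrict (Ioi 0)) :=
    ((measurable_deriv f).aemeasurable.mul
      hw.aestronglyMeasurable.aemeasurable.sqrt).aestronglyMeasurable
  rw [memLp_two_iff_integrable_sq hm]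
  refine ⟨hm.pow 2, ?_⟩
  rw [hasFiniteIntegral_iff_ofReal (Eventually.of_forall fun r => sq_nonneg _)]
  refine lt_of_le_of_lt (le_of_eq ?_) hE
  exact setLIntegral_congr_fun measurableSet_Ioi fun r hr => by
    rw [sq_abs_mul_sqrt (hw.pos r hr).le]

lemma IsDecayWeight.memLp_inv_sqrt (hw : IsDecayWeight w) {r : ℝ} (hr : 0 < r) :
    MemLp (fun t => (√(w t))⁻¹) 2 (volume.restrict (Ioi r)) := by
  have hwm : AEMeasurable w (volume.restrict (Ioi r)) :=
    hw.aestronglyMeasurable.aemeasurable.mono_measure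
      (Measure.restrict_mono (Ioi_subset_Ioi hr.le) le_rfl)
  have hm : AEStronglyMeasurable (fun t => (√(w t))⁻¹) (volume.restrict (Ioi r)) :=
    hwm.sqrt.inv.aestronglyMeasurable
  rw [memLp_two_iff_integrable_sq hm]
  refine (integrableOn_congr_fun (fun t ht => ?_) measurableSet_Ioi).1 (hw.integrableOn_inv r hr)
  rw [inv_pow, Real.sq_sqrt (hw.pos t (hr.trans ht)).le]

lemma IsDecayWeight.integrableOn_div_sqrt (hw : IsDecayWeight w) {h : ℝ → ℝ}
    (hh : MemLp h 2 (volume.restrict (Ioi 0))) {r : ℝ} (hr : 0 < r) :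
    IntegrableOn (fun t => h t / √(w t)) (Ioi r) := by
  have h1 : MemLp h 2 (volume.restrict (Ioi r)) :=
    hh.mono_measure (Measure.restrict_mono (Ioi_subset_Ioi hr.le) le_rfl)
  simp only [div_eq_mul_inv]
  exact h1.integrable_mul (hw.memLp_inv_sqrt hr)

lemma IsDecayWeight.integrableOn_deriv (hw : IsDecayWeight w) (hE : weightedEnergy w f < ⊤)
    {r : ℝ} (hr : 0 < r) : IntegrableOn (deriv f) (Ioi r) := by
  refine (integrableOn_congr_fun (fun t ht => ?_) measurableSet_Ioi).1
    (hw.integrableOn_div_sqrt (hw.memLp_of_energy hE) hr)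
  have := Real.sqrt_pos.2 (hw.pos t (hr.trans ht))
  field_simp

lemma LocAC.eq_neg_integral (hf : LocAC f) (hw : IsDecayWeight w)
    (hE : weightedEnergy w f < ⊤) (hf0 : Tendsto f atTop (𝓝 0)) {r : ℝ} (hr : 0 < r) :
    f r = -∫ t in Ioi r, deriv f t := by
  have h1 := intervalIntegral_tendsto_integral_Ioi r (hw.integrableOn_deriv hE hr) tendsto_id
  have h2 : Tendsto (fun b => ∫ t in r..b, deriv f t) atTop (𝓝 (0 - f r)) := by
    refine (hf0.sub_const (f r)).congr' ?_
    filter_upwards [eventually_ge_atTop r] with b hb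
    rw [(hf r b hr hb).integral_deriv_eq_sub]
  have := tendsto_nhds_unique h1 h2
  linarith

/-- The function with `f' = h / √w` vanishing at infinity. -/
noncomputable def tailPrimitive (w h : ℝ → ℝ) (r : ℝ) : ℝ :=
  -(∫ t in Ioi 1, h t / √(w t)) + ∫ t in (1 : ℝ)..r, h t / √(w t)

lemma IsDecayWeight.intervalIntegrable_div_sqrt (hw : IsDecayWeight w) {h : ℝ → ℝ}
    (hh : MemLp h 2 (volume.restrict (Ioi 0))) (a b : ℝ) (ha : 0 < a) (hab : a ≤ b) :
    IntervalIntegrable (fun t => h t / √(w t)) volume a b :=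
  (intervalIntegrable_iff_integrableOn_Ioc_of_le hab).2
    ((hw.integrableOn_div_sqrt hh ha).mono_set Ioc_subset_Ioi_self)

lemma tailPrimitive_locAC (hw : IsDecayWeight w) {h : ℝ → ℝ}
    (hh : MemLp h 2 (volume.restrict (Ioi 0))) : LocAC (tailPrimitive w h) :=
  LocAC.primitive (hw.intervalIntegrable_div_sqrt hh) _

lemma tailPrimitive_tendsto (hw : IsDecayWeight w) {h : ℝ → ℝ}
    (hh : MemLp h 2 (volume.restrict (Ioi 0))) :
    Tendsto (tailPrimitive w h) atTop (𝓝 0) := by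
  have := (intervalIntegral_tendsto_integral_Ioi 1 (hw.integrableOn_div_sqrt hh one_pos)
    tendsto_id).const_add (-(∫ t in Ioi 1, h t / √(w t)))
  rw [neg_add_cancel] at this
  exact this

lemma deriv_tailPrimitive (hw : IsDecayWeight w) {h : ℝ → ℝ}
    (hh : MemLp h 2 (volume.restrict (Ioi 0))) :
    ∀ᵐ r, 0 < r → deriv (tailPrimitive w h) r = h r / √(w r) :=
  LocAC.deriv_primitive (hw.intervalIntegrable_div_sqrt hh) _

lemma energyOn_tailPrimitive (hw : IsDecayWeight w) {h : ℝ → ℝ}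
    (hh : MemLp h 2 (volume.restrict (Ioi 0))) {S : Set ℝ} (hSm : MeasurableSet S)
    (hS : S ⊆ Ioi 0) :
    energyOn w (tailPrimitive w h) S = ∫⁻ r in S, ENNReal.ofReal (h r ^ 2) := by
  refine setLIntegral_congr_fun_ae hSm ?_
  filter_upwards [deriv_tailPrimitive hw hh] with r hr hrS
  have := hw.pos r (hS hrS)
  rw [hr (hS hrS), ← sq_abs_mul_sqrt this.le, div_mul_cancel₀ _ (Real.sqrt_pos.2 this).ne']

lemma lintegral_sq_lt_top {h : ℝ → ℝ} {μ : Measure ℝ} (hh : MemLp h 2 μ) :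
    ∫⁻ r, ENNReal.ofReal (h r ^ 2) ∂μ < ⊤ :=
  (hasFiniteIntegral_iff_ofReal (Eventually.of_forall fun _ => sq_nonneg _)).1
    hh.integrable_sq.2

/-- Weak sequential compactness of bounded subsets of the energy space: a subsequence converges
pointwise, and the energy on any measurable set is lower semicontinuous along it. -/
theorem exists_subseq_tendsto_of_energy_le (hw : IsDecayWeight w) (φ : ℕ → ℝ → ℝ)
    (hφ : ∀ k, LocAC (φ k)) (hφ0 : ∀ k, Tendsto (φ k) atTop (𝓝 0)) (B : ℝ≥0∞) (hB : B < ⊤)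
    (hE : ∀ k, weightedEnergy w (φ k) ≤ B) :
    ∃ (f : ℝ → ℝ) (s : ℕ → ℕ), StrictMono s ∧ LocAC f ∧ Tendsto f atTop (𝓝 0) ∧
      weightedEnergy w f < ⊤ ∧
      (∀ r, 0 < r → Tendsto (fun k => φ (s k) r) atTop (𝓝 (f r))) ∧
      ∀ S : Set ℝ, MeasurableSet S → S ⊆ Ioi 0 →
        energyOn w f S ≤ liminf (fun k => energyOn w (φ (s k)) S) atTop := by
  have hEt : ∀ k, weightedEnergy w (φ k) < ⊤ := fun k => (hE k).trans_lt hB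
  have hm := fun k => hw.memLp_of_energy (hEt k)
  have : Fact ((1 : ℝ≥0∞) ≤ 2) := ⟨one_le_two⟩
  have : Fact ((2 : ℝ≥0∞) ≠ ⊤) := ⟨ENNReal.ofNat_ne_top⟩
  let x : ℕ → Lp ℝ 2 (volume.restrict (Ioi (0 : ℝ))) := fun k => (hm k).toLp _
  have hnorm : ∀ k, ‖x k‖ ≤ √B.toReal := by
    intro k
    refine Real.le_sqrt_of_sq_le ?_
    rw [← real_inner_self_eq_norm_sq, L2.inner_def]
    have h1 : ∫ r, inner ℝ (x k r) (x k r) ∂(volume.restrict (Ioi (0 : ℝ))) =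
        ∫ r in Ioi 0, |deriv (φ k) r| ^ 2 * w r := by
      refine integral_congr_ae ?_
      filter_upwards [(hm k).coeFn_toLp, ae_restrict_mem measurableSet_Ioi] with r hr hr0
      simp only [x]
      rw [hr, real_inner_self_eq_norm_sq, Real.norm_eq_abs, sq_abs,
        sq_abs_mul_sqrt (hw.pos r hr0).le]
    rw [h1, integral_eq_lintegral_of_nonneg_ae]
    · exact ENNReal.toReal_mono hB.ne (hE k)
    · filter_upwards [ae_restrict_mem measurableSet_Ioi] with r hr
      have := (hw.pos r hr).le
      positivity
    · exact (((measurable_deriv (φ k)).norm.pow_const 2).aemeasurable.mul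
        hw.aestronglyMeasurable.aemeasurable).aestronglyMeasurable
  obtain ⟨y, s, hs, hy⟩ := exists_weakly_convergent_subseq x _ hnorm
  have hyL : MemLp y 2 (volume.restrict (Ioi 0)) := Lp.memLp y
  have hfin : weightedEnergy w (tailPrimitive w y) < ⊤ := by
    have := energyOn_tailPrimitive hw hyL measurableSet_Ioi (subset_refl (Ioi 0))
    exact this.trans_lt (lintegral_sq_lt_top hyL)
  -- testing against explicit functions
  have htest : ∀ g : ℝ → ℝ, MemLp g 2 (volume.restrict (Ioi 0)) →
      Tendsto (fun k => ∫ r in Ioi 0, (deriv (φ (s k)) r * √(w r)) * g r) atTop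
        (𝓝 (∫ r in Ioi 0, y r * g r)) := by
    intro g hg
    have h1 := hy (hg.toLp g)
    simp only [L2.inner_def] at h1
    convert h1 using 2 with k
    · refine integral_congr_ae ?_
      filter_upwards [(hm (s k)).coeFn_toLp, hg.coeFn_toLp] with r hr hr'
      simp only [x]
      rw [hr, hr']
      simp [mul_comm]
    · refine integral_congr_ae ?_
      filter_upwards [hg.coeFn_toLp] with r hr'
      rw [hr']
      simp [mul_comm]
  refine ⟨tailPrimitive w y, s, hs, tailPrimitive_locAC hw hyL, tailPrimitive_tendsto hw hyL,
    hfin, fun r hr => ?_, fun S hSm hS => ?_⟩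
  -- Evaluation at `r` is, up to sign, the `L²` pairing of `f'√w` with `1_{(r,∞)}/√w`, so weak
  -- convergence implies pointwise convergence.
  · have hg : MemLp ((Ioi r).indicator fun t => (√(w t))⁻¹) 2 (volume.restrict (Ioi 0)) := by
      rw [memLp_indicator_iff_restrict measurableSet_Ioi, Measure.restrict_restrict
        measurableSet_Ioi, inter_eq_left.2 (Ioi_subset_Ioi hr.le)]
      exact hw.memLp_inv_sqrt hr
    have hint : ∀ h : ℝ → ℝ, ∫ t in Ioi 0, h t * (Ioi r).indicator (fun t => (√(w t))⁻¹) t =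
        ∫ t in Ioi r, h t / √(w t) := by
      intro h
      rw [← inter_eq_left.2 (Ioi_subset_Ioi hr.le), inter_comm,
        ← setIntegral_indicator measurableSet_Ioi, inter_comm,
        inter_eq_left.2 (Ioi_subset_Ioi hr.le)]
      refine integral_congr_ae (Eventually.of_forall fun t => ?_)
      by_cases ht : t ∈ Ioi r <;> simp [ht, div_eq_mul_inv]
    have h2 := (htest _ hg).neg
    simp only [hint] at h2
    have e1 : tailPrimitive w y r = -∫ t in Ioi r, y t / √(w t) := by
      rw [(tailPrimitive_locAC hw hyL).eq_neg_integral hw hfin (tailPrimitive_tendsto hw hyL) hr]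
      congr 1
      refine setIntegral_congr_ae measurableSet_Ioi ?_
      filter_upwards [deriv_tailPrimitive hw hyL] with t ht htr
      exact ht (hr.trans htr)
    rw [e1]
    refine h2.congr fun k => ?_
    rw [(hφ (s k)).eq_neg_integral hw (hEt _) (hφ0 _) hr]
    congr 1
    refine setIntegral_congr_fun measurableSet_Ioi fun t ht => ?_
    have := Real.sqrt_pos.2 (hw.pos t (hr.trans ht))
    field_simp
  · have hg : MemLp (S.indicator y) 2 (volume.restrict (Ioi 0)) := hyL.indicator hSm
    have hyS : MemLp y 2 (volume.restrict S) := hyL.mono_measure (Measure.restrict_mono hS le_rfl)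
    have hint : ∀ h : ℝ → ℝ, ∫ t in Ioi 0, h t * S.indicator y t = ∫ t in S, h t * y t := by
      intro h
      conv_rhs => rw [← inter_eq_right.2 hS, ← setIntegral_indicator hSm]
      refine integral_congr_ae (Eventually.of_forall fun t => ?_)
      by_cases ht : t ∈ S <;> simp [ht]
    -- Lower semicontinuity from `2⟨x_k, y⟩ - ‖y‖² ≤ ‖x_k‖²` on `S`, whose left side converges to
    -- `‖y‖²`.
    have h2 := ENNReal.tendsto_ofReal
      (((htest _ hg).const_mul 2).sub_const (∫ t in S, y t * y t))
    simp only [hint] at h2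
    have e1 : energyOn w (tailPrimitive w y) S =
        ENNReal.ofReal (2 * (∫ t in S, y t * y t) - ∫ t in S, y t * y t) := by
      rw [energyOn_tailPrimitive hw hyL hSm hS, two_mul, add_sub_cancel_right,
        ofReal_integral_eq_lintegral_ofReal]
      · simp only [sq]
      · simpa only [sq] using hyS.integrable_sq
      · exact Eventually.of_forall fun t => mul_self_nonneg _
    rw [e1, ← h2.liminf_eq]
    refine liminf_le_liminf (Eventually.of_forall fun k => ?_)
    have hk : MemLp (fun r => deriv (φ (s k)) r * √(w r)) 2 (volume.restrict S) :=
      (hm (s k)).mono_measure (Measure.restrict_mono hS le_rfl)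
    have e2 : energyOn w (φ (s k)) S =
        ENNReal.ofReal (∫ t in S, (deriv (φ (s k)) t * √(w t)) ^ 2) := by
      rw [ofReal_integral_eq_lintegral_ofReal hk.integrable_sq
        (Eventually.of_forall fun t => sq_nonneg _)]
      exact setLIntegral_congr_fun hSm fun r hr => by
        rw [sq_abs_mul_sqrt (hw.pos r (hS hr)).le]
    rw [e2]
    refine ENNReal.ofReal_le_ofReal ?_
    rw [← integral_const_mul, ← integral_sub]
    · refine integral_mono ?_ hk.integrable_sq fun t => ?_
      · exact ((hk.integrable_mul hyS).const_mul 2).sub (hyS.integrable_mul hyS)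
      · dsimp only
        nlinarith [sq_nonneg (deriv (φ (s k)) t * √(w t) - y t)]
    · exact (hk.integrable_mul hyS).const_mul 2
    · exact hyS.integrable_mul hyS

end WeakCompactness

/-! ### Radial test functions and their density. -/

section RadialFunctions

variable {n : ℕ} {w f φ : ℝ → ℝ}

/-- Restricting the radial function to a line through the origin gives `Φ r = φ |r|`, a `C¹`
function on all of `ℝ`; the values of `φ` on the negative axis carry no information. -/
lemma IsRadialC1c.exists_contDiff (hn : 1 ≤ n) (hφ : IsRadialC1c n φ) :
    ∃ Φ : ℝ → ℝ, ContDiff ℝ 1 Φ ∧ (∃ R : ℝ, 0 < R ∧ ∀ r, R ≤ r → Φ r = 0) ∧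
      ∀ r, 0 ≤ r → Φ r = φ r := by
  obtain ⟨h1, h2⟩ := hφ
  let e : EuclideanSpace ℝ (Fin n) := EuclideanSpace.single ⟨0, hn⟩ 1
  have he : ‖e‖ = 1 := by simp [e]
  refine ⟨fun r => φ ‖r • e‖, h1.comp (contDiff_id.smul contDiff_const), ?_, fun r hr => ?_⟩
  · obtain ⟨R, hR⟩ := h2.isCompact.isBounded.subset_closedBall 0
    refine ⟨max R 0 + 1, by positivity, fun r hr => ?_⟩
    by_contra hne
    have h3 : r • e ∈ tsupport fun x : EuclideanSpace ℝ (Fin n) => φ ‖x‖ :=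
      subset_tsupport _ hne
    have h4 := hR h3
    rw [mem_closedBall_zero_iff, norm_smul, he, mul_one, Real.norm_eq_abs] at h4
    linarith [le_abs_self r, le_max_left R 0]
  · simp [norm_smul, he, abs_of_nonneg hr]

/-- The norm fails to be smooth only at the origin, and there constancy of the profile takes over.
-/
lemma isRadialC1c_of_contDiff (hφ : ContDiff ℝ 1 φ) {ε c R : ℝ} (hε : 0 < ε)
    (h0 : ∀ r, r < ε → φ r = c) (hR : ∀ r, R ≤ r → φ r = 0) : IsRadialC1c n φ := by
  constructor
  · rw [contDiff_iff_contDiffAt]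
    intro x
    by_cases hx : x = 0
    · refine (contDiffAt_const (c := c)).congr_of_eventuallyEq ?_
      have : ∀ᶠ y : EuclideanSpace ℝ (Fin n) in 𝓝 x, ‖y‖ < ε := by
        subst hx
        exact (continuous_norm.tendsto' 0 0 norm_zero).eventually (gt_mem_nhds hε)
      filter_upwards [this] with y hy using h0 _ hy
    · exact hφ.contDiffAt.comp x (contDiffAt_norm ℝ hx)
  · refine HasCompactSupport.intro (isCompact_closedBall 0 R) fun x hx => hR _ ?_
    rw [mem_closedBall_zero_iff, not_le] at hx
    exact hx.le

lemma deriv_eq_of_eqOn_Ioi {Φ : ℝ → ℝ} (h : ∀ r, 0 ≤ r → Φ r = φ r) {r : ℝ} (hr : 0 < r) :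
    deriv Φ r = deriv φ r :=
  Filter.EventuallyEq.deriv_eq (by
    filter_upwards [lt_mem_nhds hr] with s hs using h s hs.le)

lemma IsRadialC1c.locAC (hn : 1 ≤ n) (hφ : IsRadialC1c n φ) : LocAC φ := by
  obtain ⟨Φ, h1, -, h3⟩ := hφ.exists_contDiff hn
  exact (LocAC.of_contDiff h1).congr fun r hr => h3 r hr.le

lemma IsRadialC1c.tendsto_zero (hn : 1 ≤ n) (hφ : IsRadialC1c n φ) :
    Tendsto φ atTop (𝓝 0) := by
  obtain ⟨Φ, h1, ⟨R, hR0, hR⟩, h3⟩ := hφ.exists_contDiff hn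
  refine tendsto_const_nhds.congr' ?_
  filter_upwards [eventually_ge_atTop R] with r hr
  rw [← h3 r (hR0.le.trans hr), hR r hr]

lemma IsRadialC1c.energy_lt_top (hn : 1 ≤ n) (hφ : IsRadialC1c n φ) (hw : IsDecayWeight w)
    (hw0 : ∀ R, IntegrableOn w (Ioc 0 R)) : weightedEnergy w φ < ⊤ := by
  obtain ⟨Φ, h1, ⟨R, hR0, hR⟩, h3⟩ := hφ.exists_contDiff hn
  obtain ⟨C, hC⟩ := (isCompact_Icc (a := 0) (b := R)).exists_bound_of_continuousOn
    (contDiff_one_iff_deriv.1 h1).2.continuousOn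
  have h4 : weightedEnergy w φ ≤ ∫⁻ r in Ioc 0 R, ENNReal.ofReal (C ^ 2 * w r) := by
    unfold weightedEnergy
    rw [← lintegral_indicator measurableSet_Ioi, ← lintegral_indicator measurableSet_Ioc]
    refine lintegral_mono_ae ?_
    filter_upwards [(measure_eq_zero_iff_ae_notMem (μ := volume) (s := {R})).1 (by simp)]
      with r hrR
    by_cases hr : r ∈ Ioi 0
    · have hr0 : 0 < r := hr
      have hwr := hw.pos r hr
      rw [indicator_of_mem hr, ← deriv_eq_of_eqOn_Ioi h3 hr]
      by_cases hr' : r ≤ R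
      · rw [indicator_of_mem (show r ∈ Ioc 0 R from ⟨hr, hr'⟩)]
        refine ENNReal.ofReal_le_ofReal ?_
        have := hC r ⟨hr0.le, hr'⟩
        rw [Real.norm_eq_abs] at this
        gcongr
      · have : deriv Φ r = 0 := by
          have : Φ =ᶠ[𝓝 r] fun _ => 0 := by
            filter_upwards [lt_mem_nhds (not_le.1 hr')] with s hs using hR s hs.le
          rw [this.deriv_eq, deriv_const]
        simp [this]
    · rw [indicator_of_notMem hr]
      exact zero_le
  refine h4.trans_lt ?_
  have h5 := ((hw0 R).const_mul (C ^ 2)).2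
  rwa [hasFiniteIntegral_iff_ofReal] at h5
  filter_upwards [ae_restrict_mem measurableSet_Ioc] with r hr
  have := hw.pos r hr.1
  positivity

lemma IsDecayWeight.tendsto_tail (hw : IsDecayWeight w) :
    Tendsto (fun a => ∫⁻ r in Ioi a, ENNReal.ofReal (w r)⁻¹) atTop (𝓝 0) := by
  have h1 : Tendsto (fun a => ENNReal.ofReal (∫ r in Ioi a, (w r)⁻¹)) atTop (𝓝 0) := by
    have := ENNReal.tendsto_ofReal
      (tendsto_integral_Ioi_zero (f := fun r => (w r)⁻¹) (μ := volume) tendsto_id)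
    simpa using this
  refine h1.congr' ?_
  filter_upwards [eventually_gt_atTop 0] with a ha
  rw [ofReal_integral_eq_lintegral_ofReal (hw.integrableOn_inv a ha)]
  filter_upwards [ae_restrict_mem measurableSet_Ioi] with r hr
  exact inv_nonneg.2 (hw.pos r (ha.trans hr)).le

lemma ofReal_sq_add_le {a b W : ℝ} (hW : 0 ≤ W) :
    ENNReal.ofReal (|a + b| ^ 2 * W) ≤
      2 * ENNReal.ofReal (|a| ^ 2 * W) + 2 * ENNReal.ofReal (|b| ^ 2 * W) := by
  rw [← ENNReal.ofReal_ofNat 2, ← ENNReal.ofReal_mul (by norm_num),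
    ← ENNReal.ofReal_mul (by norm_num), ← ENNReal.ofReal_add (by positivity) (by positivity)]
  refine ENNReal.ofReal_le_ofReal ?_
  simp only [sq_abs]
  nlinarith [mul_nonneg (sq_nonneg (a - b)) hW]

lemma LocAC.energy_add_le (hw : IsDecayWeight w) {g : ℝ → ℝ} (hf : LocAC f) (hg : LocAC g) :
    weightedEnergy w (fun r => f r + g r) ≤ 2 * weightedEnergy w f + 2 * weightedEnergy w g := by
  unfold weightedEnergy
  rw [← lintegral_const_mul' _ _ ENNReal.ofNat_ne_top,
    ← lintegral_const_mul' _ _ ENNReal.ofNat_ne_top,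
    ← lintegral_add_left' ((hw.aemeasurable_energy f subset_rfl).const_mul 2)]
  refine lintegral_mono_ae ?_
  filter_upwards [ae_restrict_mem measurableSet_Ioi,
    ae_restrict_of_ae hf.ae_differentiableAt, ae_restrict_of_ae hg.ae_differentiableAt]
    with r hr h1 h2
  rw [deriv_fun_add (h1 hr) (h2 hr)]
  exact ofReal_sq_add_le (hw.pos r hr).le

/-- Truncations away from `0` and `∞` converge in `L²`. -/
lemma exists_lintegral_compl_lt {H : ℝ → ℝ} (hH : MemLp H 2 (volume.restrict (Ioi 0)))
    {ε : ℝ≥0∞} (hε : 0 < ε) :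
    ∃ δ R : ℝ, 0 < δ ∧ δ < R ∧
      ∫⁻ r in Ioi 0 \ Icc δ R, ENNReal.ofReal (H r ^ 2) < ε := by
  have hm : AEMeasurable (fun r => ENNReal.ofReal (H r ^ 2)) (volume.restrict (Ioi 0)) :=
    (hH.1.aemeasurable.pow_const 2).ennreal_ofReal
  have h1 : Tendsto (fun k : ℕ => ∫⁻ r in Ioi 0,
      (Icc ((k : ℝ) + 2)⁻¹ (k + 2))ᶜ.indicator (fun r => ENNReal.ofReal (H r ^ 2)) r)
      atTop (𝓝 (∫⁻ _ in Ioi (0 : ℝ), 0)) := by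
    refine tendsto_lintegral_of_dominated_convergence' (fun r => ENNReal.ofReal (H r ^ 2))
      (fun k => hm.indicator measurableSet_Icc.compl)
      (fun k => Eventually.of_forall fun r => indicator_le_self _ _ _)
      (lintegral_sq_lt_top hH).ne ?_
    filter_upwards [ae_restrict_mem measurableSet_Ioi] with r hr
    have hr : 0 < r := hr
    refine tendsto_const_nhds.congr' ?_
    obtain ⟨K, hK⟩ := exists_nat_gt (max r r⁻¹)
    have h1 := (le_max_left r r⁻¹).trans_lt hK
    have h2 := (le_max_right r r⁻¹).trans_lt hK
    filter_upwards [eventually_ge_atTop K] with k hk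
    have hk' : (K : ℝ) ≤ k := by exact_mod_cast hk
    rw [indicator_of_notMem]
    simp only [mem_compl_iff, not_not]
    refine ⟨?_, by linarith⟩
    rw [inv_le_comm₀ (by positivity) hr]
    linarith
  simp only [lintegral_zero] at h1
  obtain ⟨k, hk⟩ := (h1.eventually (gt_mem_nhds hε)).exists
  refine ⟨((k : ℝ) + 2)⁻¹, k + 2, by positivity, ?_, ?_⟩
  · have : ((k : ℝ) + 2)⁻¹ < 1 := inv_lt_one_of_one_lt₀ (by linarith [k.cast_nonneg (α := ℝ)])
    linarith [k.cast_nonneg (α := ℝ)]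
  · rwa [sdiff_eq, inter_comm, ← Measure.restrict_restrict measurableSet_Icc.compl,
      ← lintegral_indicator measurableSet_Icc.compl]

/-- The compactly supported `C¹` functions which are constant near the pole are dense. -/
lemma exists_contDiff_energy_sub_le (hw : IsDecayWeight w)
    (hE : weightedEnergy w f < ⊤) {ε : ℝ≥0∞} (hε : 0 < ε) :
    ∃ φ : ℝ → ℝ, IsRadialC1c n φ ∧ ContDiff ℝ 1 φ ∧ (∃ R : ℝ, ∀ r, R ≤ r → φ r = 0) ∧
      ∫⁻ r in Ioi (0 : ℝ), ENNReal.ofReal (|deriv φ r - deriv f r| ^ 2 * w r) ≤ ε := by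
  set H : ℝ → ℝ := fun r => deriv f r * √(w r) with hH
  have hHL : MemLp H 2 (volume.restrict (Ioi 0)) := hw.memLp_of_energy hE
  have hε4 : 0 < ε / 4 := ENNReal.div_pos hε.ne' (by norm_num)
  obtain ⟨δ, R, hδ, hδR, htail⟩ := exists_lintegral_compl_lt hHL hε4
  have hI : Icc δ R ⊆ Ioi 0 := fun x hx => hδ.trans_le hx.1
  have hH1 : MemLp ((Icc δ R).indicator H) 2 volume := by
    rw [memLp_indicator_iff_restrict measurableSet_Icc]
    exact hHL.mono_measure (Measure.restrict_mono hI le_rfl)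
  obtain ⟨h, hhc, hhε, hhcont, hhL⟩ := hH1.exists_hasCompactSupport_eLpNorm_sub_le
    (by norm_num) (ε := (ε / 4) ^ (1 / 2 : ℝ))
    (by simp [hε4.ne'])
  have happ : ∫⁻ r, ENNReal.ofReal (((Icc δ R).indicator H r - h r) ^ 2) ≤ ε / 4 := by
    rw [eLpNorm_eq_lintegral_rpow_enorm_toReal (by norm_num) (by norm_num)] at hhε
    have := (ENNReal.rpow_le_rpow_iff (by norm_num)).1 hhε
    refine le_trans (le_of_eq (lintegral_congr fun r => ?_)) this
    rw [Pi.sub_apply, ← ofReal_norm, ENNReal.toReal_ofNat, ENNReal.rpow_two,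
      ← ENNReal.ofReal_pow (norm_nonneg _), Real.norm_eq_abs, sq_abs]
  obtain ⟨R', hR'⟩ := hhc.isCompact.isBounded.subset_closedBall 0
  have hhR : ∀ r, max R' 0 + 1 ≤ r → h r = 0 := by
    intro r hr
    by_contra hne
    have := hR' (subset_tsupport h hne)
    rw [mem_closedBall_zero_iff, Real.norm_eq_abs] at this
    linarith [le_abs_self r, le_max_left R' 0]
  -- The density `h` must be divided by `√w`, which is controlled only on `(0,∞)`. The cutoff equals
  -- `1` on `[δ,∞)`, leaving the approximation there intact, and `0` below `δ/2`, which also makes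
  -- the primitive constant near the pole.
  set χ : ℝ → ℝ := fun t => max 0 (min 1 (2 / δ * t - 1)) with hχ
  have hχc : Continuous χ := by fun_prop
  have hχ0 : ∀ t, 0 ≤ χ t := fun t => le_max_left _ _
  have hχ1 : ∀ t, χ t ≤ 1 := fun t => max_le zero_le_one (min_le_left _ _)
  have hχδ : ∀ t, δ ≤ t → χ t = 1 := by
    intro t ht
    have : 2 ≤ 2 / δ * t := by rw [div_mul_eq_mul_div, le_div_iff₀ hδ]; linarith
    simp only [χ]
    rw [min_eq_left (by linarith), max_eq_right zero_le_one]
  have hχz : ∀ t, t < δ / 2 → χ t = 0 := by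
    intro t ht
    have : 2 / δ * t ≤ 1 := by rw [div_mul_eq_mul_div, div_le_one hδ]; linarith
    simp only [χ]
    exact max_eq_left ((min_le_right _ _).trans (by linarith))
  set g : ℝ → ℝ := fun t => χ t * h t / √(w t) with hg
  have hgc : Continuous g := by
    rw [continuous_iff_continuousAt]
    intro t
    rcases lt_or_ge t (δ / 2) with ht | ht
    · refine (continuousAt_const (y := (0 : ℝ))).congr ?_
      filter_upwards [gt_mem_nhds ht] with s hs
      simp [g, hχz s hs]
    · have ht0 : 0 < t := by linarith
      exact (hχc.mul hhcont).continuousAt.div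
        ((hw.continuousOn.continuousAt (Ioi_mem_nhds ht0)).sqrt)
        (Real.sqrt_pos.2 (hw.pos t ht0)).ne'
  set b := max R' 0 + 1 with hb
  have hφ' : ∀ r, HasDerivAt (fun r => ∫ t in b..r, g t) (g r) r := fun r =>
    intervalIntegral.integral_hasDerivAt_right (hgc.intervalIntegrable _ _)
      (hgc.stronglyMeasurableAtFilter _ _) hgc.continuousAt
  have hφd : deriv (fun r => ∫ t in b..r, g t) = g := funext fun r => (hφ' r).deriv
  have hφC : ContDiff ℝ 1 (fun r => ∫ t in b..r, g t) :=
    contDiff_one_iff_deriv.2 ⟨fun r => (hφ' r).differentiableAt, by rwa [hφd]⟩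
  have hφR : ∀ r, b ≤ r → ∫ t in b..r, g t = 0 := by
    intro r hr
    rw [intervalIntegral.integral_congr (g := fun _ => 0) (fun t ht => ?_)]
    · simp
    · rw [uIcc_of_le hr] at ht
      simp [g, hhR t ht.1]
  refine ⟨fun r => ∫ t in b..r, g t, isRadialC1c_of_contDiff (ε := δ / 2)
    (c := ∫ t in b..0, g t) hφC (by positivity) (fun r hr => ?_) hφR, hφC, ⟨b, hφR⟩, ?_⟩
  · rw [← intervalIntegral.integral_add_adjacent_intervals (b := 0) (hgc.intervalIntegrable _ _)
      (hgc.intervalIntegrable _ _), intervalIntegral.integral_congr (g := fun _ => 0)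
      (a := 0) (b := r) (fun t ht => ?_)]
    · simp
    · have : t < δ / 2 := lt_of_le_of_lt ht.2 (by simp [hr, hδ])
      simp [g, hχz t this]
  · rw [hφd]
    have hpt : ∀ r ∈ Ioi (0 : ℝ), ENNReal.ofReal (|g r - deriv f r| ^ 2 * w r) ≤
        2 * ENNReal.ofReal (((Icc δ R).indicator H r - h r) ^ 2) +
        2 * (Icc δ R)ᶜ.indicator (fun r => ENNReal.ofReal (H r ^ 2)) r := by
      intro r hr
      have hwr := hw.pos r hr
      have hsq := Real.sqrt_pos.2 hwr
      have e1 : |g r - deriv f r| ^ 2 * w r = (χ r * h r - H r) ^ 2 := by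
        rw [← sq_abs_mul_sqrt hwr.le]
        congr 1
        simp only [g, H]
        field_simp
      rw [e1]
      by_cases hrI : r ∈ Icc δ R
      · rw [indicator_of_mem hrI, indicator_of_notMem (by simpa using hrI), mul_zero, add_zero,
          hχδ r hrI.1, one_mul, two_mul]
        refine le_trans (le_of_eq ?_) (le_add_of_nonneg_right zero_le)
        congr 1
        ring
      · rw [indicator_of_notMem hrI, indicator_of_mem (by simpa using hrI),
          ← ENNReal.ofReal_ofNat 2, ← ENNReal.ofReal_mul (by norm_num),
          ← ENNReal.ofReal_mul (by norm_num),
          ← ENNReal.ofReal_add (by positivity) (by positivity)]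
        refine ENNReal.ofReal_le_ofReal ?_
        have h1 : (χ r * h r) ^ 2 ≤ h r ^ 2 := by
          rw [mul_pow]
          exact mul_le_of_le_one_left (sq_nonneg _) (pow_le_one₀ (hχ0 r) (hχ1 r))
        nlinarith [sq_nonneg (χ r * h r + H r)]
    have hm1 : AEMeasurable (fun r => ENNReal.ofReal (((Icc δ R).indicator H r - h r) ^ 2))
        (volume.restrict (Ioi 0)) :=
      (((hH1.1.aemeasurable.sub hhcont.aemeasurable).pow_const 2).ennreal_ofReal).restrict
    calc _ ≤ ∫⁻ r in Ioi 0, (2 * ENNReal.ofReal (((Icc δ R).indicator H r - h r) ^ 2) +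
        2 * (Icc δ R)ᶜ.indicator (fun r => ENNReal.ofReal (H r ^ 2)) r) :=
          setLIntegral_mono' measurableSet_Ioi hpt
      _ = 2 * (∫⁻ r in Ioi 0, ENNReal.ofReal (((Icc δ R).indicator H r - h r) ^ 2)) +
          2 * ∫⁻ r in Ioi 0 \ Icc δ R, ENNReal.ofReal (H r ^ 2) := by
        rw [lintegral_add_left' (hm1.const_mul 2), lintegral_const_mul' _ _ ENNReal.ofNat_ne_top,
          lintegral_const_mul' _ _ ENNReal.ofNat_ne_top,
          lintegral_indicator measurableSet_Icc.compl,
          Measure.restrict_restrict measurableSet_Icc.compl, sdiff_eq, inter_comm]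
      _ ≤ 2 * (ε / 4) + 2 * (ε / 4) := by
        gcongr
        exact (setLIntegral_le_lintegral _ _).trans happ
      _ = ε := by
        rw [← two_mul, ← mul_assoc, show (2 : ℝ≥0∞) * 2 = 4 by norm_num,
          ENNReal.mul_div_cancel (by norm_num) (by norm_num)]

end RadialFunctions

/-! ### Intrinsic description of `D^{1,2}_rad`. -/

section EnergySpace

variable {n : ℕ} {ψ f : ℝ → ℝ}

/-- Density supplies approximants in energy. Their differences from `f` vanish at infinity, so the
tail estimate upgrades this to convergence of the values. -/
lemma mem_D12rad_of_energy_lt_top (hw : IsDecayWeight fun r => ψ r ^ (n - 1)) (hf : LocAC f)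
    (hE : weightedEnergy (fun r => ψ r ^ (n - 1)) f < ⊤) (hf0 : Tendsto f atTop (𝓝 0)) :
    f ∈ D12rad n ψ := by
  have h := fun k : ℕ => exists_contDiff_energy_sub_le (n := n) hw hE
    (ε := ((k : ℝ≥0∞) + 1)⁻¹) (by simp)
  choose φ hφ hφC hφR hφE using h
  have hlim : Tendsto (fun k : ℕ => ((k : ℝ≥0∞) + 1)⁻¹) atTop (𝓝 0) := by
    simpa using (tendsto_add_atTop_iff_nat 1).2 ENNReal.tendsto_inv_nat_nhds_zero
  refine ⟨hf, φ, hφ, tendsto_of_tendsto_of_tendsto_of_le_of_le tendsto_const_nhds hlim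
    (fun _ => zero_le) hφE, fun r hr => ?_⟩
  have hAC := fun k => (LocAC.of_contDiff (hφC k)).sub hf
  have h0 : ∀ k, Tendsto (fun r => φ k r - f r) atTop (𝓝 0) := by
    intro k
    obtain ⟨R, hR⟩ := hφR k
    have : Tendsto (φ k) atTop (𝓝 0) := tendsto_const_nhds.congr' (by
      filter_upwards [eventually_ge_atTop R] with r hr using (hR r hr).symm)
    simpa using this.sub hf0
  have hEk : ∀ k, weightedEnergy (fun r => ψ r ^ (n - 1)) (fun r => φ k r - f r) ≤
      ((k : ℝ≥0∞) + 1)⁻¹ := by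
    intro k
    refine le_trans (le_of_eq ?_) (hφE k)
    refine setLIntegral_congr_fun_ae measurableSet_Ioi ?_
    filter_upwards [hf.ae_differentiableAt] with s hs hs0
    rw [deriv_fun_sub (((hφC k).differentiable one_ne_zero) s) (hs hs0)]
  have hV : ∫⁻ s in Ioi r, ENNReal.ofReal (ψ s ^ (n - 1))⁻¹ ≠ ⊤ := by
    have := (hw.integrableOn_inv r hr).2
    rw [hasFiniteIntegral_iff_ofReal] at this
    · exact this.ne
    · filter_upwards [ae_restrict_mem measurableSet_Ioi] with s hs
      exact inv_nonneg.2 (hw.pos s (hr.trans hs)).le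
  have h1 : Tendsto (fun k => ENNReal.ofReal |φ k r - f r| ^ 2) atTop (𝓝 0) := by
    refine tendsto_of_tendsto_of_tendsto_of_le_of_le tendsto_const_nhds
      (h := fun k : ℕ => (∫⁻ s in Ioi r, ENNReal.ofReal (ψ s ^ (n - 1))⁻¹) *
        ((k : ℝ≥0∞) + 1)⁻¹) ?_ (fun _ => zero_le) fun k => ?_
    · simpa using ENNReal.Tendsto.const_mul hlim (Or.inr hV)
    · exact (ofReal_abs_sq_le hw (hAC k) (h0 k) hr).trans (mul_le_mul_right (hEk k) _)
  have h2 : Tendsto (fun k => (φ k r - f r) ^ 2) atTop (𝓝 0) := by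
    have := (ENNReal.tendsto_toReal ENNReal.zero_ne_top).comp h1
    simpa [Function.comp_def] using this
  have h3 := h2.sqrt
  simp only [Real.sqrt_sq_eq_abs, Real.sqrt_zero] at h3
  have h4 := (tendsto_zero_iff_abs_tendsto_zero _).2 h3
  simpa using h4.add_const (f r)

/-- Vanishing at infinity is the point of the forward direction: the approximants satisfy a uniform
bound by the tail of `∫ 1/w`, which survives the pointwise limit and rules out additive constants.
-/
theorem mem_D12rad_iff (hn : 1 ≤ n) (hw : IsDecayWeight fun r => ψ r ^ (n - 1))
    (hw0 : ∀ R, IntegrableOn (fun r => ψ r ^ (n - 1)) (Ioc 0 R)) :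
    f ∈ D12rad n ψ ↔ LocAC f ∧ weightedEnergy (fun r => ψ r ^ (n - 1)) f < ⊤ ∧
      Tendsto f atTop (𝓝 0) := by
  refine ⟨?_, fun h => mem_D12rad_of_energy_lt_top hw h.1 h.2.1 h.2.2⟩
  rintro ⟨hf, φ, hφ, hlim, hpt⟩
  replace hf : LocAC f := hf
  have hEadd : ∀ k, weightedEnergy (fun r => ψ r ^ (n - 1)) (fun r => φ k r - f r) =
      ∫⁻ r in Ioi (0 : ℝ),
        ENNReal.ofReal (|deriv (φ k) r - deriv f r| ^ 2 * ψ r ^ (n - 1)) := by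
    intro k
    refine setLIntegral_congr_fun_ae measurableSet_Ioi ?_
    filter_upwards [hf.ae_differentiableAt, ((hφ k).locAC hn).ae_differentiableAt]
      with s hs hs' hs0
    rw [deriv_fun_sub (hs' hs0) (hs hs0)]
  obtain ⟨K, hK⟩ := eventually_atTop.1 (hlim.eventually (gt_mem_nhds one_pos))
  have hd : ∀ k, K ≤ k →
      weightedEnergy (fun r => ψ r ^ (n - 1)) (fun r => φ k r - f r) ≤ 1 := fun k hk => by
    rw [hEadd]; exact (hK k hk).le
  have hneg : ∀ g : ℝ → ℝ, weightedEnergy (fun r => ψ r ^ (n - 1)) (fun r => -1 * g r) =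
      weightedEnergy (fun r => ψ r ^ (n - 1)) g := fun g =>
    lintegral_congr fun r => by rw [deriv_const_mul_field]; simp
  have hE : weightedEnergy (fun r => ψ r ^ (n - 1)) f < ⊤ := by
    have h1 := LocAC.energy_add_le hw ((hφ K).locAC hn)
      ((((hφ K).locAC hn).sub hf).const_mul (-1))
    rw [hneg] at h1
    have h2 : (fun r => φ K r + -1 * (φ K r - f r)) = f := by funext r; ring
    rw [h2] at h1
    refine h1.trans_lt ?_
    have := (hφ K).energy_lt_top hn hw hw0
    refine ENNReal.add_lt_top.2 ⟨ENNReal.mul_lt_top (by simp) this,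
      ENNReal.mul_lt_top (by simp) ((hd K le_rfl).trans_lt ENNReal.one_lt_top)⟩
  refine ⟨hf, hE, ?_⟩
  set B := 2 * weightedEnergy (fun r => ψ r ^ (n - 1)) f + 2 * 1 with hB
  have hBt : B < ⊤ := ENNReal.add_lt_top.2 ⟨ENNReal.mul_lt_top (by simp) hE, by simp⟩
  have hφB : ∀ k, K ≤ k → weightedEnergy (fun r => ψ r ^ (n - 1)) (φ k) ≤ B := by
    intro k hk
    have h1 := LocAC.energy_add_le hw hf (((hφ k).locAC hn).sub hf)
    have h2 : (fun r => f r + (φ k r - f r)) = φ k := by funext r; ring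
    rw [h2] at h1
    exact h1.trans (by rw [hB]; gcongr; exact hd k hk)
  have hbd : ∀ a, 0 < a → ENNReal.ofReal |f a| ^ 2 ≤
      (∫⁻ r in Ioi a, ENNReal.ofReal (ψ r ^ (n - 1))⁻¹) * B := by
    intro a ha
    refine le_of_tendsto (ENNReal.Tendsto.pow (ENNReal.tendsto_ofReal (hpt a ha).abs)) ?_
    filter_upwards [eventually_ge_atTop K] with k hk
    exact (ofReal_abs_sq_le hw ((hφ k).locAC hn) ((hφ k).tendsto_zero hn) ha).trans
      (by gcongr; exact hφB k hk)
  have h1 : Tendsto (fun a => ENNReal.ofReal |f a| ^ 2) atTop (𝓝 0) := by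
    refine tendsto_of_tendsto_of_tendsto_of_le_of_le' tendsto_const_nhds
      (h := fun a => (∫⁻ r in Ioi a, ENNReal.ofReal (ψ r ^ (n - 1))⁻¹) * B) ?_
      (Eventually.of_forall fun _ => zero_le) ?_
    · simpa using ENNReal.Tendsto.mul_const hw.tendsto_tail (Or.inr hBt.ne)
    · filter_upwards [eventually_gt_atTop 0] with a ha using hbd a ha
  have h2 : Tendsto (fun a => f a ^ 2) atTop (𝓝 0) := by
    have := (ENNReal.tendsto_toReal ENNReal.zero_ne_top).comp h1
    simpa [Function.comp_def] using this
  have h3 := h2.sqrt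
  simp only [Real.sqrt_sq_eq_abs, Real.sqrt_zero] at h3
  exact (tendsto_zero_iff_abs_tendsto_zero _).2 h3

end EnergySpace

/-! ### Asymptotics of the weight at the pole and at infinity. -/

section ModelWeight

variable {n : ℕ} {ψ : ℝ → ℝ} {α κ : ℝ}

lemma IsModelFunction.continuousOn (hψ : IsModelFunction ψ) : ContinuousOn ψ (Ici 0) :=
  hψ.contDiffOn.continuousOn

lemma IsModelFunction.hasDerivWithinAt_zero (hψ : IsModelFunction ψ) :
    HasDerivWithinAt ψ 1 (Ici 0) 0 := by
  have := (hψ.contDiffOn.differentiableOn (by simp) 0 self_mem_Ici).hasDerivWithinAt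
  rwa [hψ.deriv_zero] at this

lemma IsModelFunction.tendsto_div (hψ : IsModelFunction ψ) :
    Tendsto (fun r => ψ r / r) (𝓝[>] 0) (𝓝 1) := by
  have := (hasDerivWithinAt_iff_tendsto_slope' self_notMem_Ioi).1
    (hψ.hasDerivWithinAt_zero.mono Ioi_subset_Ici_self)
  refine this.congr fun r => ?_
  rw [slope_def_field, hψ.map_zero, sub_zero, sub_zero]

/-- The ratio `ψ r / r` tends to `1` at the pole and is continuous and positive on compact intervals
away from it. -/
lemma IsModelFunction.exists_bounds (hψ : IsModelFunction ψ) (T : ℝ) :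
    ∃ c C : ℝ, 0 < c ∧ 0 < C ∧ ∀ r ∈ Ioc 0 T, c * r ≤ ψ r ∧ ψ r ≤ C * r := by
  have h1 := hψ.tendsto_div.eventually (Icc_mem_nhds (a := 1 / 2) (b := 2) (by norm_num)
    (by norm_num))
  obtain ⟨δ, hδ, h2⟩ := mem_nhdsGT_iff_exists_Ioc_subset.1 h1
  have hδ : 0 < δ := hδ
  have hcont : ContinuousOn (fun r => ψ r / r) (Icc δ (max δ T)) :=
    (hψ.continuousOn.mono fun x hx => hδ.le.trans hx.1).div continuousOn_id
      fun x hx => (hδ.trans_le hx.1).ne'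
  have hne : (Icc δ (max δ T)).Nonempty := nonempty_Icc.2 (le_max_left _ _)
  obtain ⟨x, hx, hxm⟩ := isCompact_Icc.exists_isMinOn hne hcont
  obtain ⟨y, hy, hym⟩ := isCompact_Icc.exists_isMaxOn hne hcont
  have hx0 : 0 < ψ x / x := div_pos (hψ.pos x (hδ.trans_le hx.1)) (hδ.trans_le hx.1)
  refine ⟨min (1 / 2) (ψ x / x), max 2 (ψ y / y), by positivity, by positivity, fun r hr => ?_⟩
  rw [← le_div_iff₀ hr.1, ← div_le_iff₀ hr.1]
  rcases le_or_gt r δ with h | h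
  · have := h2 ⟨hr.1, h⟩
    exact ⟨(min_le_left _ _).trans this.1, this.2.trans (le_max_left _ _)⟩
  · have hmem : r ∈ Icc δ (max δ T) := ⟨h.le, hr.2.trans (le_max_right _ _)⟩
    exact ⟨(min_le_right _ _).trans (hxm hmem), (hym hmem).trans (le_max_right _ _)⟩

lemma IsModelFunction.exists_lower_bound_atTop (hκ : 0 < κ)
    (hasymp : Tendsto (fun r : ℝ => ψ r / (κ * r ^ α)) atTop (𝓝 1)) :
    ∃ R : ℝ, 0 < R ∧ ∀ r, R ≤ r → κ / 2 * r ^ α ≤ ψ r := by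
  obtain ⟨R, hR⟩ := eventually_atTop.1
    (hasymp.eventually (lt_mem_nhds (show (1 / 2 : ℝ) < 1 by norm_num)))
  refine ⟨max R 1, by positivity, fun r hr => ?_⟩
  have hr0 : 0 < r := lt_of_lt_of_le one_pos ((le_max_right _ _).trans hr)
  have := hR r ((le_max_left _ _).trans hr)
  have hp : 0 < κ * r ^ α := by positivity
  rw [lt_div_iff₀ hp] at this
  linarith

lemma IsModelFunction.continuousOn_pow (hψ : IsModelFunction ψ) (m : ℕ) :
    ContinuousOn (fun r => ψ r ^ m) (Ici 0) :=
  hψ.continuousOn.pow m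

/-- Near the pole the integrand is at most a multiple of `s^(b-m)`, integrable since `b > m - 1`; at
infinity it is at most a multiple of `s^(b-αm)`, integrable since `b < αm - 1`. -/
lemma IsModelFunction.integrableOn_rpow_mul_inv (hψ : IsModelFunction ψ) (hκ : 0 < κ)
    (hasymp : Tendsto (fun r : ℝ => ψ r / (κ * r ^ α)) atTop (𝓝 1)) {m : ℕ} {b : ℝ}
    (hb : (m : ℝ) - 1 < b) (hb' : b < α * m - 1) :
    IntegrableOn (fun s => s ^ b * (ψ s ^ m)⁻¹) (Ioi 0) := by
  obtain ⟨R, hR, hlow⟩ := IsModelFunction.exists_lower_bound_atTop hκ hasymp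
  obtain ⟨c, C, hc, hC, hloc⟩ := hψ.exists_bounds R
  have hcont : ContinuousOn (fun s => s ^ b * (ψ s ^ m)⁻¹) (Ioi 0) := by
    refine ContinuousOn.mul (fun x hx => ?_) (((hψ.continuousOn_pow m).mono
      Ioi_subset_Ici_self).inv₀ fun x hx => (pow_pos (hψ.pos x hx) m).ne')
    exact (Real.continuousAt_rpow_const x b (Or.inl (ne_of_gt hx))).continuousWithinAt
  have hm := hcont.aestronglyMeasurable (μ := volume) measurableSet_Ioi
  rw [← Ioc_union_Ioi_eq_Ioi hR.le]
  refine IntegrableOn.union ?_ ?_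
  · have h1 : IntegrableOn (fun s : ℝ => (c ^ m)⁻¹ * s ^ (b - m)) (Ioc 0 R) := by
      refine Integrable.const_mul ?_ _
      have := intervalIntegral.intervalIntegrable_rpow' (a := 0) (b := R) (r := b - m)
        (by linarith)
      rwa [intervalIntegrable_iff_integrableOn_Ioc_of_le hR.le] at this
    refine Integrable.mono' h1 (hm.mono_measure
      (Measure.restrict_mono Ioc_subset_Ioi_self le_rfl)) ?_
    filter_upwards [ae_restrict_mem measurableSet_Ioc] with s hs
    have hs0 := hs.1
    have hψs := hψ.pos s hs0
    rw [Real.norm_of_nonneg (by positivity), Real.rpow_sub hs0, Real.rpow_natCast, ← div_eq_inv_mul,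
      div_div, ← div_eq_mul_inv]
    gcongr
    rw [mul_comm, ← mul_pow]
    exact pow_le_pow_left₀ (by positivity) (hloc s hs).1 m
  · have h1 : IntegrableOn (fun s : ℝ => ((κ / 2) ^ m)⁻¹ * s ^ (b - α * m)) (Ioi R) :=
      Integrable.const_mul (integrableOn_Ioi_rpow_of_lt (by linarith) hR) _
    refine Integrable.mono' h1 (hm.mono_measure
      (Measure.restrict_mono (Ioi_subset_Ioi hR.le) le_rfl)) ?_
    filter_upwards [ae_restrict_mem measurableSet_Ioi] with s hs
    have hs0 : 0 < s := hR.trans hs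
    have hψs := hψ.pos s hs0
    rw [Real.norm_of_nonneg (by positivity), Real.rpow_sub hs0, Real.rpow_mul hs0.le,
      Real.rpow_natCast, ← div_eq_inv_mul, div_div, ← div_eq_mul_inv]
    gcongr
    rw [mul_comm, ← mul_pow]
    exact pow_le_pow_left₀ (by positivity) (hlow s (le_of_lt hs)) m

/-- An exponent governing the decay of `∫_r^∞ ψ^{-m}` which is subcritical at the pole. -/
lemma exists_decay_exponent {m : ℕ} (hm : 1 ≤ m) (hα : 1 < α) :
    ∃ b : ℝ, 0 < b ∧ (m : ℝ) - 1 < b ∧ b < α * m - 1 ∧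
      b / 2 * (2 * (α * m + 1) / (α * m - 1)) < m + 1 := by
  have hm' : (1 : ℝ) ≤ m := by exact_mod_cast hm
  have h1 : (m : ℝ) < α * m := by nlinarith
  have hD : 0 < α * m - 1 := by linarith
  have hN : 0 < α * m + 1 := by linarith
  -- Room for `b` exists exactly because `α > 1`: clearing denominators leaves `2m < 2αm`.
  have h2 : (m : ℝ) - 1 < (m + 1) * (α * m - 1) / (α * m + 1) := by
    rw [lt_div_iff₀ hN]; nlinarith
  obtain ⟨b, hb1, hb2⟩ := exists_between h2
  rw [lt_div_iff₀ hN] at hb2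
  refine ⟨b, by linarith, hb1, ?_, ?_⟩
  · by_contra hcon
    push Not at hcon
    nlinarith
  · rw [div_mul_div_comm, div_lt_iff₀ (by positivity)]
    linarith

lemma IsModelFunction.isDecayWeight (hψ : IsModelFunction ψ) (hκ : 0 < κ) (hα : 1 < α)
    (hasymp : Tendsto (fun r : ℝ => ψ r / (κ * r ^ α)) atTop (𝓝 1)) {m : ℕ} (hm : 1 ≤ m) :
    IsDecayWeight fun r => ψ r ^ m := by
  refine ⟨(hψ.continuousOn_pow m).mono Ioi_subset_Ici_self, fun r hr => pow_pos (hψ.pos r hr) m,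
    fun r hr => ?_⟩
  obtain ⟨b, hb0, hb1, hb2, -⟩ := exists_decay_exponent hm hα
  have h := ((hψ.integrableOn_rpow_mul_inv hκ hasymp hb1 hb2).mono_set
    (Ioi_subset_Ioi hr.le)).const_mul (r ^ (-b))
  refine Integrable.mono' h ?_ ?_
  · exact (((hψ.continuousOn_pow m).mono fun x hx => (hr.trans hx).le).inv₀
      fun x hx => (pow_pos (hψ.pos x (hr.trans hx)) m).ne').aestronglyMeasurable measurableSet_Ioi
  · filter_upwards [ae_restrict_mem measurableSet_Ioi] with s hs
    have hψs := hψ.pos s (hr.trans hs)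
    rw [Real.norm_of_nonneg (by positivity), ← mul_assoc, Real.rpow_neg hr.le, ← div_eq_inv_mul]
    refine le_mul_of_one_le_left (by positivity) ?_
    rw [one_le_div (by positivity)]
    exact Real.rpow_le_rpow hr.le (le_of_lt hs) hb0.le

/-- Chebyshev's argument: `s^b ≥ r^b` on `(r,∞)`, so the tail is at most `r^(-b)` times the full
integral of `s^b ψ^(-m)`. Consequently functions of finite energy grow at most like `r^(-b/2)` at
the pole. -/
lemma IsModelFunction.exists_tail_le (hψ : IsModelFunction ψ) (hκ : 0 < κ)
    (hasymp : Tendsto (fun r : ℝ => ψ r / (κ * r ^ α)) atTop (𝓝 1)) {m : ℕ} {b : ℝ} (hb0 : 0 < b)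
    (hb : (m : ℝ) - 1 < b) (hb' : b < α * m - 1) :
    ∃ C : ℝ, 0 < C ∧ ∀ r, 0 < r →
      ∫⁻ s in Ioi r, ENNReal.ofReal (ψ s ^ m)⁻¹ ≤ ENNReal.ofReal (C * r ^ (-b)) := by
  have h := hψ.integrableOn_rpow_mul_inv hκ hasymp hb hb'
  have hnn : 0 ≤ᵐ[volume.restrict (Ioi 0)] fun s => s ^ b * (ψ s ^ m)⁻¹ := by
    filter_upwards [ae_restrict_mem measurableSet_Ioi] with s hs
    have hs : 0 < s := hs
    have := hψ.pos s hs
    change 0 ≤ s ^ b * (ψ s ^ m)⁻¹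
    positivity
  refine ⟨(∫ s in Ioi 0, s ^ b * (ψ s ^ m)⁻¹) + 1,
    add_pos_of_nonneg_of_pos (integral_nonneg_of_ae hnn) one_pos, fun r hr => ?_⟩
  calc ∫⁻ s in Ioi r, ENNReal.ofReal (ψ s ^ m)⁻¹
      ≤ ∫⁻ s in Ioi r, ENNReal.ofReal (r ^ (-b)) * ENNReal.ofReal (s ^ b * (ψ s ^ m)⁻¹) := by
        refine setLIntegral_mono' measurableSet_Ioi fun s hs => ?_
        have hψs := hψ.pos s (hr.trans hs)
        rw [← ENNReal.ofReal_mul (by positivity)]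
        refine ENNReal.ofReal_le_ofReal ?_
        rw [← mul_assoc, Real.rpow_neg hr.le, ← div_eq_inv_mul]
        refine le_mul_of_one_le_left (by positivity) ?_
        rw [one_le_div (by positivity)]
        exact Real.rpow_le_rpow hr.le (le_of_lt hs) hb0.le
    _ = ENNReal.ofReal (r ^ (-b)) * ∫⁻ s in Ioi r, ENNReal.ofReal (s ^ b * (ψ s ^ m)⁻¹) :=
        lintegral_const_mul' _ _ ENNReal.ofReal_ne_top
    _ ≤ ENNReal.ofReal (r ^ (-b)) * ∫⁻ s in Ioi 0, ENNReal.ofReal (s ^ b * (ψ s ^ m)⁻¹) := by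
        gcongr
    _ = ENNReal.ofReal (r ^ (-b)) * ENNReal.ofReal (∫ s in Ioi 0, s ^ b * (ψ s ^ m)⁻¹) := by
        rw [ofReal_integral_eq_lintegral_ofReal h hnn]
    _ ≤ _ := by
        rw [← ENNReal.ofReal_mul (by positivity), mul_comm]
        refine ENNReal.ofReal_le_ofReal ?_
        gcongr
        linarith

lemma IsModelFunction.integrableOn_Ioc (hψ : IsModelFunction ψ) (m : ℕ) (R : ℝ) :
    IntegrableOn (fun r => ψ r ^ m) (Ioc 0 R) :=
  (((hψ.continuousOn_pow m).mono Icc_subset_Ici_self).integrableOn_Icc).mono_set Ioc_subset_Icc_self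

/-- With `β = bp/2` this is the integrable majorant of the mass density near the pole. -/
lemma IsModelFunction.integrableOn_rpow_mul (hψ : IsModelFunction ψ) {m : ℕ} {β : ℝ}
    (hβ : β < m + 1) (T : ℝ) : IntegrableOn (fun r => r ^ (-β) * ψ r ^ m) (Ioc 0 T) := by
  rcases le_or_gt T 0 with hT | hT
  · simp [Ioc_eq_empty (not_lt.2 hT)]
  obtain ⟨c, C, hc, hC, hloc⟩ := hψ.exists_bounds T
  have h1 : IntegrableOn (fun s : ℝ => C ^ m * s ^ (m - β)) (Ioc 0 T) := by
    refine Integrable.const_mul ?_ _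
    have := intervalIntegral.intervalIntegrable_rpow' (a := 0) (b := T) (r := m - β)
      (by linarith)
    rwa [intervalIntegrable_iff_integrableOn_Ioc_of_le hT.le] at this
  refine Integrable.mono' h1 ?_ ?_
  · refine ContinuousOn.aestronglyMeasurable (ContinuousOn.mul (fun x hx => ?_)
      ((hψ.continuousOn_pow m).mono fun x hx => hx.1.le)) measurableSet_Ioc
    exact (Real.continuousAt_rpow_const x _ (Or.inl hx.1.ne')).continuousWithinAt
  · filter_upwards [ae_restrict_mem measurableSet_Ioc] with s hs
    have hs0 := hs.1
    have hψs := hψ.pos s hs0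
    rw [Real.norm_of_nonneg (by positivity), sub_eq_neg_add, Real.rpow_add hs0, Real.rpow_natCast,
      mul_left_comm, ← mul_pow]
    gcongr
    exact (hloc s hs).2

lemma twoStar_eq (hn : 1 ≤ n) (α : ℝ) :
    twoStar n α = 2 * (α * ((n - 1 : ℕ) : ℝ) + 1) / (α * ((n - 1 : ℕ) : ℝ) - 1) := by
  rw [twoStar, Nat.cast_sub hn, Nat.cast_one]

lemma two_lt_twoStar (hn : 2 ≤ n) (hα : 1 < α) : 2 < twoStar n α := by
  have : (2 : ℝ) ≤ n := by exact_mod_cast hn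
  have hD : 0 < α * ((n : ℝ) - 1) - 1 := by nlinarith
  rw [twoStar, lt_div_iff₀ hD]
  linarith

end ModelWeight

/-! ### The Sobolev inequality outside a large ball. -/

section AtInfinity

variable {n : ℕ} {ψ : ℝ → ℝ} {α κ : ℝ}

/-- Cutting off the derivative of a compactly supported `C¹` function. -/
lemma exists_cutoff {Φ : ℝ → ℝ} (hΦ : ContDiff ℝ 1 Φ) {B : ℝ} (hB : ∀ r, B ≤ r → Φ r = 0) (R : ℝ) :
    ∃ η : ℝ → ℝ, ContDiff ℝ 1 η ∧ (∃ B' : ℝ, ∀ r, B' ≤ r → η r = 0) ∧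
      (∀ r, R + 1 ≤ r → η r = Φ r) ∧ (∀ r, r ≤ R → deriv η r = 0) ∧
      ∀ r, |deriv η r| ≤ |deriv Φ r| := by
  set χ : ℝ → ℝ := fun s => max 0 (min 1 (s - R))
  have hχc : Continuous χ := by fun_prop
  have hΦ' := (contDiff_one_iff_deriv.1 hΦ).2
  set g : ℝ → ℝ := fun s => χ s * deriv Φ s with hg
  have hgc : Continuous g := hχc.mul hΦ'
  set b := max (B + 1) (R + 1)
  have hφ' : ∀ r, HasDerivAt (fun r => ∫ t in b..r, g t) (g r) r := fun r =>
    intervalIntegral.integral_hasDerivAt_right (hgc.intervalIntegrable _ _)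
      (hgc.stronglyMeasurableAtFilter _ _) hgc.continuousAt
  have hφd : deriv (fun r => ∫ t in b..r, g t) = g := funext fun r => (hφ' r).deriv
  have heq : ∀ r, R + 1 ≤ r → ∫ t in b..r, g t = Φ r := by
    intro r hr
    have h1 : ∫ t in b..r, g t = ∫ t in b..r, deriv Φ t := by
      refine intervalIntegral.integral_congr fun t ht => ?_
      have ht' : R + 1 ≤ t := (le_min (le_max_right _ _) hr).trans ht.1
      have : χ t = 1 := by
        simp only [χ]
        rw [min_eq_left (by linarith), max_eq_right zero_le_one]
      simp [g, this]
    rw [h1, intervalIntegral.integral_deriv_eq_sub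
      (fun x _ => (hΦ.differentiable one_ne_zero) x) (hΦ'.intervalIntegrable _ _),
      hB b ((by linarith : B ≤ B + 1).trans (le_max_left _ _)), sub_zero]
  refine ⟨fun r => ∫ t in b..r, g t,
    contDiff_one_iff_deriv.2 ⟨fun r => (hφ' r).differentiableAt, by rwa [hφd]⟩,
    ⟨b, fun r hr => ?_⟩, heq, fun r hr => ?_, fun r => ?_⟩
  · dsimp only
    rw [heq r ((le_max_right _ _).trans hr),
      hB r ((by linarith : B ≤ B + 1).trans ((le_max_left _ _).trans hr))]
  · rw [hφd]
    have : χ r = 0 := max_eq_left ((min_le_right _ _).trans (by linarith))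
    simp [g, this]
  · rw [hφd]
    simp only [g]
    rw [abs_mul]
    refine mul_le_of_le_one_left (abs_nonneg _) ?_
    rw [abs_of_nonneg (le_max_left _ _)]
    exact max_le zero_le_one (min_le_left _ _)

/-- Strict at `η = 0`, hence true for small `η` by continuity. The gap between `c` and `c₁` pays for
replacing `w` by its asymptotic power. -/
lemma exists_asymptotic_factor {c c₁ p : ℝ} (hc : c < c₁) :
    ∃ η : ℝ, 0 < η ∧ η < 1 ∧ c * (1 + η) ^ (1 / p) ≤ (1 - η) ^ (1 / 2 : ℝ) * c₁ := by
  have h1 : ContinuousAt (fun η : ℝ => (1 - η) ^ (1 / 2 : ℝ) * c₁ - c * (1 + η) ^ (1 / p)) 0 := by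
    refine ContinuousAt.sub (ContinuousAt.mul ?_ continuousAt_const)
      (continuousAt_const.mul ?_)
    · exact ContinuousAt.rpow_const (by fun_prop) (Or.inl (by norm_num))
    · exact ContinuousAt.rpow_const (by fun_prop) (Or.inl (by norm_num))
  have h2 : ∀ᶠ η : ℝ in 𝓝 0, 0 < (1 - η) ^ (1 / 2 : ℝ) * c₁ - c * (1 + η) ^ (1 / p) := by
    refine h1.eventually (lt_mem_nhds ?_)
    simp [hc]
  have h2' : ∀ᶠ η : ℝ in 𝓝[>] 0, 0 < (1 - η) ^ (1 / 2 : ℝ) * c₁ - c * (1 + η) ^ (1 / p) :=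
    nhdsWithin_le_nhds h2
  have h3 : ∀ᶠ η : ℝ in 𝓝[>] 0, η < 1 := nhdsWithin_le_nhds (gt_mem_nhds one_pos)
  obtain ⟨η, ha, hb, hη⟩ := (h2'.and (h3.and self_mem_nhdsWithin)).exists
  exact ⟨η, hη, hb, by linarith⟩

/-- Division-free form of the infimum, valid also for functions vanishing on `[0,∞)`, which the
infimum excludes. -/
lemma le_of_lt_asymptoticInf {c : ℝ≥0∞} (hc : c ≤ asymptoticInf n α κ)
    (hp : 0 < twoStar n α) {η : ℝ → ℝ} (hη : IsC1cHalfLine η) :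
    c * weightedMass (fun r => κ ^ (n - 1) * r ^ (α * ((n : ℝ) - 1))) (twoStar n α) η ^
        (1 / twoStar n α) ≤
      weightedEnergy (fun r => κ ^ (n - 1) * r ^ (α * ((n : ℝ) - 1))) η ^ (1 / 2 : ℝ) := by
  by_cases h : ∃ r, 0 ≤ r ∧ η r ≠ 0
  · exact ENNReal.mul_le_of_le_div (hc.trans (iInf₂_le η ⟨hη, h⟩))
  · push Not at h
    have : weightedMass (fun r => κ ^ (n - 1) * r ^ (α * ((n : ℝ) - 1))) (twoStar n α) η = 0 := by
      unfold weightedMass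
      rw [setLIntegral_congr_fun (g := fun _ => 0) measurableSet_Ioi fun r hr => ?_]
      · simp
      · simp [h r (le_of_lt hr), Real.zero_rpow hp.ne']
    rw [this, ENNReal.zero_rpow_of_pos (by positivity), mul_zero]
    exact zero_le

/-- Outside a large ball the Sobolev quotient is almost bounded below by its asymptotic value. -/
theorem exists_radius_mass_le_energy (hn : 2 ≤ n) (hα : 1 < α) (hκ : 0 < κ)
    (hasymp : Tendsto (fun r : ℝ => ψ r / (κ * r ^ α)) atTop (𝓝 1)) {c : ℝ} (hc0 : 0 < c)
    (hc : ENNReal.ofReal c < asymptoticInf n α κ) :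
    ∃ R₀ : ℝ, 0 < R₀ ∧ ∀ R, R₀ ≤ R → ∀ φ, IsRadialC1c n φ →
      ENNReal.ofReal c * massOn (fun r => ψ r ^ (n - 1)) (twoStar n α) φ (Ioi (R + 1)) ^
        (1 / twoStar n α) ≤ energyOn (fun r => ψ r ^ (n - 1)) φ (Ioi R) ^ (1 / 2 : ℝ) := by
  have hp : 0 < twoStar n α := by linarith [two_lt_twoStar hn hα]
  set p := twoStar n α with hpdef
  set w : ℝ → ℝ := fun r => ψ r ^ (n - 1) with hw
  set v : ℝ → ℝ := fun r => κ ^ (n - 1) * r ^ (α * ((n : ℝ) - 1)) with hv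
  obtain ⟨c₁, hcc, hc₁⟩ : ∃ c₁ : ℝ, c < c₁ ∧ ENNReal.ofReal c₁ ≤ asymptoticInf n α κ := by
    obtain ⟨d, hd1, hd2⟩ := exists_between hc
    have hdt : d ≠ ⊤ := (hd2.trans_le le_top).ne
    refine ⟨d.toReal, (ENNReal.ofReal_lt_iff_lt_toReal hc0.le hdt).1 hd1, ?_⟩
    rw [ENNReal.ofReal_toReal hdt]
    exact hd2.le
  obtain ⟨η, hη0, hη1, hη⟩ := exists_asymptotic_factor (p := p) hcc
  have hvpos : ∀ r, 0 < r → 0 < v r := fun r hr => by simp only [v]; positivity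
  have hratio : Tendsto (fun r => w r / v r) atTop (𝓝 1) := by
    have := hasymp.pow (n - 1)
    rw [one_pow] at this
    refine this.congr' ?_
    filter_upwards [eventually_gt_atTop 0] with r hr
    simp only [w, v]
    rw [div_pow, mul_pow, ← Real.rpow_natCast (r ^ α), ← Real.rpow_mul hr.le,
      Nat.cast_sub (by omega), Nat.cast_one]
  obtain ⟨R₀, hR₀⟩ := eventually_atTop.1
    (hratio.eventually (Icc_mem_nhds (a := 1 - η) (b := 1 + η) (by linarith) (by linarith)))
  refine ⟨max R₀ 1, by positivity, fun R hR φ hφ => ?_⟩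
  have hR0 : 0 < R := lt_of_lt_of_le one_pos ((le_max_right _ _).trans hR)
  have hwv : ∀ r, R ≤ r → (1 - η) * v r ≤ w r ∧ w r ≤ (1 + η) * v r := by
    intro r hr
    have h1 := hR₀ r ((le_max_left _ _).trans (hR.trans hr))
    have h2 := hvpos r (hR0.trans_le hr)
    exact ⟨(le_div_iff₀ h2).1 h1.1, (div_le_iff₀ h2).1 h1.2⟩
  obtain ⟨Φ, hΦ, ⟨B, -, hB⟩, hΦφ⟩ := hφ.exists_contDiff (by omega)
  -- Cutting off the derivative instead of the function produces no commutator term: `ζ` has energy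
  -- only beyond `R`, dominated by that of `φ`, and agrees with `φ` only beyond `R + 1`. Hence the
  -- two radii in the conclusion.
  obtain ⟨ζ, hζ, hζB, hζeq, hζ0, hζle⟩ := exists_cutoff hΦ hB R
  have hmain := le_of_lt_asymptoticInf (n := n) (κ := κ) hc₁ hp
    (η := ζ) ⟨hζ.contDiffOn, hζB⟩
  have hM : massOn w p φ (Ioi (R + 1)) ≤ ENNReal.ofReal (1 + η) * weightedMass v p ζ := by
    unfold massOn weightedMass
    rw [← lintegral_const_mul' _ _ ENNReal.ofReal_ne_top]
    refine le_trans (setLIntegral_mono' measurableSet_Ioi fun r hr => ?_)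
      (lintegral_mono_set (Ioi_subset_Ioi (by linarith : (0 : ℝ) ≤ R + 1)))
    have hr : R + 1 < r := hr
    rw [← ENNReal.ofReal_mul (by linarith), hζeq r hr.le, hΦφ r (by linarith), mul_left_comm]
    refine ENNReal.ofReal_le_ofReal ?_
    gcongr
    exact (hwv r (by linarith)).2
  have hE : ENNReal.ofReal (1 - η) * weightedEnergy v ζ ≤ energyOn w φ (Ioi R) := by
    unfold energyOn weightedEnergy
    rw [← lintegral_const_mul' _ _ ENNReal.ofReal_ne_top, ← lintegral_indicator measurableSet_Ioi,
      ← lintegral_indicator measurableSet_Ioi]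
    refine lintegral_mono fun r => ?_
    by_cases hr : R < r
    · have hr0 := hR0.trans hr
      rw [indicator_of_mem (show r ∈ Ioi 0 from hr0), indicator_of_mem (show r ∈ Ioi R from hr),
        ← ENNReal.ofReal_mul (by linarith), mul_left_comm, ← deriv_eq_of_eqOn_Ioi hΦφ hr0]
      refine ENNReal.ofReal_le_ofReal ?_
      have h1 := (hwv r hr.le).1
      have h2 := hvpos r hr0
      have h3 : 0 ≤ (1 - η) * v r := mul_nonneg (by linarith) h2.le
      have := hζle r
      gcongr
    · rw [indicator_of_notMem (show r ∉ Ioi R from hr)]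
      simp [indicator, hζ0 r (not_lt.1 hr)]
  calc ENNReal.ofReal c * massOn w p φ (Ioi (R + 1)) ^ (1 / p)
      ≤ ENNReal.ofReal c * (ENNReal.ofReal (1 + η) * weightedMass v p ζ) ^ (1 / p) := by
        gcongr
    _ = ENNReal.ofReal (c * (1 + η) ^ (1 / p)) * weightedMass v p ζ ^ (1 / p) := by
        rw [ENNReal.mul_rpow_of_nonneg _ _ (by positivity), ← mul_assoc,
          ENNReal.ofReal_rpow_of_pos (by linarith), ← ENNReal.ofReal_mul hc0.le]
    _ ≤ ENNReal.ofReal ((1 - η) ^ (1 / 2 : ℝ) * c₁) * weightedMass v p ζ ^ (1 / p) := by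
        gcongr
    _ = ENNReal.ofReal (1 - η) ^ (1 / 2 : ℝ) *
          (ENNReal.ofReal c₁ * weightedMass v p ζ ^ (1 / p)) := by
        rw [ENNReal.ofReal_mul (Real.rpow_nonneg (by linarith) _),
          ENNReal.ofReal_rpow_of_pos (by linarith), mul_assoc]
    _ ≤ ENNReal.ofReal (1 - η) ^ (1 / 2 : ℝ) * weightedEnergy v ζ ^ (1 / 2 : ℝ) := by
        gcongr
    _ = (ENNReal.ofReal (1 - η) * weightedEnergy v ζ) ^ (1 / 2 : ℝ) := by
        rw [ENNReal.mul_rpow_of_nonneg _ _ (by positivity)]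
    _ ≤ _ := by gcongr

end AtInfinity

/-! ### Energy and mass: scaling, semicontinuity, normalized test functions. -/

section Functionals

variable {n : ℕ} {ψ w f g : ℝ → ℝ} {p : ℝ}

lemma weightedEnergy_const_mul (w f : ℝ → ℝ) (c : ℝ) :
    weightedEnergy w (fun r => c * f r) = ENNReal.ofReal (c ^ 2) * weightedEnergy w f := by
  unfold weightedEnergy
  rw [← lintegral_const_mul' _ _ ENNReal.ofReal_ne_top]
  refine lintegral_congr fun r => ?_
  rw [deriv_const_mul_field, abs_mul, mul_pow, sq_abs c, mul_assoc,
    ENNReal.ofReal_mul (sq_nonneg c)]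

lemma weightedMass_const_mul (w f : ℝ → ℝ) (p c : ℝ) :
    weightedMass w p (fun r => c * f r) = ENNReal.ofReal (|c| ^ p) * weightedMass w p f := by
  unfold weightedMass
  rw [← lintegral_const_mul' _ _ ENNReal.ofReal_ne_top]
  refine lintegral_congr fun r => ?_
  rw [abs_mul, Real.mul_rpow (abs_nonneg _) (abs_nonneg _), mul_assoc,
    ENNReal.ofReal_mul (Real.rpow_nonneg (abs_nonneg c) p)]

lemma IsDecayWeight.aemeasurable_mass (hw : IsDecayWeight w) (hf : ContinuousOn f (Ioi 0))
    {S : Set ℝ} (hS : S ⊆ Ioi 0) :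
    AEMeasurable (fun r => ENNReal.ofReal (|f r| ^ p * w r)) (volume.restrict S) := by
  have h1 : AEMeasurable f (volume.restrict (Ioi 0)) := hf.aemeasurable measurableSet_Ioi
  refine AEMeasurable.mono_measure ?_ (Measure.restrict_mono hS le_rfl)
  exact ((h1.norm.pow_const p).mul hw.aestronglyMeasurable.aemeasurable).ennreal_ofReal

lemma IsDecayWeight.tendsto_mass_integrand {φ : ℕ → ℝ → ℝ} (hp : 0 ≤ p) {r : ℝ}
    (h : Tendsto (fun k => φ k r) atTop (𝓝 (f r))) :
    Tendsto (fun k => ENNReal.ofReal (|φ k r| ^ p * w r)) atTop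
      (𝓝 (ENNReal.ofReal (|f r| ^ p * w r))) :=
  ENNReal.tendsto_ofReal ((h.abs.rpow_const (Or.inr hp)).mul_const _)

/-- Fatou's lemma for the mass. -/
lemma weightedMass_le_liminf (hw : IsDecayWeight w) (hp : 0 ≤ p) {φ : ℕ → ℝ → ℝ}
    (hφ : ∀ k, ContinuousOn (φ k) (Ioi 0))
    (h : ∀ r, 0 < r → Tendsto (fun k => φ k r) atTop (𝓝 (f r))) :
    weightedMass w p f ≤ liminf (fun k => weightedMass w p (φ k)) atTop := by
  refine le_trans (le_of_eq ?_) (lintegral_liminf_le' fun k =>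
    hw.aemeasurable_mass (hφ k) subset_rfl)
  refine setLIntegral_congr_fun measurableSet_Ioi fun r hr => ?_
  exact (IsDecayWeight.tendsto_mass_integrand hp (h r hr)).liminf_eq.symm

lemma weightedMass_pos (hw : IsDecayWeight w) (hf : ContinuousOn f (Ioi 0)) {r : ℝ} (hr : 0 < r)
    (hfr : f r ≠ 0) : 0 < weightedMass w p f := by
  have hm := hw.aemeasurable_mass (p := p) hf subset_rfl
  unfold weightedMass
  rw [pos_iff_ne_zero, Ne, lintegral_eq_zero_iff' hm]
  intro h
  have h1 : ∀ᶠ s in 𝓝 r, f s ≠ 0 :=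
    (hf.continuousAt (Ioi_mem_nhds hr)).eventually_ne hfr
  obtain ⟨ε, hε, hball⟩ := Metric.eventually_nhds_iff_ball.1 (h1.and (lt_mem_nhds hr))
  rw [EventuallyEq, ae_restrict_iff' measurableSet_Ioi] at h
  have h2 : volume (Metric.ball r ε) = 0 := by
    refine measure_mono_null (fun s hs => ?_) (ae_iff.1 h)
    rw [mem_ofPred_eq]
    intro hcon
    have h3 := hball s hs
    have h4 := hcon h3.2
    have h5 := hw.pos s h3.2
    have h6 : 0 < |f s| ^ p := Real.rpow_pos_of_pos (abs_pos.2 h3.1) p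
    simp only [Pi.zero_apply, ENNReal.ofReal_eq_zero] at h4
    exact absurd h4 (not_le.2 (mul_pos h6 h5))
  rw [Real.volume_ball] at h2
  simp only [ENNReal.ofReal_eq_zero] at h2
  linarith

lemma sobolevInf_mul_le (hp : 0 < p) (hf : f ∈ D12rad n ψ) :
    sobolevInf n ψ (p - 1) * weightedMass (fun r => ψ r ^ (n - 1)) p f ^ (1 / p) ≤
      weightedEnergy (fun r => ψ r ^ (n - 1)) f ^ (1 / 2 : ℝ) := by
  by_cases h : ∃ r, 0 < r ∧ f r ≠ 0
  · refine ENNReal.mul_le_of_le_div ((iInf₂_le f ⟨hf, h⟩).trans (le_of_eq ?_))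
    simp only [sobolevQuotient, weightedQuotient, sub_add_cancel]
  · push Not at h
    have : weightedMass (fun r => ψ r ^ (n - 1)) p f = 0 := by
      unfold weightedMass
      rw [setLIntegral_congr_fun (g := fun _ => 0) measurableSet_Ioi fun r hr => ?_]
      · simp
      · simp [h r hr, Real.zero_rpow hp.ne']
    rw [this, ENNReal.zero_rpow_of_pos (by positivity), mul_zero]
    exact zero_le

/-- Minkowski's inequality for `f'√w`. Writing `deriv f r - deriv g r` rather than the derivative of
the difference avoids any differentiability hypothesis. -/
lemma weightedEnergy_sqrt_le (hw : IsDecayWeight w) (f g : ℝ → ℝ) :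
    weightedEnergy w f ^ (1 / 2 : ℝ) ≤
      (∫⁻ r in Ioi (0 : ℝ), ENNReal.ofReal (|deriv f r - deriv g r| ^ 2 * w r)) ^ (1 / 2 : ℝ) +
        weightedEnergy w g ^ (1 / 2 : ℝ) := by
  have hwm : AEMeasurable (fun r => √(w r)) (volume.restrict (Ioi 0)) :=
    hw.aestronglyMeasurable.aemeasurable.sqrt
  have hf := (measurable_deriv f).aemeasurable (μ := volume.restrict (Ioi 0))
  have hg := (measurable_deriv g).aemeasurable (μ := volume.restrict (Ioi 0))
  have h := ENNReal.lintegral_Lp_add_le (μ := volume.restrict (Ioi (0 : ℝ))) (p := 2)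
    (f := fun r => ENNReal.ofReal (|deriv f r - deriv g r| * √(w r)))
    (g := fun r => ENNReal.ofReal (|deriv g r| * √(w r)))
    ((hf.sub hg).norm.mul hwm).ennreal_ofReal (hg.norm.mul hwm).ennreal_ofReal one_le_two
  have e : ∀ F : ℝ → ℝ, ∫⁻ r in Ioi (0 : ℝ), ENNReal.ofReal (|F r| * √(w r)) ^ (2 : ℝ) =
      ∫⁻ r in Ioi (0 : ℝ), ENNReal.ofReal (|F r| ^ 2 * w r) := fun F => by
    refine setLIntegral_congr_fun measurableSet_Ioi fun r hr => ?_
    rw [ENNReal.rpow_two, ← ENNReal.ofReal_pow (by positivity), mul_pow,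
      Real.sq_sqrt (hw.pos r hr).le]
  rw [e, e] at h
  refine le_trans ?_ h
  unfold weightedEnergy
  rw [← e]
  gcongr with r
  rw [Pi.add_apply, ← ENNReal.ofReal_add (by positivity) (by positivity), ← add_mul]
  refine ENNReal.ofReal_le_ofReal ?_
  gcongr
  simpa using abs_add_le (deriv f r - deriv g r) (deriv g r)

lemma IsRadialC1c.mass_lt_top {φ : ℝ → ℝ} (hn : 1 ≤ n) (hφ : IsRadialC1c n φ) (hp : 0 < p)
    (hw : IsDecayWeight w) (hw0 : ∀ R, IntegrableOn w (Ioc 0 R)) : weightedMass w p φ < ⊤ := by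
  obtain ⟨Φ, h1, ⟨R, hR0, hR⟩, h3⟩ := hφ.exists_contDiff hn
  obtain ⟨C, hC⟩ := (isCompact_Icc (a := 0) (b := R)).exists_bound_of_continuousOn
    h1.continuous.continuousOn
  have h4 : weightedMass w p φ ≤ ∫⁻ r in Ioc 0 R, ENNReal.ofReal (C ^ p * w r) := by
    unfold weightedMass
    rw [← lintegral_indicator measurableSet_Ioi, ← lintegral_indicator measurableSet_Ioc]
    refine lintegral_mono fun r => ?_
    by_cases hr : r ∈ Ioi 0
    · have hr0 : 0 < r := hr
      have hwr := hw.pos r hr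
      rw [indicator_of_mem hr, ← h3 r hr0.le]
      by_cases hr' : r ≤ R
      · rw [indicator_of_mem (show r ∈ Ioc 0 R from ⟨hr, hr'⟩)]
        refine ENNReal.ofReal_le_ofReal ?_
        have := hC r ⟨hr0.le, hr'⟩
        rw [Real.norm_eq_abs] at this
        gcongr
      · simp [hR r (not_le.1 hr').le, Real.zero_rpow hp.ne']
    · rw [indicator_of_notMem hr]
      exact zero_le
  have hC0 : 0 ≤ C := (norm_nonneg _).trans (hC 0 ⟨le_rfl, hR0.le⟩)
  refine h4.trans_lt ?_
  have h5 := ((hw0 R).const_mul (C ^ p)).2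
  rwa [hasFiniteIntegral_iff_ofReal] at h5
  filter_upwards [ae_restrict_mem measurableSet_Ioc] with r hr
  have := hw.pos r hr.1
  change 0 ≤ C ^ p * w r
  positivity

lemma IsRadialC1c.const_mul {φ : ℝ → ℝ} (hφ : IsRadialC1c n φ) (c : ℝ) :
    IsRadialC1c n fun r => c * φ r :=
  ⟨contDiff_const.mul hφ.1, hφ.2.mul_left⟩

/-- The infimum defining `I_{ψ,q}` may be computed with normalized test functions. -/
lemma exists_isRadialC1c_energy_lt (hn : 1 ≤ n) (hp : 0 < p)
    (hw : IsDecayWeight fun r => ψ r ^ (n - 1))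
    (hw0 : ∀ R, IntegrableOn (fun r => ψ r ^ (n - 1)) (Ioc 0 R)) {J : ℝ≥0∞}
    (hJ : sobolevInf n ψ (p - 1) < J) (hJt : J < ⊤) :
    ∃ φ, IsRadialC1c n φ ∧ weightedMass (fun r => ψ r ^ (n - 1)) p φ = 1 ∧
      weightedEnergy (fun r => ψ r ^ (n - 1)) φ ^ (1 / 2 : ℝ) < J := by
  set w : ℝ → ℝ := fun r => ψ r ^ (n - 1)
  have hJ0 : J ≠ 0 := (zero_le.trans_lt hJ).ne'
  have step : ∃ φ, IsRadialC1c n φ ∧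
      weightedEnergy w φ ^ (1 / 2 : ℝ) < J * weightedMass w p φ ^ (1 / p) := by
    obtain ⟨f, ⟨hfD, r₀, hr₀, hfr⟩, hQ⟩ : ∃ f, (f ∈ D12rad n ψ ∧ ∃ r, 0 < r ∧ f r ≠ 0) ∧
        sobolevQuotient n ψ (p - 1) f < J := by
      simpa only [sobolevInf, iInf_lt_iff, exists_prop, mem_ofPred_eq] using hJ
    have hfL := (mem_D12rad_iff hn hw hw0).1 hfD
    have hM := weightedMass_pos (p := p) hw hfL.1.continuousOn hr₀ hfr
    simp only [sobolevQuotient, weightedQuotient, sub_add_cancel] at hQ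
    have hMp : weightedMass w p f ^ (1 / p) ≠ 0 := (ENNReal.rpow_pos_of_nonneg hM
      (by positivity)).ne'
    have h1 : weightedEnergy w f ^ (1 / 2 : ℝ) < J * weightedMass w p f ^ (1 / p) := by
      rwa [ENNReal.div_lt_iff (Or.inl hMp) (Or.inr (ENNReal.rpow_lt_top_of_nonneg (by norm_num)
        hfL.2.1.ne).ne)] at hQ
    -- The level `y` decouples the two functionals: along the approximants the root energies
    -- eventually fall below `y` by Minkowski, while Fatou keeps the masses above `(y/J)^p`.
    obtain ⟨y, hy1, hy2⟩ := exists_between h1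
    obtain ⟨-, φ, hφ, hlim, hpt⟩ := hfD
    have hEv : ∀ᶠ k in atTop, weightedEnergy w (φ k) ^ (1 / 2 : ℝ) < y := by
      have h2 : Tendsto (fun k => (∫⁻ r in Ioi (0 : ℝ),
          ENNReal.ofReal (|deriv (φ k) r - deriv f r| ^ 2 * w r)) ^ (1 / 2 : ℝ) +
            weightedEnergy w f ^ (1 / 2 : ℝ)) atTop
          (𝓝 (weightedEnergy w f ^ (1 / 2 : ℝ))) := by
        have := (hlim.ennrpow_const (1 / 2 : ℝ)).add_const (weightedEnergy w f ^ (1 / 2 : ℝ))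
        rwa [ENNReal.zero_rpow_of_pos (by norm_num), zero_add] at this
      filter_upwards [h2.eventually (gt_mem_nhds hy1)] with k hk
      exact (weightedEnergy_sqrt_le hw _ _).trans_lt hk
    have h3 : (y / J) ^ p < weightedMass w p f := by
      rw [← ENNReal.lt_rpow_inv_iff hp, ← one_div]
      exact ENNReal.div_lt_of_lt_mul' hy2
    have hMv : ∀ᶠ k in atTop, (y / J) ^ p < weightedMass w p (φ k) :=
      eventually_lt_of_lt_liminf (h3.trans_le (weightedMass_le_liminf hw hp.le
        (fun k => ((hφ k).locAC hn).continuousOn) hpt))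
    obtain ⟨k, hk1, hk2⟩ := (hEv.and hMv).exists
    refine ⟨φ k, hφ k, hk1.trans ?_⟩
    rw [← ENNReal.lt_rpow_inv_iff hp, ← one_div,
      ENNReal.div_lt_iff (Or.inl hJ0) (Or.inl hJt.ne)] at hk2
    rwa [mul_comm]
  obtain ⟨φ, hφ, hlt⟩ := step
  have hMt := hφ.mass_lt_top hn hp hw hw0
  have hM0 : weightedMass w p φ ≠ 0 := by
    intro h
    rw [h, ENNReal.zero_rpow_of_pos (by positivity), mul_zero] at hlt
    exact not_lt_zero hlt
  set M := (weightedMass w p φ).toReal with hMdef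
  have hMpos : 0 < M := ENNReal.toReal_pos hM0 hMt.ne
  have hMeq : weightedMass w p φ = ENNReal.ofReal M := (ENNReal.ofReal_toReal hMt.ne).symm
  have hc : 0 < M ^ (-(1 / p)) := Real.rpow_pos_of_pos hMpos _
  refine ⟨fun r => M ^ (-(1 / p)) * φ r, hφ.const_mul _, ?_, ?_⟩
  · rw [weightedMass_const_mul, hMeq, ← ENNReal.ofReal_mul (by positivity), abs_of_pos hc,
      ← Real.rpow_mul hMpos.le, show -(1 / p) * p = -1 by field_simp, Real.rpow_neg_one,
      inv_mul_cancel₀ hMpos.ne', ENNReal.ofReal_one]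
  · rw [weightedEnergy_const_mul, ENNReal.mul_rpow_of_nonneg _ _ (by norm_num),
      ENNReal.ofReal_rpow_of_pos (by positivity), ← Real.sqrt_eq_rpow, Real.sqrt_sq hc.le]
    calc _ < ENNReal.ofReal (M ^ (-(1 / p))) * (J * weightedMass w p φ ^ (1 / p)) :=
          ENNReal.mul_lt_mul_right (by simpa using hc) ENNReal.ofReal_ne_top hlt
      _ = J := by
          rw [mul_left_comm, hMeq, ENNReal.ofReal_rpow_of_pos hMpos,
            ← ENNReal.ofReal_mul hc.le, ← Real.rpow_add hMpos, neg_add_cancel, Real.rpow_zero,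
            ENNReal.ofReal_one, mul_one]

/-- The reverse triangle inequality for difference quotients; where `|f|` is not differentiable its
`deriv` is `0` by convention. -/
lemma abs_deriv_abs_le {r : ℝ} (hf : DifferentiableAt ℝ f r) :
    |deriv (fun s => |f s|) r| ≤ |deriv f r| := by
  by_cases h : DifferentiableAt ℝ (fun s => |f s|) r
  · have h1 := (hasDerivAt_iff_tendsto_slope.1 h.hasDerivAt).abs
    have h2 := (hasDerivAt_iff_tendsto_slope.1 hf.hasDerivAt).abs
    refine le_of_tendsto_of_tendsto h1 h2 (Eventually.of_forall fun s => ?_)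
    simp only [slope_def_field, abs_div]
    exact div_le_div_of_nonneg_right (abs_abs_sub_abs_le (f s) (f r)) (abs_nonneg _)
  · rw [deriv_zero_of_not_differentiableAt h, abs_zero]
    exact abs_nonneg _

lemma LocAC.weightedEnergy_abs_le (hf : LocAC f) (hw : IsDecayWeight w) :
    weightedEnergy w (fun r => |f r|) ≤ weightedEnergy w f := by
  unfold weightedEnergy
  refine lintegral_mono_ae ?_
  filter_upwards [ae_restrict_mem measurableSet_Ioi, ae_restrict_of_ae hf.ae_differentiableAt]
    with r hr h1
  have := hw.pos r hr
  have := abs_deriv_abs_le (h1 hr)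
  gcongr

lemma weightedMass_abs (w f : ℝ → ℝ) (p : ℝ) :
    weightedMass w p (fun r => |f r|) = weightedMass w p f := by
  simp [weightedMass]

lemma energyOn_Ioc_add_Ioi (w f : ℝ → ℝ) {R : ℝ} (hR : 0 ≤ R) :
    energyOn w f (Ioc 0 R) + energyOn w f (Ioi R) = weightedEnergy w f := by
  unfold energyOn weightedEnergy
  rw [← lintegral_union measurableSet_Ioi (Ioc_disjoint_Ioi le_rfl), Ioc_union_Ioi_eq_Ioi hR]

lemma massOn_Ioc_add_Ioi (w f : ℝ → ℝ) (p : ℝ) {R : ℝ} (hR : 0 ≤ R) :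
    massOn w p f (Ioc 0 R) + massOn w p f (Ioi R) = weightedMass w p f := by
  unfold massOn weightedMass
  rw [← lintegral_union measurableSet_Ioi (Ioc_disjoint_Ioi le_rfl), Ioc_union_Ioi_eq_Ioi hR]

lemma tendsto_energyOn_Ioc (hw : IsDecayWeight w) (f : ℝ → ℝ) :
    Tendsto (fun R => energyOn w f (Ioc 0 R)) atTop (𝓝 (weightedEnergy w f)) := by
  have h := (aecover_Iic (μ := volume.restrict (Ioi (0 : ℝ)))
    (tendsto_id (α := ℝ) (x := atTop))).lintegral_tendsto_of_countably_generated
      (hw.aemeasurable_energy f subset_rfl)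
  refine h.congr fun R => ?_
  rw [Measure.restrict_restrict measurableSet_Iic, id, inter_comm, Ioi_inter_Iic]
  rfl

end Functionals

/-! ### Existence of a minimizer. -/

section Minimizer

variable {n : ℕ} {ψ w f : ℝ → ℝ} {p α κ : ℝ}

/-- Decay of functions of finite energy. -/
lemma LocAC.abs_sq_le {b C B : ℝ} (hw : IsDecayWeight w) (hf : LocAC f)
    (hf0 : Tendsto f atTop (𝓝 0)) (hC : 0 < C) (hB : 0 ≤ B)
    (hE : weightedEnergy w f ≤ ENNReal.ofReal B)
    (htail : ∀ r, 0 < r → ∫⁻ s in Ioi r, ENNReal.ofReal (w s)⁻¹ ≤ ENNReal.ofReal (C * r ^ (-b)))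
    {r : ℝ} (hr : 0 < r) : |f r| ^ 2 ≤ C * B * r ^ (-b) := by
  have h := (ofReal_abs_sq_le hw hf hf0 hr).trans (mul_le_mul' (htail r hr) hE)
  rw [← ENNReal.ofReal_mul (by positivity), ← ENNReal.ofReal_pow (abs_nonneg _),
    ENNReal.ofReal_le_ofReal_iff (by positivity)] at h
  linarith

lemma abs_rpow_le_of_sq_le {x K r b : ℝ} (hp : 0 ≤ p) (hK : 0 ≤ K) (hr : 0 < r)
    (h : |x| ^ 2 ≤ K * r ^ (-b)) : |x| ^ p ≤ K ^ (p / 2) * r ^ (-(b / 2 * p)) := by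
  have h1 : |x| ^ p = (|x| ^ 2) ^ (p / 2) := by
    rw [← Real.rpow_natCast, ← Real.rpow_mul (abs_nonneg x)]
    congr 1
    push_cast
    ring
  rw [h1]
  refine (Real.rpow_le_rpow (by positivity) h (by positivity)).trans (le_of_eq ?_)
  rw [Real.mul_rpow hK (by positivity), ← Real.rpow_mul hr.le]
  congr 2
  ring

/-- Local compactness: the mass near the pole passes to the limit. -/
lemma tendsto_massOn_Ioc {b C B T : ℝ} (hw : IsDecayWeight w) (hp : 0 < p) (hC : 0 < C)
    (hB : 0 ≤ B)
    (htail : ∀ r, 0 < r → ∫⁻ s in Ioi r, ENNReal.ofReal (w s)⁻¹ ≤ ENNReal.ofReal (C * r ^ (-b)))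
    (hint : IntegrableOn (fun r => r ^ (-(b / 2 * p)) * w r) (Ioc 0 T))
    {φ : ℕ → ℝ → ℝ} (hφ : ∀ k, LocAC (φ k)) (hφ0 : ∀ k, Tendsto (φ k) atTop (𝓝 0))
    (hE : ∀ k, weightedEnergy w (φ k) ≤ ENNReal.ofReal B)
    (hpt : ∀ r, 0 < r → Tendsto (fun k => φ k r) atTop (𝓝 (f r))) :
    Tendsto (fun k => massOn w p (φ k) (Ioc 0 T)) atTop (𝓝 (massOn w p f (Ioc 0 T))) := by
  have hS : Ioc 0 T ⊆ Ioi 0 := Ioc_subset_Ioi_self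
  refine tendsto_lintegral_of_dominated_convergence'
    (fun r => ENNReal.ofReal ((C * B) ^ (p / 2) * (r ^ (-(b / 2 * p)) * w r)))
    (fun k => hw.aemeasurable_mass (hφ k).continuousOn hS) (fun k => ?_) ?_ ?_
  · filter_upwards [ae_restrict_mem measurableSet_Ioc] with r hr
    have h1 := abs_rpow_le_of_sq_le hp.le (by positivity) hr.1
      ((hφ k).abs_sq_le hw (hφ0 k) hC hB (hE k) htail hr.1)
    have h2 := hw.pos r hr.1
    rw [← mul_assoc]
    gcongr
  · have h5 := (hint.const_mul ((C * B) ^ (p / 2))).2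
    rw [hasFiniteIntegral_iff_ofReal] at h5
    · exact h5.ne
    · filter_upwards [ae_restrict_mem measurableSet_Ioc] with r hr
      have := hw.pos r hr.1
      have := hr.1
      change 0 ≤ (C * B) ^ (p / 2) * (r ^ (-(b / 2 * p)) * w r)
      positivity
  · filter_upwards [ae_restrict_mem measurableSet_Ioc] with r hr
    exact IsDecayWeight.tendsto_mass_integrand hp.le (hpt r hr.1)

lemma ENNReal_sq_of_rpow_half {x : ℝ≥0∞} : (x ^ (1 / 2 : ℝ)) ^ 2 = x := by
  rw [← ENNReal.rpow_two, ← ENNReal.rpow_mul]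
  norm_num

/-- For `x ≤ 1` and `p ≥ 2` one has `x ≤ x^(2/p)`. The resulting linear bound can be added over
inner and outer regions. -/
lemma mul_le_of_mul_rpow_le {c x y : ℝ≥0∞} (hp : 2 ≤ p) (hx : x ≤ 1)
    (h : c * x ^ (1 / p) ≤ y ^ (1 / 2 : ℝ)) : c ^ 2 * x ≤ y := by
  have h1 := pow_le_pow_left₀ zero_le h 2
  rw [ENNReal_sq_of_rpow_half, mul_pow, ← ENNReal.rpow_two (x ^ (1 / p)), ← ENNReal.rpow_mul] at h1
  refine le_trans ?_ h1
  gcongr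
  conv_lhs => rw [← ENNReal.rpow_one x]
  refine ENNReal.rpow_le_rpow_of_exponent_ge hx ?_
  rw [div_mul_eq_mul_div, one_mul, div_le_one (by linarith)]
  exact hp

/-- Existence of a normalized nonnegative minimizer under the strict inequality
`I_{ψ,q} < I_α`. -/
theorem exists_normalized_minimizer (hn : 2 ≤ n) (hα : 1 < α) (hκ : 0 < κ)
    (hψ : IsModelFunction ψ)
    (hasymp : Tendsto (fun r : ℝ => ψ r / (κ * r ^ α)) atTop (𝓝 1))
    (hI : sobolevInf n ψ (twoStar n α - 1) < asymptoticInf n α κ) :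
    ∃ f : ℝ → ℝ, LocAC f ∧ Tendsto f atTop (𝓝 0) ∧ (∀ r, 0 ≤ f r) ∧
      weightedMass (fun r => ψ r ^ (n - 1)) (twoStar n α) f = 1 ∧
      weightedEnergy (fun r => ψ r ^ (n - 1)) f = sobolevInf n ψ (twoStar n α - 1) ^ 2 := by
  have hn1 : 1 ≤ n := by omega
  have hm : 1 ≤ n - 1 := by omega
  have hp2 := two_lt_twoStar hn hα
  have hw := hψ.isDecayWeight hκ hα hasymp hm
  have hw0 := fun R => hψ.integrableOn_Ioc (n - 1) R
  obtain ⟨b, hb0, hb1, hb2, hb3⟩ := exists_decay_exponent hm hα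
  obtain ⟨C, hC, htail⟩ := hψ.exists_tail_le hκ hasymp hb0 hb1 hb2
  rw [← twoStar_eq hn1] at hb3
  have hint := fun T => hψ.integrableOn_rpow_mul hb3 T
  set p := twoStar n α with hpdef
  set I := sobolevInf n ψ (p - 1) with hIdef
  have hp0 : 0 < p := by linarith
  -- `c² > I²` will be the price per unit of mass escaping to infinity.
  obtain ⟨c, hIc, hcA⟩ := ENNReal.lt_iff_exists_nnreal_btwn.1 hI
  have hc0 : 0 < (c : ℝ) := by
    have := zero_le.trans_lt hIc
    exact_mod_cast this
  have hIt : I < ⊤ := hIc.trans ENNReal.coe_lt_top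
  set w : ℝ → ℝ := fun r => ψ r ^ (n - 1) with hwdef
  have hcof : ENNReal.ofReal (c : ℝ) = c := ENNReal.ofReal_coe_nnreal
  obtain ⟨R₀, hR₀, hout⟩ := exists_radius_mass_le_energy hn hα hκ hasymp hc0
    (by rwa [hcof])
  rw [hcof] at hout
  -- a minimizing sequence
  obtain ⟨J, -, hJ, hJlim⟩ := exists_seq_strictAnti_tendsto' hIc
  have hmin := fun k => exists_isRadialC1c_energy_lt hn1 hp0 hw hw0 (hJ k).1
    ((hJ k).2.trans ENNReal.coe_lt_top)
  choose φ hφ hφM hφE using hmin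
  have hφAC := fun k => (hφ k).locAC hn1
  have hφ0 := fun k => (hφ k).tendsto_zero hn1
  have hφE2 : ∀ k, weightedEnergy w (φ k) ≤ J k ^ 2 := fun k => by
    have := pow_le_pow_left₀ zero_le (hφE k).le 2
    rwa [ENNReal_sq_of_rpow_half] at this
  have hφB : ∀ k, weightedEnergy w (φ k) ≤ ENNReal.ofReal ((c : ℝ) ^ 2) := fun k => by
    rw [ENNReal.ofReal_pow hc0.le, hcof]
    exact (hφE2 k).trans (pow_le_pow_left₀ zero_le (hJ k).2.le 2)
  obtain ⟨f, s, hs, hfAC, hf0, hfE, hpt, hlsc⟩ :=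
    exists_subseq_tendsto_of_energy_le hw φ hφAC hφ0 _ ENNReal.ofReal_lt_top hφB
  have hfD : f ∈ D12rad n ψ := mem_D12rad_of_energy_lt_top hw hfAC hfE hf0
  have hfM1 : weightedMass w p f ≤ 1 := by
    refine (weightedMass_le_liminf hw hp0.le (fun k => (hφAC (s k)).continuousOn) hpt).trans ?_
    have h1 : (fun k => weightedMass w p (φ (s k))) = fun _ => 1 := funext fun k => hφM (s k)
    rw [h1, liminf_const]
  -- splitting at a large radius
  have hsplit : ∀ R, R₀ ≤ R → energyOn w f (Ioc 0 R) + c ^ 2 * (1 - weightedMass w p f) ≤ I ^ 2 := by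
    intro R hR
    have hR0 : 0 ≤ R := hR₀.le.trans hR
    -- Energy is split at `R` but mass at `R + 1`. Mass in between counts as inner mass, which
    -- converges, so the mismatch is harmless.
    have hk : ∀ k, energyOn w (φ k) (Ioc 0 R) +
        c ^ 2 * (1 - massOn w p (φ k) (Ioc 0 (R + 1))) ≤ J k ^ 2 := by
      intro k
      have h1 := massOn_Ioc_add_Ioi w (φ k) p (show 0 ≤ R + 1 by linarith)
      rw [hφM] at h1
      have h2 : 1 - massOn w p (φ k) (Ioc 0 (R + 1)) ≤ massOn w p (φ k) (Ioi (R + 1)) := by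
        rw [← h1]
        exact add_tsub_le_left
      have h3 : massOn w p (φ k) (Ioi (R + 1)) ≤ 1 := by
        rw [← h1]
        exact le_add_self
      have h4 := mul_le_of_mul_rpow_le hp2.le h3 (hout R hR (φ k) (hφ k))
      refine le_trans ?_ (hφE2 k)
      rw [← energyOn_Ioc_add_Ioi w (φ k) hR0]
      gcongr
      exact (mul_le_mul_right h2 _).trans h4
    have hmass := tendsto_massOn_Ioc (T := R + 1) hw hp0 hC (sq_nonneg (c : ℝ)) htail (hint _)
      (fun k => hφAC (s k)) (fun k => hφ0 (s k)) (fun k => hφB (s k)) hpt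
    have hJs : Tendsto (fun k => J (s k) ^ 2) atTop (𝓝 (I ^ 2)) :=
      ENNReal.Tendsto.pow (hJlim.comp hs.tendsto_atTop)
    have hm1 : Tendsto (fun k => (c : ℝ≥0∞) ^ 2 * (1 - massOn w p (φ (s k)) (Ioc 0 (R + 1)))) atTop
        (𝓝 (c ^ 2 * (1 - massOn w p f (Ioc 0 (R + 1))))) :=
      ENNReal.Tendsto.const_mul (ENNReal.Tendsto.sub tendsto_const_nhds hmass
        (Or.inl ENNReal.one_ne_top)) (Or.inr (by simp))
    -- The inner energies need not converge; lower semicontinuity only puts them eventually above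
    -- each `η` below the limit energy.
    have hstep : ∀ η, η < energyOn w f (Ioc 0 R) →
        η + c ^ 2 * (1 - massOn w p f (Ioc 0 (R + 1))) ≤ I ^ 2 := by
      intro η hη
      refine le_of_tendsto_of_tendsto (tendsto_const_nhds.add hm1) hJs ?_
      filter_upwards [eventually_lt_of_lt_liminf (hη.trans_le
        (hlsc (Ioc 0 R) measurableSet_Ioc Ioc_subset_Ioi_self))] with k hk'
      exact (add_le_add hk'.le le_rfl).trans (hk (s k))
    have hle : massOn w p f (Ioc 0 (R + 1)) ≤ weightedMass w p f :=
      lintegral_mono_set Ioc_subset_Ioi_self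
    have hIfin : I ^ 2 ≠ ⊤ := ENNReal.pow_ne_top hIt.ne
    refine le_trans (add_le_add le_rfl (mul_le_mul_right (tsub_le_tsub_left hle 1) _)) ?_
    rcases eq_or_ne (energyOn w f (Ioc 0 R)) 0 with h0 | h0
    · rw [h0, zero_add]
      refine le_of_tendsto_of_tendsto hm1 hJs (Eventually.of_forall fun k => ?_)
      exact le_add_self.trans (hk (s k))
    · have hfin : c ^ 2 * (1 - massOn w p f (Ioc 0 (R + 1))) ≠ ⊤ :=
        ENNReal.mul_ne_top (by simp) (ENNReal.sub_ne_top ENNReal.one_ne_top)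
      have hle2 : c ^ 2 * (1 - massOn w p f (Ioc 0 (R + 1))) ≤ I ^ 2 :=
        le_add_self.trans (hstep 0 (pos_iff_ne_zero.2 h0))
      have : energyOn w f (Ioc 0 R) ≤ I ^ 2 - c ^ 2 * (1 - massOn w p f (Ioc 0 (R + 1))) :=
        le_of_forall_lt fun η hη => by
          obtain ⟨η', h1, h2⟩ := exists_between hη
          exact h1.trans_le (ENNReal.le_sub_of_add_le_right hfin (hstep η' h2))
      calc _ ≤ I ^ 2 - c ^ 2 * (1 - massOn w p f (Ioc 0 (R + 1))) +
            c ^ 2 * (1 - massOn w p f (Ioc 0 (R + 1))) := by gcongr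
        _ = I ^ 2 := tsub_add_cancel_of_le hle2
  have htot : weightedEnergy w f + c ^ 2 * (1 - weightedMass w p f) ≤ I ^ 2 :=
    le_of_tendsto ((tendsto_energyOn_Ioc hw f).add_const _)
      ((eventually_ge_atTop R₀).mono hsplit)
  have hlow : I ^ 2 * weightedMass w p f ≤ weightedEnergy w f :=
    mul_le_of_mul_rpow_le hp2.le hfM1 (sobolevInf_mul_le hp0 hfD)
  -- Together the two bounds read `I² M + c² (1 - M) ≤ I²`; as `I < c`, mass `M < 1` is impossible.
  have hM : weightedMass w p f = 1 := by
    have h1 := (add_le_add hlow le_rfl).trans htot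
    have hMt : weightedMass w p f ≠ ⊤ := (hfM1.trans_lt ENNReal.one_lt_top).ne
    lift weightedMass w p f to NNReal using hMt with M
    have hIt' := hIt.ne
    lift I to NNReal using hIt' with I'
    have hMle : M ≤ 1 := by exact_mod_cast hfM1
    have hlt : I' < c := by exact_mod_cast hIc
    have h2 : I' ^ 2 * M + c ^ 2 * (1 - M) ≤ I' ^ 2 := by exact_mod_cast h1
    have h3 : (I' : ℝ) ^ 2 * M + c ^ 2 * (1 - M) ≤ I' ^ 2 := by
      have : ((I' ^ 2 * M + c ^ 2 * (1 - M) : NNReal) : ℝ) ≤ ((I' ^ 2 : NNReal) : ℝ) := h2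
      push_cast [NNReal.coe_sub hMle] at this
      exact this
    have h4 : (M : ℝ) = 1 := by
      have h5 : (I' : ℝ) < c := hlt
      have h6 : (M : ℝ) ≤ 1 := hMle
      have h7 : (I' : ℝ) ^ 2 < c ^ 2 := pow_lt_pow_left₀ h5 I'.2 two_ne_zero
      by_contra hne
      have h8 : 0 < 1 - (M : ℝ) := sub_pos.2 (lt_of_le_of_ne h6 hne)
      nlinarith [mul_pos (sub_pos.2 h7) h8]
    have h5 : M = 1 := by exact_mod_cast h4
    rw [h5, ENNReal.coe_one]
  have hEle : weightedEnergy w f ≤ I ^ 2 := le_self_add.trans htot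
  -- Passing to `|f|` preserves the mass and does not raise the energy; the infimum forces equality.
  have habsE : weightedEnergy w (fun r => |f r|) ≤ weightedEnergy w f :=
    hfAC.weightedEnergy_abs_le hw
  have habs0 : Tendsto (fun r => |f r|) atTop (𝓝 0) := by simpa using hf0.abs
  refine ⟨fun r => |f r|, hfAC.abs, habs0, fun r => abs_nonneg _, ?_,
    le_antisymm (habsE.trans hEle) ?_⟩
  · rw [weightedMass_abs, hM]
  · have h1 := mul_le_of_mul_rpow_le (x := 1) hp2.le le_rfl (by
      have := sobolevInf_mul_le hp0
        (mem_D12rad_of_energy_lt_top hw hfAC.abs (habsE.trans_lt hfE) habs0)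
      rwa [weightedMass_abs, hM] at this)
    rwa [mul_one] at h1

end Minimizer

/-! ### First variation. -/

section EulerLagrange

variable {n : ℕ} {ψ w f : ℝ → ℝ} {p lam : ℝ}

/-- The graph of the convex function `|·|^p` lies above its tangent at `a`. Dividing by `a^p`
reduces it to Bernoulli's inequality, and for `x/a < -1` the tangent is already negative. -/
lemma rpow_add_mul_le_abs_add_rpow {a x : ℝ} (ha : 0 ≤ a) (hp : 1 < p) :
    a ^ p + p * a ^ (p - 1) * x ≤ |a + x| ^ p := by
  rcases ha.eq_or_lt with rfl | ha
  · rw [Real.zero_rpow (by linarith), Real.zero_rpow (by linarith)]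
    simp only [mul_zero, zero_mul, zero_add]
    positivity
  have h1 : a ^ p + p * a ^ (p - 1) * x = a ^ p * (1 + p * (x / a)) := by
    rw [Real.rpow_sub_one ha.ne']
    field_simp
  have h2 : |a + x| ^ p = a ^ p * |1 + x / a| ^ p := by
    rw [← Real.mul_rpow ha.le (abs_nonneg _), ← abs_of_pos ha, ← abs_mul, abs_of_pos ha]
    congr 2
    field_simp
  rw [h1, h2]
  refine mul_le_mul_of_nonneg_left ?_ (by positivity)
  rcases le_or_gt (-1) (x / a) with h | h
  · rw [abs_of_nonneg (by linarith)]
    exact one_add_mul_self_le_rpow_one_add h hp.le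
  · refine le_trans ?_ (Real.rpow_nonneg (abs_nonneg _) p)
    nlinarith

lemma ofReal_integral_le_lintegral {μ : Measure ℝ} {g : ℝ → ℝ} (hg : Integrable g μ) :
    ENNReal.ofReal (∫ r, g r ∂μ) ≤ ∫⁻ r, ENNReal.ofReal (g r) ∂μ := by
  refine ENNReal.ofReal_le_of_le_toReal ?_
  rw [integral_eq_lintegral_pos_part_sub_lintegral_neg_part hg]
  exact sub_le_self _ ENNReal.toReal_nonneg

lemma integral_add_const_mul_sq {μ : Measure ℝ} {H h : ℝ → ℝ} (hH : MemLp H 2 μ)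
    (hh : MemLp h 2 μ) (τ : ℝ) :
    ∫ r, (H r + τ * h r) ^ 2 ∂μ =
      (∫ r, H r ^ 2 ∂μ) + 2 * τ * (∫ r, H r * h r ∂μ) + τ ^ 2 * ∫ r, h r ^ 2 ∂μ := by
  have hi : Integrable (fun r => H r * h r) μ := hH.integrable_mul hh
  have hi2 : Integrable (fun r => H r ^ 2 + 2 * τ * (H r * h r)) μ :=
    hH.integrable_sq.add (hi.const_mul (2 * τ))
  rw [← integral_const_mul, ← integral_const_mul,
    ← integral_add hH.integrable_sq (hi.const_mul (2 * τ)),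
    ← integral_add hi2 (hh.integrable_sq.const_mul _)]
  exact integral_congr_ae (Eventually.of_forall fun r => by ring)

lemma weightedEnergy_add_tailPrimitive (hw : IsDecayWeight w) (hf : LocAC f)
    (hE : weightedEnergy w f < ⊤) {h : ℝ → ℝ} (hh : MemLp h 2 (volume.restrict (Ioi 0))) (τ : ℝ) :
    weightedEnergy w (fun r => f r + τ * tailPrimitive w h r) =
      ENNReal.ofReal (∫ r in Ioi 0, (deriv f r * √(w r) + τ * h r) ^ 2) := by
  have hf2 := hw.memLp_of_energy hE
  have hi : Integrable (fun r => (deriv f r * √(w r) + τ * h r) ^ 2) (volume.restrict (Ioi 0)) :=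
    (hf2.add (hh.const_mul τ)).integrable_sq
  rw [ofReal_integral_eq_lintegral_ofReal hi (Eventually.of_forall fun r => sq_nonneg _)]
  refine setLIntegral_congr_fun_ae measurableSet_Ioi ?_
  filter_upwards [hf.ae_differentiableAt, (tailPrimitive_locAC hw hh).ae_differentiableAt,
    deriv_tailPrimitive hw hh] with r h1 h2 h3 hr
  have hwr := hw.pos r hr
  have := Real.sqrt_pos.2 hwr
  rw [deriv_fun_add (h1 hr) ((h2 hr).const_mul τ), deriv_const_mul_field, h3 hr,
    ← sq_abs_mul_sqrt hwr.le]
  congr 2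
  field_simp

/-- First variation of a normalized minimizer in the direction of a tail primitive. -/
lemma first_variation (hp : 2 < p) (hw : IsDecayWeight fun r => ψ r ^ (n - 1))
    (hf : LocAC f) (hf0 : Tendsto f atTop (𝓝 0)) (hfnn : ∀ r, 0 ≤ f r)
    (hM : weightedMass (fun r => ψ r ^ (n - 1)) p f = 1)
    (hE : weightedEnergy (fun r => ψ r ^ (n - 1)) f = sobolevInf n ψ (p - 1) ^ 2)
    (hlam0 : 0 ≤ lam) (hlam : weightedEnergy (fun r => ψ r ^ (n - 1)) f = ENNReal.ofReal lam)
    {h : ℝ → ℝ} (hh : MemLp h 2 (volume.restrict (Ioi 0)))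
    (hint : IntegrableOn (fun r => f r ^ (p - 1) *
      tailPrimitive (fun r => ψ r ^ (n - 1)) h r * ψ r ^ (n - 1)) (Ioi 0)) :
    ∫ r in Ioi 0, deriv f r * √(ψ r ^ (n - 1)) * h r =
      lam * ∫ r in Ioi 0, f r ^ (p - 1) *
        tailPrimitive (fun r => ψ r ^ (n - 1)) h r * ψ r ^ (n - 1) := by
  set w : ℝ → ℝ := fun r => ψ r ^ (n - 1) with hwdef
  set φ := tailPrimitive w h with hφ
  set B := ∫ r in Ioi 0, f r ^ (p - 1) * φ r * w r with hB
  set D := ∫ r in Ioi 0, deriv f r * √(w r) * h r with hD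
  set K := ∫ r in Ioi 0, h r ^ 2 with hK
  have hEt : weightedEnergy w f < ⊤ := hlam ▸ ENNReal.ofReal_lt_top
  change IntegrableOn (fun r => f r ^ (p - 1) * φ r * w r) (Ioi 0) at hint
  have hf2 := hw.memLp_of_energy hEt
  have hlamint : ∫ r in Ioi 0, (deriv f r * √(w r)) ^ 2 = lam := by
    have h1 := weightedEnergy_add_tailPrimitive hw hf hEt hh 0
    simp only [zero_mul, add_zero] at h1
    rw [hlam] at h1
    exact ((ENNReal.ofReal_eq_ofReal_iff hlam0 (integral_nonneg fun r => sq_nonneg _)).1 h1).symm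
  have hexp : ∀ τ : ℝ, ∫ r in Ioi 0, (deriv f r * √(w r) + τ * h r) ^ 2 =
      lam + 2 * τ * D + τ ^ 2 * K := fun τ => by
    rw [integral_add_const_mul_sq hf2 hh, hlamint]
  have hmassint : IntegrableOn (fun r => f r ^ p * w r) (Ioi 0) := by
    refine ⟨?_, ?_⟩
    · exact ((hf.continuousOn.rpow_const fun x _ => Or.inr (by linarith)).mul
        hw.continuousOn).aestronglyMeasurable measurableSet_Ioi
    · rw [hasFiniteIntegral_iff_ofReal]
      · refine lt_of_le_of_lt (le_of_eq ?_) (hM ▸ ENNReal.one_lt_top)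
        exact lintegral_congr fun r => by rw [abs_of_nonneg (hfnn r)]
      · filter_upwards [ae_restrict_mem measurableSet_Ioi] with r hr
        exact mul_nonneg (Real.rpow_nonneg (hfnn r) p) (hw.pos r hr).le
  have hmass1 : ∫ r in Ioi 0, f r ^ p * w r = 1 := by
    rw [integral_eq_lintegral_of_nonneg_ae _ hmassint.1]
    · have : ∫⁻ r in Ioi 0, ENNReal.ofReal (f r ^ p * w r) = 1 := by
        rw [← hM]
        exact lintegral_congr fun r => by rw [abs_of_nonneg (hfnn r)]
      rw [this, ENNReal.toReal_one]
    · filter_upwards [ae_restrict_mem measurableSet_Ioi] with r hr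
      exact mul_nonneg (Real.rpow_nonneg (hfnn r) p) (hw.pos r hr).le
  have hφAC := tailPrimitive_locAC hw hh
  have hkey : ∀ τ : ℝ, 0 < 1 + p * B * τ →
      lam * (1 + p * B * τ) ^ (2 / p) ≤ lam + 2 * τ * D + τ ^ 2 * K := by
    intro τ hτ
    have hEτ := weightedEnergy_add_tailPrimitive hw hf hEt hh τ
    rw [hexp] at hEτ
    have hD12 : (fun r => f r + τ * φ r) ∈ D12rad n ψ := by
      refine mem_D12rad_of_energy_lt_top hw (hf.add (hφAC.const_mul τ)) ?_ ?_
      · exact hEτ ▸ ENNReal.ofReal_lt_top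
      · simpa using hf0.add ((tailPrimitive_tendsto hw hh).const_mul τ)
    -- Convexity gives a one-sided linear bound, which suffices for minimality and avoids
    -- differentiating the mass under the integral.
    have hMτ : ENNReal.ofReal (1 + p * B * τ) ≤ weightedMass w p (fun r => f r + τ * φ r) := by
      have h1 : 1 + p * B * τ =
          ∫ r in Ioi 0, (f r ^ p * w r + p * τ * (f r ^ (p - 1) * φ r * w r)) := by
        rw [integral_add hmassint (hint.const_mul _), hmass1, integral_const_mul]
        ring
      rw [h1]
      have hi2 : IntegrableOn (fun r => f r ^ p * w r +
          p * τ * (f r ^ (p - 1) * φ r * w r)) (Ioi 0) := hmassint.add (hint.const_mul _)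
      refine (ofReal_integral_le_lintegral hi2).trans ?_
      refine setLIntegral_mono' measurableSet_Ioi fun r hr => ENNReal.ofReal_le_ofReal ?_
      have h2 := rpow_add_mul_le_abs_add_rpow (x := τ * φ r) (hfnn r) (by linarith : 1 < p)
      have h3 := mul_le_mul_of_nonneg_right h2 (hw.pos r hr).le
      refine le_trans (le_of_eq ?_) h3
      ring
    have h1 := pow_le_pow_left₀ zero_le (sobolevInf_mul_le (by linarith : 0 < p) hD12) 2
    rw [ENNReal_sq_of_rpow_half, mul_pow, ← hE, hlam, hEτ, ← ENNReal.rpow_two,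
      ← ENNReal.rpow_mul, one_div_mul_eq_div] at h1
    have h2 : ENNReal.ofReal (lam * (1 + p * B * τ) ^ (2 / p)) ≤
        ENNReal.ofReal (lam + 2 * τ * D + τ ^ 2 * K) := by
      refine le_trans ?_ h1
      rw [ENNReal.ofReal_mul hlam0, ← ENNReal.ofReal_rpow_of_pos hτ]
      gcongr
    refine (ENNReal.ofReal_le_ofReal_iff ?_).1 h2
    rw [← hexp]
    exact integral_nonneg fun r => sq_nonneg _
  -- This function is nonnegative near `0` and vanishes at `0`; its derivative there, `2D - 2 lam
  -- B`, must be zero.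
  have hmin : IsLocalMin (fun τ : ℝ => lam + 2 * τ * D + τ ^ 2 * K -
      lam * (1 + p * B * τ) ^ (2 / p)) 0 := by
    have h1 : ∀ᶠ τ : ℝ in 𝓝 0, 0 < 1 + p * B * τ := by
      have : ContinuousAt (fun τ : ℝ => 1 + p * B * τ) 0 := by fun_prop
      exact this.eventually (lt_mem_nhds (by simp))
    filter_upwards [h1] with τ hτ
    have := hkey τ hτ
    simp only [mul_zero, zero_mul, add_zero, Real.one_rpow, mul_one, ne_eq, OfNat.ofNat_ne_zero,
      not_false_eq_true, zero_pow, sub_self]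
    linarith
  have hder : HasDerivAt (fun τ : ℝ => lam + 2 * τ * D + τ ^ 2 * K -
      lam * (1 + p * B * τ) ^ (2 / p)) (2 * D - 2 * (lam * B)) 0 := by
    have h1 : HasDerivAt (fun τ : ℝ => 1 + p * B * τ) (p * B) 0 := by
      simpa using ((hasDerivAt_id (0 : ℝ)).const_mul (p * B)).const_add 1
    have h2 := (h1.rpow_const (p := 2 / p) (Or.inl (by simp))).const_mul lam
    have h3 : HasDerivAt (fun τ : ℝ => lam + 2 * τ * D + τ ^ 2 * K) (2 * D) 0 := by
      have a1 := (((hasDerivAt_id (0 : ℝ)).const_mul 2).mul_const D).const_add lam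
      have a2 := ((hasDerivAt_id (0 : ℝ)).pow 2).mul_const K
      refine (a1.add a2).congr_deriv ?_
      simp
    refine (h3.sub h2).congr_deriv ?_
    simp only [mul_zero, add_zero, Real.one_rpow, mul_one]
    field_simp
  have := hmin.hasDerivAt_eq_zero hder
  linarith

end EulerLagrange

/-! ### The Euler–Lagrange equation in flux form. -/

section IntegralEquation

variable {n : ℕ} {ψ w f : ℝ → ℝ} {p lam : ℝ}

/-- The function `-1_{(s,t]} / √w`. -/
noncomputable def testDensity (w : ℝ → ℝ) (s t : ℝ) : ℝ → ℝ :=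
  (Ioc s t).indicator fun r => -(√(w r))⁻¹

lemma testDensity_memLp (hw : IsDecayWeight w) {s t : ℝ} (hs : 0 < s) :
    MemLp (testDensity w s t) 2 (volume.restrict (Ioi 0)) := by
  rw [testDensity, memLp_indicator_iff_restrict measurableSet_Ioc,
    Measure.restrict_restrict measurableSet_Ioc]
  refine MemLp.neg ((hw.memLp_inv_sqrt hs).mono_measure (Measure.restrict_mono ?_ le_rfl))
  exact fun x hx => hx.1.1

/-- The test function is constant on `(0,s]`, decreases with slope `-1/w` on `(s,t]` and vanishes
beyond `t`. Being constant rather than zero near the pole, it enforces the natural boundary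
condition of zero flux there. -/
lemma tailPrimitive_testDensity (hw : IsDecayWeight w) {s t : ℝ} (hs : 0 < s) {r : ℝ}
    (hr : 0 < r) :
    tailPrimitive w (testDensity w s t) r = ∫ x in Ioi r ∩ Ioc s t, (w x)⁻¹ := by
  have hh := testDensity_memLp (t := t) hw hs
  have hE : weightedEnergy w (tailPrimitive w (testDensity w s t)) < ⊤ := by
    have := energyOn_tailPrimitive hw hh measurableSet_Ioi (subset_refl (Ioi 0))
    exact this.trans_lt (lintegral_sq_lt_top hh)
  rw [(tailPrimitive_locAC hw hh).eq_neg_integral hw hE (tailPrimitive_tendsto hw hh) hr,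
    ← integral_neg, ← setIntegral_indicator measurableSet_Ioc]
  refine setIntegral_congr_ae measurableSet_Ioi ?_
  filter_upwards [deriv_tailPrimitive hw hh] with x hx hxr
  have hx0 : 0 < x := hr.trans hxr
  rw [hx hx0]
  by_cases hxs : x ∈ Ioc s t
  · have hwx := hw.pos x hx0
    rw [testDensity, indicator_of_mem hxs, indicator_of_mem hxs, neg_div, neg_neg, div_eq_mul_inv,
      ← mul_inv, Real.mul_self_sqrt hwx.le]
  · simp [testDensity, hxs]

lemma integral_deriv_mul_testDensity (hw : IsDecayWeight w) (hf : LocAC f) {s t : ℝ} (hs : 0 < s)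
    (hst : s ≤ t) :
    ∫ r in Ioi 0, deriv f r * √(w r) * testDensity w s t r = f s - f t := by
  have h1 : ∫ r in Ioi 0, deriv f r * √(w r) * testDensity w s t r =
      ∫ r in Ioi 0, (Ioc s t).indicator (fun r => -deriv f r) r := by
    refine setIntegral_congr_fun measurableSet_Ioi fun r hr => ?_
    by_cases hrs : r ∈ Ioc s t
    · have := Real.sqrt_pos.2 (hw.pos r hr)
      simp only [testDensity, indicator_of_mem hrs]
      field_simp
    · simp [testDensity, hrs]
  rw [h1, setIntegral_indicator measurableSet_Ioc,
    inter_eq_right.2 (show Ioc s t ⊆ Ioi 0 from fun x hx => hs.trans hx.1), integral_neg,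
    ← intervalIntegral.integral_of_le hst, (hf s t hs hst).integral_deriv_eq_sub]
  ring

/-- Domination by `f^(p-1) ≤ 1 + f^p`: the weight is integrable near the pole and the mass is
finite. -/
lemma integrableOn_rpow_sub_one (hp : 1 ≤ p) (hw : IsDecayWeight w)
    (hw0 : ∀ R, IntegrableOn w (Ioc 0 R)) (hf : LocAC f) (hfnn : ∀ r, 0 ≤ f r)
    (hM : weightedMass w p f < ⊤) (T : ℝ) :
    IntegrableOn (fun r => f r ^ (p - 1) * w r) (Ioc 0 T) := by
  have hcont : ∀ q : ℝ, 0 ≤ q → ContinuousOn (fun r => f r ^ q * w r) (Ioi 0) := fun q hq =>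
    (hf.continuousOn.rpow_const fun x _ => Or.inr hq).mul hw.continuousOn
  have hmass : IntegrableOn (fun r => f r ^ p * w r) (Ioi 0) := by
    refine ⟨(hcont p (by linarith)).aestronglyMeasurable measurableSet_Ioi, ?_⟩
    rw [hasFiniteIntegral_iff_ofReal]
    · refine lt_of_le_of_lt (le_of_eq ?_) hM
      exact lintegral_congr fun r => by rw [abs_of_nonneg (hfnn r)]
    · filter_upwards [ae_restrict_mem measurableSet_Ioi] with r hr
      exact mul_nonneg (Real.rpow_nonneg (hfnn r) p) (hw.pos r hr).le
  refine Integrable.mono' ((hw0 T).add (hmass.mono_set Ioc_subset_Ioi_self))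
    (((hcont (p - 1) (by linarith)).mono Ioc_subset_Ioi_self).aestronglyMeasurable
      measurableSet_Ioc) ?_
  filter_upwards [ae_restrict_mem measurableSet_Ioc] with r hr
  have hwr := hw.pos r hr.1
  have hfr := hfnn r
  rw [Real.norm_of_nonneg (by positivity), Pi.add_apply, ← one_add_mul]
  refine mul_le_mul_of_nonneg_right ?_ hwr.le
  have hnn : 0 ≤ f r ^ p := by positivity
  rcases le_or_gt (f r) 1 with h | h
  · linarith [Real.rpow_le_one hfr h (by linarith : 0 ≤ p - 1)]
  · linarith [Real.rpow_le_rpow_of_exponent_le h.le (by linarith : p - 1 ≤ p)]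

/-- The flux `∫_0^r f^{p-1} w`. -/
noncomputable def flux (w f : ℝ → ℝ) (p r : ℝ) : ℝ := ∫ x in (0 : ℝ)..r, f x ^ (p - 1) * w x

lemma hasDerivAt_flux (hp : 1 ≤ p) (hw : IsDecayWeight w) (hf : ContinuousOn f (Ioi 0))
    (hint : ∀ T, IntegrableOn (fun r => f r ^ (p - 1) * w r) (Ioc 0 T)) {r : ℝ} (hr : 0 < r) :
    HasDerivAt (flux w f p) (f r ^ (p - 1) * w r) r := by
  have hcont : ContinuousOn (fun r => f r ^ (p - 1) * w r) (Ioi 0) :=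
    (hf.rpow_const fun x _ => Or.inr (by linarith)).mul hw.continuousOn
  exact intervalIntegral.integral_hasDerivAt_right
    ((intervalIntegrable_iff_integrableOn_Ioc_of_le hr.le).2 (hint r))
    (hcont.stronglyMeasurableAtFilter isOpen_Ioi r hr) (hcont.continuousAt (Ioi_mem_nhds hr))

/-- Integration by parts on `[s,t]` against the flux. The boundary term at `s` cancels the
contribution of `(0,s]`, where the test function is the constant `G s`; the one at `t` vanishes
since `G t = 0`. -/
lemma integral_mul_tailPrimitive_testDensity (hp : 1 ≤ p) (hw : IsDecayWeight w)
    (hf : ContinuousOn f (Ioi 0))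
    (hint : ∀ T, IntegrableOn (fun r => f r ^ (p - 1) * w r) (Ioc 0 T)) {s t : ℝ}
    (hs : 0 < s) (hst : s ≤ t) :
    IntegrableOn (fun r => f r ^ (p - 1) * tailPrimitive w (testDensity w s t) r * w r) (Ioi 0) ∧
    ∫ r in Ioi 0, f r ^ (p - 1) * tailPrimitive w (testDensity w s t) r * w r =
      ∫ r in s..t, flux w f p r / w r := by
  have ht : 0 < t := hs.trans_le hst
  set G : ℝ → ℝ := fun r => ∫ x in r..t, (w x)⁻¹ with hG
  set F : ℝ → ℝ := fun r => f r ^ (p - 1) * tailPrimitive w (testDensity w s t) r * w r with hF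
  have hwinv : ContinuousOn (fun r => (w r)⁻¹) (Ioi 0) :=
    hw.continuousOn.inv₀ fun x hx => (hw.pos x hx).ne'
  have hsub : uIcc s t ⊆ Ioi 0 := by
    rw [uIcc_of_le hst]; exact fun x hx => hs.trans_le hx.1
  have hGd : ∀ r ∈ uIcc s t, HasDerivAt G (-(w r)⁻¹) r := by
    intro r hr
    have hr0 : 0 < r := hsub hr
    refine intervalIntegral.integral_hasDerivAt_left ?_
      (hwinv.stronglyMeasurableAtFilter isOpen_Ioi r hr0) (hwinv.continuousAt (Ioi_mem_nhds hr0))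
    refine (hwinv.mono fun x hx => ?_).intervalIntegrable
    exact (lt_min hr0 ht).trans_le hx.1
  have hcont : ContinuousOn (fun r => f r ^ (p - 1) * w r) (Ioi 0) :=
    (hf.rpow_const fun x _ => Or.inr (by linarith)).mul hw.continuousOn
  have h1 : EqOn (fun r => G s * (f r ^ (p - 1) * w r)) F (Ioc 0 s) := by
    intro r hr
    simp only [F, G]
    rw [tailPrimitive_testDensity hw hs hr.1,
      inter_eq_right.2 (show Ioc s t ⊆ Ioi r from fun x hx => hr.2.trans_lt hx.1),
      ← intervalIntegral.integral_of_le hst]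
    ring
  have h2 : EqOn (fun r => G r * (f r ^ (p - 1) * w r)) F (Ioc s t) := by
    intro r hr
    simp only [F, G]
    rw [tailPrimitive_testDensity hw hs (hs.trans hr.1),
      intervalIntegral.integral_of_le hr.2,
      show Ioi r ∩ Ioc s t = Ioc r t from by
        ext x
        exact ⟨fun hx => ⟨hx.1, hx.2.2⟩, fun hx => ⟨hx.1, hr.1.trans hx.1, hx.2⟩⟩]
    ring
  have h3 : EqOn (fun _ => (0 : ℝ)) F (Ioi t) := by
    intro r hr
    have hr : t < r := hr
    simp only [F]
    rw [tailPrimitive_testDensity hw hs (ht.trans hr),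
      show Ioi r ∩ Ioc s t = ∅ from by
        ext x
        simp only [mem_inter_iff, mem_Ioi, mem_Ioc, mem_empty_iff_false, iff_false]
        intro hx
        linarith]
    simp
  have hGc : ContinuousOn (fun r => G r * (f r ^ (p - 1) * w r)) (Icc s t) := by
    refine ContinuousOn.mul (fun r hr => ?_) (hcont.mono fun x hx => hs.trans_le hx.1)
    rw [← uIcc_of_le hst] at hr
    exact (hGd r hr).continuousAt.continuousWithinAt
  have i1 : IntegrableOn F (Ioc 0 s) :=
    (integrableOn_congr_fun h1 measurableSet_Ioc).1 ((hint s).const_mul _)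
  have i2 : IntegrableOn F (Ioc s t) :=
    (integrableOn_congr_fun h2 measurableSet_Ioc).1
      (hGc.integrableOn_Icc.mono_set Ioc_subset_Icc_self)
  have i3 : IntegrableOn F (Ioi t) :=
    (integrableOn_congr_fun h3 measurableSet_Ioi).1 integrableOn_zero
  have hparts : ∫ r in s..t, G r * (f r ^ (p - 1) * w r) =
      -(G s * flux w f p s) + ∫ r in s..t, flux w f p r / w r := by
    have := intervalIntegral.integral_mul_deriv_eq_deriv_mul (u := G) (v := flux w f p)
      (u' := fun r => -(w r)⁻¹) (v' := fun r => f r ^ (p - 1) * w r) (a := s) (b := t) hGd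
      (fun r hr => hasDerivAt_flux hp hw hf hint (hsub hr))
      ((hwinv.mono hsub).neg.intervalIntegrable) ((hcont.mono hsub).intervalIntegrable)
    rw [this]
    have hGt : G t = 0 := intervalIntegral.integral_same
    have : ∫ r in s..t, -(w r)⁻¹ * flux w f p r = -∫ r in s..t, flux w f p r / w r := by
      rw [← intervalIntegral.integral_neg]
      exact intervalIntegral.integral_congr fun r _ => by ring
    rw [hGt, this]
    ring
  rw [← Ioc_union_Ioi_eq_Ioi ht.le, ← Ioc_union_Ioc_eq_Ioc hs.le hst]
  refine ⟨(i1.union i2).union i3, ?_⟩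
  rw [setIntegral_union (by
      rw [Ioc_union_Ioc_eq_Ioc hs.le hst]; exact Ioc_disjoint_Ioi le_rfl) measurableSet_Ioi
      (i1.union i2) i3, setIntegral_union (Ioc_disjoint_Ioc_of_le le_rfl) measurableSet_Ioc i1 i2,
    ← setIntegral_congr_fun measurableSet_Ioc h1, ← setIntegral_congr_fun measurableSet_Ioc h2,
    ← setIntegral_congr_fun measurableSet_Ioi h3, ← intervalIntegral.integral_of_le hst, hparts,
    integral_const_mul, ← intervalIntegral.integral_of_le hs.le]
  simp [flux]

/-- The Euler–Lagrange equation of a normalized minimizer, in integrated form. -/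
theorem minimizer_hasDerivAt (hp : 2 < p) (hw : IsDecayWeight fun r => ψ r ^ (n - 1))
    (hw0 : ∀ R, IntegrableOn (fun r => ψ r ^ (n - 1)) (Ioc 0 R))
    (hf : LocAC f) (hf0 : Tendsto f atTop (𝓝 0)) (hfnn : ∀ r, 0 ≤ f r)
    (hM : weightedMass (fun r => ψ r ^ (n - 1)) p f = 1)
    (hE : weightedEnergy (fun r => ψ r ^ (n - 1)) f = sobolevInf n ψ (p - 1) ^ 2)
    (hlam0 : 0 ≤ lam) (hlam : weightedEnergy (fun r => ψ r ^ (n - 1)) f = ENNReal.ofReal lam)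
    {r : ℝ} (hr : 0 < r) :
    HasDerivAt f (-(lam * (flux (fun r => ψ r ^ (n - 1)) f p r / ψ r ^ (n - 1)))) r := by
  set w : ℝ → ℝ := fun r => ψ r ^ (n - 1) with hwdef
  have hp1 : 1 ≤ p := by linarith
  have hint := integrableOn_rpow_sub_one hp1 hw hw0 hf hfnn (hM ▸ ENNReal.one_lt_top)
  -- The first variation tested with `testDensity w s t` is already the integrated equation.
  have heq : ∀ s t, 0 < s → s ≤ t → f s - f t = lam * ∫ x in s..t, flux w f p x / w x := by
    intro s t hs hst
    obtain ⟨h1, h2⟩ := integral_mul_tailPrimitive_testDensity hp1 hw hf.continuousOn hint hs hst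
    rw [← h2, ← integral_deriv_mul_testDensity hw hf hs hst]
    exact first_variation hp hw hf hf0 hfnn hM hE hlam0 hlam (testDensity_memLp hw hs) h1
  have hcont : ContinuousOn (fun x => flux w f p x / w x) (Ioi 0) := by
    refine ContinuousOn.div (fun x hx => ?_) hw.continuousOn fun x hx => (hw.pos x hx).ne'
    exact (hasDerivAt_flux hp1 hw hf.continuousOn hint hx).continuousAt.continuousWithinAt
  have hd : HasDerivAt (fun t => ∫ x in (r / 2)..t, flux w f p x / w x) (flux w f p r / w r) r := by
    refine intervalIntegral.integral_hasDerivAt_right ?_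
      (hcont.stronglyMeasurableAtFilter isOpen_Ioi r hr) (hcont.continuousAt (Ioi_mem_nhds hr))
    refine (hcont.mono fun x hx => ?_).intervalIntegrable
    exact (lt_min (half_pos hr) hr).trans_le hx.1
  refine ((hd.const_mul lam).const_sub (f (r / 2))).congr_of_eventuallyEq ?_
  filter_upwards [lt_mem_nhds (half_lt_self hr)] with t ht
  have := heq (r / 2) t (half_pos hr) ht.le
  linarith

end IntegralEquation

/-! ### Boundedness at the pole by bootstrap. -/

section PoleRegularity

variable {m : ℕ} {ψ w f : ℝ → ℝ} {p lam : ℝ}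

lemma monotoneOn_Ioc_of_hasDerivAt {f f' : ℝ → ℝ} {T : ℝ}
    (h : ∀ r, 0 < r → HasDerivAt f (f' r) r) (h0 : ∀ r, 0 < r → r < T → 0 ≤ f' r) :
    MonotoneOn f (Ioc 0 T) := by
  refine monotoneOn_of_deriv_nonneg (convex_Ioc 0 T)
    (fun r hr => (h r hr.1).continuousAt.continuousWithinAt) (fun r hr => ?_) fun r hr => ?_
  · rw [interior_Ioc] at hr
    exact (h r hr.1).differentiableAt.differentiableWithinAt
  · rw [interior_Ioc] at hr
    rw [(h r hr.1).deriv]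
    exact h0 r hr.1 hr.2

lemma flux_nonneg (hw : ∀ r, 0 < r → 0 < w r) (hf : ∀ r, 0 ≤ f r) {r : ℝ} (hr : 0 ≤ r) :
    0 ≤ flux w f p r := by
  rw [flux, intervalIntegral.integral_of_le hr]
  exact setIntegral_nonneg measurableSet_Ioc fun x hx =>
    mul_nonneg (Real.rpow_nonneg (hf x) _) (hw x hx.1).le

/-- One step of the bootstrap argument at the pole. -/
lemma le_of_rpow_bound (hψ : IsModelFunction ψ) (hp : 2 < p) (hlam : 0 ≤ lam)
    (hf : ∀ r, 0 ≤ f r)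
    (hint : ∀ T, IntegrableOn (fun r => f r ^ (p - 1) * ψ r ^ m) (Ioc 0 T))
    (hd : ∀ r, 0 < r →
      HasDerivAt f (-(lam * (flux (fun r => ψ r ^ m) f p r / ψ r ^ m))) r)
    {K a e : ℝ} (hK : 0 ≤ K) (ha : (p - 1) * a < m + 1)
    (hfK : ∀ r ∈ Ioc (0 : ℝ) 1, f r ≤ K * r ^ (-a)) (he0 : e ≠ 0) (he : (p - 1) * a - 2 ≤ e) :
    ∃ D : ℝ, 0 ≤ D ∧ ∀ r ∈ Ioc (0 : ℝ) 1, f r ≤ f 1 - D / e + D / e * r ^ (-e) := by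
  obtain ⟨c, C, hc, hC, hloc⟩ := hψ.exists_bounds 1
  set δ := (m : ℝ) + 1 - (p - 1) * a with hδ
  have hδ0 : 0 < δ := by linarith
  set D := lam * (K ^ (p - 1) * C ^ m / δ / c ^ m) with hDdef
  have hD : 0 ≤ D := by positivity
  have hflux : ∀ r ∈ Ioc (0 : ℝ) 1,
      flux (fun r => ψ r ^ m) f p r ≤ K ^ (p - 1) * C ^ m / δ * r ^ δ := by
    intro r hr
    have h1 : ∫ x in (0 : ℝ)..r, K ^ (p - 1) * C ^ m * x ^ (δ - 1) =
        K ^ (p - 1) * C ^ m / δ * r ^ δ := by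
      rw [intervalIntegral.integral_const_mul, integral_rpow (Or.inl (by linarith)),
        sub_add_cancel, Real.zero_rpow hδ0.ne', sub_zero]
      ring
    rw [← h1]
    refine intervalIntegral.integral_mono_on_of_le_Ioo hr.1.le
      ((intervalIntegrable_iff_integrableOn_Ioc_of_le hr.1.le).2 (hint r))
      ((intervalIntegral.intervalIntegrable_rpow' (by linarith)).const_mul _) fun x hx => ?_
    have hx1 : x ∈ Ioc (0 : ℝ) 1 := ⟨hx.1, hx.2.le.trans hr.2⟩
    have hψx := hψ.pos x hx.1
    calc f x ^ (p - 1) * ψ x ^ m ≤ (K * x ^ (-a)) ^ (p - 1) * (C * x) ^ m :=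
          mul_le_mul (Real.rpow_le_rpow (hf x) (hfK x hx1) (by linarith))
            (pow_le_pow_left₀ hψx.le (hloc x hx1).2 m) (by positivity)
            (Real.rpow_nonneg (mul_nonneg hK (Real.rpow_nonneg hx.1.le _)) _)
      _ = K ^ (p - 1) * C ^ m * x ^ (δ - 1) := by
        rw [Real.mul_rpow hK (Real.rpow_nonneg hx.1.le _), ← Real.rpow_mul hx.1.le, mul_pow,
          show δ - 1 = -a * (p - 1) + m by rw [hδ]; ring, Real.rpow_add hx.1, Real.rpow_natCast]
        ring
  have hderiv : ∀ r ∈ Ioc (0 : ℝ) 1,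
      lam * (flux (fun r => ψ r ^ m) f p r / ψ r ^ m) ≤ D * r ^ (-e - 1) := by
    intro r hr
    have hr0 := hr.1
    have h1 : flux (fun r => ψ r ^ m) f p r / ψ r ^ m ≤
        (K ^ (p - 1) * C ^ m / δ * r ^ δ) / (c * r) ^ m := by
      refine div_le_div₀ ?_ (hflux r hr) (by positivity)
        (pow_le_pow_left₀ (by positivity) (hloc r hr).1 m)
      positivity
    refine (mul_le_mul_of_nonneg_left h1 hlam).trans ?_
    have h2 : lam * ((K ^ (p - 1) * C ^ m / δ * r ^ δ) / (c * r) ^ m) =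
        D * r ^ (δ - m) := by
      rw [Real.rpow_sub hr0 δ m, Real.rpow_natCast, hDdef, mul_pow]
      field_simp
    rw [h2]
    refine mul_le_mul_of_nonneg_left ?_ hD
    exact Real.rpow_le_rpow_of_exponent_ge hr0 hr.2 (by rw [hδ]; linarith)
  refine ⟨D, hD, fun r hr => ?_⟩
  -- The bound `f' ≥ -D r^(-e-1)` makes `f - (D/e) r^(-e)` nondecreasing for either sign of `e`.
  -- Positive `e` yields a new power bound, negative `e` yields boundedness.
  have hmono := monotoneOn_Ioc_of_hasDerivAt (f := fun r => f r - D / e * r ^ (-e))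
    (f' := fun r => -(lam * (flux (fun r => ψ r ^ m) f p r / ψ r ^ m)) -
      D / e * (-e * r ^ (-e - 1))) (T := 1)
    (fun r hr => (hd r hr).sub ((Real.hasDerivAt_rpow_const (Or.inl hr.ne')).const_mul (D / e)))
    (fun r hr hr1 => by
      have h1 := hderiv r ⟨hr, hr1.le⟩
      have h2 : D / e * (-e * r ^ (-e - 1)) = -(D * r ^ (-e - 1)) := by field_simp
      rw [h2]
      linarith)
  have := hmono hr (right_mem_Ioc.2 one_pos) hr.2
  simp only [Real.one_rpow, mul_one] at this
  linarith

/-- A solution with subcritical growth at the pole is bounded there. -/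
lemma exists_bound_near_pole (hψ : IsModelFunction ψ) (hp : 2 < p) (hlam : 0 ≤ lam)
    (hf : ∀ r, 0 ≤ f r)
    (hint : ∀ T, IntegrableOn (fun r => f r ^ (p - 1) * ψ r ^ m) (Ioc 0 T))
    (hd : ∀ r, 0 < r →
      HasDerivAt f (-(lam * (flux (fun r => ψ r ^ m) f p r / ψ r ^ m))) r)
    {K₀ a₀ : ℝ} (hK₀ : 0 ≤ K₀) (ha₀ : 0 < a₀) (ha₁ : (p - 1) * a₀ < m + 1)
    (ha₂ : (p - 2) * a₀ < 2) (hfK : ∀ r ∈ Ioc (0 : ℝ) 1, f r ≤ K₀ * r ^ (-a₀)) :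
    ∃ K : ℝ, ∀ r ∈ Ioc (0 : ℝ) 1, f r ≤ K := by
  -- A positive floor for the exponents: it avoids `e = 0`, where the primitive would be a
  -- logarithm, and gives `(p-1)ε - 2 ≤ -1`, so one last step with a negative exponent bounds `f`.
  set ε := min a₀ (1 / (p - 1)) with hε
  have hε0 : 0 < ε := lt_min ha₀ (by apply div_pos one_pos; linarith)
  have hε1 : (p - 1) * ε ≤ 1 := by
    have := mul_le_mul_of_nonneg_left (min_le_right a₀ (1 / (p - 1))) (by linarith : 0 ≤ p - 1)
    rwa [mul_one_div_cancel (by linarith : p - 1 ≠ 0)] at this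
  -- The guaranteed gain per step above the floor: `(p-1)a - 2 = a - (2 - (p-2)a) ≤ a - δ` whenever
  -- `a ≤ a₀`.
  set δ := 2 - (p - 2) * a₀ with hδ
  have hδ0 : 0 < δ := by linarith
  have hle : ∀ k : ℕ, max (a₀ - k * δ) ε ≤ a₀ := fun k =>
    max_le (by have : (0 : ℝ) ≤ k * δ := by positivity
               linarith) (min_le_left _ _)
  have hsub : ∀ k : ℕ, (p - 1) * max (a₀ - k * δ) ε < m + 1 := fun k =>
    (mul_le_mul_of_nonneg_left (hle k) (by linarith)).trans_lt ha₁
  have hind : ∀ k : ℕ, ∃ K : ℝ, 0 ≤ K ∧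
      ∀ r ∈ Ioc (0 : ℝ) 1, f r ≤ K * r ^ (-max (a₀ - k * δ) ε) := by
    intro k
    induction k with
    | zero =>
      refine ⟨K₀, hK₀, ?_⟩
      have : max (a₀ - ((0 : ℕ) : ℝ) * δ) ε = a₀ := by
        rw [Nat.cast_zero, zero_mul, sub_zero]
        exact max_eq_left (min_le_left _ _)
      rwa [this]
    | succ k ih =>
      obtain ⟨K, hK, hKf⟩ := ih
      set a := max (a₀ - k * δ) ε with ha
      set e := max (a₀ - ((k + 1 : ℕ) : ℝ) * δ) ε with he
      have he0 : 0 < e := lt_max_of_lt_right hε0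
      have hae : (p - 1) * a - 2 ≤ e := by
        have h1 : (p - 1) * a - 2 ≤ a - δ := by
          have := mul_le_mul_of_nonneg_left (hle k) (by linarith : 0 ≤ p - 2)
          rw [hδ]
          linarith
        refine h1.trans ?_
        rcases max_choice (a₀ - k * δ) ε with h | h
        · rw [ha, h]
          refine le_trans (le_of_eq ?_) (le_max_left _ _)
          push_cast
          ring
        · rw [ha, h]
          exact (by linarith : ε - δ ≤ ε).trans (le_max_right _ _)
      obtain ⟨D, hD, hDf⟩ := le_of_rpow_bound hψ hp hlam hf hint hd hK (hsub k) hKf he0.ne' hae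
      refine ⟨f 1 + D / e, add_nonneg (hf 1) (by positivity), fun r hr => (hDf r hr).trans ?_⟩
      have h1 : 1 ≤ r ^ (-e) := Real.one_le_rpow_of_pos_of_le_one_of_nonpos hr.1 hr.2 (by linarith)
      have h2 := mul_le_mul_of_nonneg_left h1 (hf 1)
      have h3 : 0 ≤ D / e := by positivity
      linarith
  obtain ⟨k, hk⟩ := exists_nat_gt (a₀ / δ)
  rw [div_lt_iff₀ hδ0] at hk
  obtain ⟨K, hK, hKf⟩ := hind k
  have hmax : max (a₀ - k * δ) ε = ε := max_eq_right (by linarith)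
  have h1 := hsub k
  rw [hmax] at hKf h1
  have hneg : (p - 1) * ε - 2 < 0 := by linarith
  obtain ⟨D, hD, hDf⟩ := le_of_rpow_bound hψ hp hlam hf hint hd hK h1 hKf hneg.ne le_rfl
  refine ⟨f 1 - D / ((p - 1) * ε - 2), fun r hr => (hDf r hr).trans ?_⟩
  have h2 : D / ((p - 1) * ε - 2) ≤ 0 := div_nonpos_of_nonneg_of_nonpos hD hneg.le
  have h3 : 0 ≤ r ^ (-((p - 1) * ε - 2)) := Real.rpow_nonneg hr.1.le _
  nlinarith

end PoleRegularity

/-! ### Positivity, limit at the pole and rescaling. -/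

section PositiveMinimizer

variable {n : ℕ} {ψ : ℝ → ℝ} {α κ : ℝ}

/-- The profile of the solution: a positive Sobolev minimizer, continuous up to the pole, solving
the first-order form `w F' = -∫_0^r F^{p-1} w` of the Lane–Emden equation. -/
theorem exists_positive_minimizer (hn : 2 ≤ n) (hα : 1 < α) (hκ : 0 < κ)
    (hψ : IsModelFunction ψ)
    (hasymp : Tendsto (fun r : ℝ => ψ r / (κ * r ^ α)) atTop (𝓝 1))
    (hI : sobolevInf n ψ (twoStar n α - 1) < asymptoticInf n α κ) :
    ∃ F : ℝ → ℝ, IsSobolevMinimizer n ψ (twoStar n α - 1) F ∧ (∀ r, 0 < F r) ∧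
      Tendsto F (𝓝[>] 0) (𝓝 (F 0)) ∧
      (∀ T, IntegrableOn (fun r => F r ^ (twoStar n α - 1) * ψ r ^ (n - 1)) (Ioc 0 T)) ∧
      ∀ r, 0 < r → HasDerivAt F
        (-(flux (fun r => ψ r ^ (n - 1)) F (twoStar n α) r / ψ r ^ (n - 1))) r := by
  have hn1 : 1 ≤ n := by omega
  have hm : 1 ≤ n - 1 := by omega
  have hp2 := two_lt_twoStar hn hα
  have hw := hψ.isDecayWeight hκ hα hasymp hm
  have hw0 := fun R => hψ.integrableOn_Ioc (n - 1) R
  obtain ⟨f, hfAC, hf0, hfnn, hfM, hfE⟩ := exists_normalized_minimizer hn hα hκ hψ hasymp hI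
  obtain ⟨b, hb0, hb1, hb2, hb3⟩ := exists_decay_exponent hm hα
  obtain ⟨C, hC, htail⟩ := hψ.exists_tail_le hκ hasymp hb0 hb1 hb2
  -- Since `p - 2 = 4/(α(n-1) - 1)`, this is just `b < α(n-1) - 1`.
  have hpb : (twoStar n α - 2) * (b / 2) < 2 := by
    rw [twoStar_eq hn1]
    have hpos : 0 < α * ((n - 1 : ℕ) : ℝ) - 1 := hb0.trans hb2
    have : 2 * (α * ((n - 1 : ℕ) : ℝ) + 1) / (α * ((n - 1 : ℕ) : ℝ) - 1) - 2 =
        4 / (α * ((n - 1 : ℕ) : ℝ) - 1) := by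
      field_simp
      ring
    rw [this, div_mul_eq_mul_div, div_lt_iff₀ hpos]
    linarith
  rw [← twoStar_eq hn1] at hb3
  set p := twoStar n α with hpdef
  set w : ℝ → ℝ := fun r => ψ r ^ (n - 1) with hwdef
  set I := sobolevInf n ψ (p - 1) with hIdef
  have hp1 : 1 ≤ p := by linarith
  have hIt : I ≠ ⊤ := (hI.trans_le le_top).ne
  set lam := (I ^ 2).toReal with hlamdef
  have hlam0 : 0 ≤ lam := ENNReal.toReal_nonneg
  have hlam : weightedEnergy w f = ENNReal.ofReal lam := by
    rw [hfE, hlamdef, ENNReal.ofReal_toReal (ENNReal.pow_ne_top hIt)]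
  have hint : ∀ T, IntegrableOn (fun r => f r ^ (p - 1) * w r) (Ioc 0 T) :=
    integrableOn_rpow_sub_one hp1 hw hw0 hfAC hfnn (hfM ▸ ENNReal.one_lt_top)
  have hd : ∀ r, 0 < r → HasDerivAt f (-(lam * (flux w f p r / w r))) r := fun r hr =>
    minimizer_hasDerivAt hp2 hw hw0 hfAC hf0 hfnn hfM hfE hlam0 hlam hr
  have hflux0 : ∀ r, 0 < r → 0 ≤ flux w f p r := fun r hr => flux_nonneg hw.pos hfnn hr.le
  have hfluxmono : ∀ r s, 0 < r → r ≤ s → flux w f p r ≤ flux w f p s := by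
    intro r s hr hrs
    refine monotoneOn_Ioc_of_hasDerivAt (T := s)
      (fun x hx => hasDerivAt_flux hp1 hw hfAC.continuousOn hint hx)
      (fun x hx _ => mul_nonneg (Real.rpow_nonneg (hfnn x) _) (hw.pos x hx).le)
      ⟨hr, hrs⟩ ⟨hr.trans_le hrs, le_rfl⟩ hrs
  have hanti : AntitoneOn f (Ioi 0) := by
    intro r hr s hs hrs
    have := monotoneOn_Ioc_of_hasDerivAt (T := s) (fun x hx => (hd x hx).neg)
      (fun x hx _ => by
        rw [neg_neg]
        exact mul_nonneg hlam0 (div_nonneg (hflux0 x hx) (hw.pos x hx).le))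
      ⟨hr, hrs⟩ ⟨hs, le_rfl⟩ hrs
    simpa using this
  -- the derivative does not vanish identically
  have hnz : ∃ r, 0 < r ∧ lam * flux w f p r ≠ 0 := by
    by_contra hcon
    push Not at hcon
    have hconst : ∀ r, 0 < r → f r = 0 := by
      intro r hr
      refine tendsto_nhds_unique (tendsto_const_nhds.congr' ?_) hf0
      filter_upwards [eventually_ge_atTop r] with s hs
      refine le_antisymm ?_ (hanti hr (hr.trans_le hs) hs)
      refine monotoneOn_Ioc_of_hasDerivAt (T := s) hd (fun x hx _ => ?_)
        ⟨hr, hs⟩ ⟨hr.trans_le hs, le_rfl⟩ hs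
      rw [← mul_div_assoc, hcon x hx, zero_div, neg_zero]
    have : weightedMass w p f = 0 := by
      unfold weightedMass
      rw [setLIntegral_congr_fun (g := fun _ => 0) measurableSet_Ioi fun r hr => ?_]
      · simp
      · simp [hconst r hr, Real.zero_rpow (by linarith : p ≠ 0)]
    rw [hfM] at this
    exact one_ne_zero this
  have hlampos : 0 < lam := by
    obtain ⟨r, -, hr⟩ := hnz
    exact lt_of_le_of_ne hlam0 fun h => hr (by rw [← h, zero_mul])
  -- A zero persists to the right because `f` is nonincreasing and nonnegative. There `f' = 0` kills
  -- the flux, which is nonnegative and nondecreasing, hence zero everywhere, against `hnz`.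
  have hfpos : ∀ r, 0 < r → 0 < f r := by
    intro r₁ hr₁
    refine lt_of_le_of_ne (hfnn r₁) fun h => ?_
    have hzero : ∀ r, r₁ ≤ r → f r = 0 := fun r hr =>
      le_antisymm ((hanti hr₁ (hr₁.trans_le hr) hr).trans h.symm.le) (hfnn r)
    obtain ⟨r₂, hr₂, hne⟩ := hnz
    have hbig : ∀ r, r₁ < r → flux w f p r = 0 := by
      intro r hr
      have hr0 := hr₁.trans hr
      have h1 : HasDerivAt f 0 r := (hasDerivAt_const r (0 : ℝ)).congr_of_eventuallyEq (by
        filter_upwards [lt_mem_nhds hr] with s hs using hzero s hs.le)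
      have h2 := (hd r hr0).unique h1
      rw [neg_eq_zero, mul_eq_zero, div_eq_zero_iff] at h2
      rcases h2 with h2 | h2 | h2
      · exact absurd h2 hlampos.ne'
      · exact h2
      · exact absurd h2 (hw.pos r hr0).ne'
    have h3 : flux w f p r₂ = 0 := le_antisymm
      ((hfluxmono r₂ (max r₁ r₂ + 1) hr₂ ((le_max_right _ _).trans (by linarith))).trans
        (hbig _ ((le_max_left r₁ r₂).trans_lt (by linarith))).le) (hflux0 r₂ hr₂)
    exact hne (by rw [h3, mul_zero])
  -- boundedness at the pole
  obtain ⟨K, hK⟩ : ∃ K : ℝ, ∀ r ∈ Ioc (0 : ℝ) 1, f r ≤ K := by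
    refine exists_bound_near_pole hψ hp2 hlam0 hfnn hint hd (K₀ := √(C * lam)) (a₀ := b / 2)
      (Real.sqrt_nonneg _) (half_pos hb0) ?_ hpb fun r hr => ?_
    · have : (p - 1) * (b / 2) = b / 2 * p - b / 2 := by ring
      linarith
    · have h1 := hfAC.abs_sq_le hw hf0 hC hlam0 hlam.le htail hr.1
      rw [abs_of_nonneg (hfnn r)] at h1
      refine (Real.le_sqrt_of_sq_le h1).trans (le_of_eq ?_)
      have := hr.1
      rw [Real.sqrt_mul (by positivity), Real.sqrt_eq_rpow (r ^ (-b)), ← Real.rpow_mul hr.1.le]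
      congr 2
      ring
  have hbdd : BddAbove (f '' Ioi 0) := by
    refine ⟨max K (f 1), ?_⟩
    rintro _ ⟨r, hr, rfl⟩
    rcases le_or_gt r 1 with h | h
    · exact (hK r ⟨hr, h⟩).trans (le_max_left _ _)
    · exact (hanti (mem_Ioi.2 one_pos) hr h.le).trans (le_max_right _ _)
  have hlim := hanti.tendsto_nhdsGT hbdd
  set L := sSup (f '' Ioi 0) with hL
  have hLpos : 0 < L := (hfpos 1 one_pos).trans_le (le_csSup hbdd ⟨1, mem_Ioi.2 one_pos, rfl⟩)
  -- rescaling
  set σ := lam ^ (1 / (p - 2)) with hσ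
  have hσ0 : 0 < σ := Real.rpow_pos_of_pos hlampos _
  -- This identity absorbs the multiplier: the flux of `σ f` is `σ lam` times that of `f`, while the
  -- Sobolev quotient is scale invariant.
  have hσp : σ ^ (p - 1) = σ * lam := by
    rw [show p - 1 = 1 + (p - 2) by ring, Real.rpow_add hσ0, Real.rpow_one, hσ,
      ← Real.rpow_mul hlam0, one_div_mul_cancel (by linarith), Real.rpow_one]
  set F : ℝ → ℝ := fun r => if 0 < r then σ * f r else σ * L with hF
  have hFf : ∀ r, 0 < r → F r = σ * f r := fun r hr => if_pos hr
  have hFev : ∀ r, 0 < r → F =ᶠ[𝓝 r] fun s => σ * f s := fun r hr => by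
    filter_upwards [lt_mem_nhds hr] with s hs using hFf s hs
  have hEF : weightedEnergy w F = weightedEnergy w (fun r => σ * f r) :=
    setLIntegral_congr_fun measurableSet_Ioi fun r hr => by rw [(hFev r hr).deriv_eq]
  have hMF : weightedMass w p F = weightedMass w p (fun r => σ * f r) :=
    setLIntegral_congr_fun measurableSet_Ioi fun r hr => by rw [hFf r hr]
  have hFD : F ∈ D12rad n ψ := by
    refine mem_D12rad_of_energy_lt_top hw ((hfAC.const_mul σ).congr fun r hr => (hFf r hr).symm)
      ?_ ?_
    · change weightedEnergy w F < ⊤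
      rw [hEF, weightedEnergy_const_mul, hlam, ← ENNReal.ofReal_mul (sq_nonneg _)]
      exact ENNReal.ofReal_lt_top
    · have h1 := hf0.const_mul σ
      rw [mul_zero] at h1
      refine h1.congr' ?_
      filter_upwards [eventually_gt_atTop 0] with r hr using (hFf r hr).symm
  have hfluxF : ∀ r, 0 < r → flux w F p r = σ * lam * flux w f p r := by
    intro r hr
    unfold flux
    rw [← intervalIntegral.integral_const_mul]
    refine intervalIntegral.integral_congr_ae (Eventually.of_forall fun x hx => ?_)
    rw [uIoc_of_le hr.le] at hx
    rw [hFf x hx.1, Real.mul_rpow hσ0.le (hfnn x), hσp]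
    ring
  refine ⟨F, ⟨hFD, ⟨1, one_pos, ?_⟩, ?_⟩, fun r => ?_, ?_, fun T => ?_, fun r hr => ?_⟩
  · rw [hFf 1 one_pos]
    exact (mul_pos hσ0 (hfpos 1 one_pos)).ne'
  · simp only [sobolevQuotient, weightedQuotient, sub_add_cancel]
    change weightedEnergy w F ^ (1 / 2 : ℝ) / weightedMass w p F ^ (1 / p) = I
    rw [hEF, hMF, weightedEnergy_const_mul, weightedMass_const_mul, hfM, mul_one, hfE,
      abs_of_pos hσ0, ENNReal.mul_rpow_of_nonneg _ _ (by norm_num),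
      ENNReal.ofReal_rpow_of_pos (by positivity), ENNReal.ofReal_rpow_of_pos (by positivity),
      ← Real.rpow_mul hσ0.le, mul_one_div_cancel (by linarith), Real.rpow_one,
      ← Real.sqrt_eq_rpow, Real.sqrt_sq hσ0.le, ← ENNReal.rpow_two, ← ENNReal.rpow_mul,
      show (2 : ℝ) * (1 / 2) = 1 by norm_num, ENNReal.rpow_one, mul_comm,
      ENNReal.mul_div_cancel_right (by simpa using hσ0) ENNReal.ofReal_ne_top]
  · by_cases hr : 0 < r
    · rw [hFf r hr]
      exact mul_pos hσ0 (hfpos r hr)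
    · simp only [F, if_neg hr]
      exact mul_pos hσ0 hLpos
  · have : F 0 = σ * L := if_neg (lt_irrefl 0)
    rw [this]
    refine (hlim.const_mul σ).congr' ?_
    filter_upwards [self_mem_nhdsWithin] with r hr using (hFf r hr).symm
  · refine (integrableOn_congr_fun (fun r hr => ?_) measurableSet_Ioc).1
      ((hint T).const_mul (σ * lam))
    rw [hFf r hr.1, Real.mul_rpow hσ0.le (hfnn r), hσp]
    simp only [w]
    ring
  · change HasDerivAt F (-(flux w F p r / w r)) r
    refine (((hd r hr).const_mul σ).congr_of_eventuallyEq (hFev r hr)).congr_deriv ?_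
    rw [hfluxF r hr]
    ring

end PositiveMinimizer

/-! ### Differentiability of radial functions and radial fields. -/

lemma ContinuousWithinAt.tendsto_comp_norm {E : Type*} [SeminormedAddCommGroup E] {G : ℝ → ℝ}
    (h : ContinuousWithinAt G (Ici 0) 0) :
    Tendsto (fun y : E => G ‖y‖) (𝓝 0) (𝓝 (G 0)) := by
  refine Tendsto.comp h (tendsto_nhdsWithin_iff.2 ⟨?_, Eventually.of_forall fun y => norm_nonneg y⟩)
  simpa using (continuous_norm (E := E)).tendsto 0

section RadialFields

variable {E : Type*} [NormedAddCommGroup E] [InnerProductSpace ℝ E]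

lemma hasFDerivAt_norm_of_ne_zero {x : E} (hx : x ≠ 0) :
    HasFDerivAt (fun y : E => ‖y‖) (‖x‖⁻¹ • innerSL ℝ x) x := by
  have hx' : 0 < ‖x‖ := norm_pos_iff.2 hx
  have h := (hasStrictFDerivAt_norm_sq x).hasFDerivAt.sqrt (by positivity)
  have h1 : (fun y : E => √(‖y‖ ^ 2)) = fun y => ‖y‖ := by
    funext y
    exact Real.sqrt_sq (norm_nonneg y)
  rw [h1, Real.sqrt_sq hx'.le] at h
  refine h.congr_fderiv ?_
  ext y
  simp only [smul_apply, smul_eq_mul, nsmul_eq_mul]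
  push_cast
  field_simp

lemma hasFDerivAt_radial_smul_of_ne_zero {G : ℝ → ℝ} {G' : ℝ} {x : E} (hx : x ≠ 0)
    (h : HasDerivAt G G' ‖x‖) :
    HasFDerivAt (fun y : E => G ‖y‖ • y)
      (G ‖x‖ • ContinuousLinearMap.id ℝ E + (G' / ‖x‖) • (innerSL ℝ x).smulRight x) x := by
  refine ((h.comp_hasFDerivAt x (hasFDerivAt_norm_of_ne_zero hx)).smul
    (hasFDerivAt_id x)).congr_fderiv ?_
  ext y
  simp [smul_smul, div_eq_mul_inv, mul_assoc]

/-- `(G ‖y‖ - G 0) • y` is `o(‖y‖)`, so continuity of `G` alone suffices at the origin. -/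
lemma hasFDerivAt_radial_smul_zero {G : ℝ → ℝ} (h : ContinuousWithinAt G (Ici 0) 0) :
    HasFDerivAt (fun y : E => G ‖y‖ • y) (G 0 • ContinuousLinearMap.id ℝ E) 0 := by
  rw [hasFDerivAt_iff_isLittleO_nhds_zero]
  have h1 : Tendsto (fun y : E => G ‖y‖ - G 0) (𝓝 0) (𝓝 0) := by
    simpa using h.tendsto_comp_norm.sub_const (G 0)
  have h2 := ((Asymptotics.isLittleO_one_iff ℝ).2 h1).smul_isBigO
    (Asymptotics.isBigO_refl (fun y : E => y) (𝓝 0))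
  simpa [sub_smul] using h2

/-- Away from the origin the derivative is `G · id + (G'/r) x ⊗ x`, whose second term has norm `|r
G'|`. This is why `r G' → 0` is required, and no bound on `G'` itself. -/
lemma contDiff_one_radial_smul {G G' : ℝ → ℝ} (hG : ContinuousWithinAt G (Ici 0) 0)
    (hd : ∀ r, 0 < r → HasDerivAt G (G' r) r) (hG' : ContinuousOn G' (Ioi 0))
    (h0 : Tendsto (fun r => r * G' r) (𝓝[>] 0) (𝓝 0)) :
    ContDiff ℝ 1 (fun y : E => G ‖y‖ • y) := by
  rw [contDiff_one_iff_hasFDerivAt]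
  refine ⟨fun x => G ‖x‖ • ContinuousLinearMap.id ℝ E +
    (G' ‖x‖ / ‖x‖) • (innerSL ℝ x).smulRight x, ?_, fun x => ?_⟩
  · rw [continuous_iff_continuousAt]
    intro x
    rcases eq_or_ne x 0 with rfl | hx
    · refine ContinuousAt.add ?_ ?_
      · have c0 : ContinuousAt (fun y : E => G ‖y‖) 0 := by
          simpa [ContinuousAt] using hG.tendsto_comp_norm (E := E)
        exact c0.smul continuousAt_const
      · have hb : ∀ x : E, ‖(G' ‖x‖ / ‖x‖) • (innerSL ℝ x).smulRight x‖ = |‖x‖ * G' ‖x‖| := by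
          intro x
          rw [norm_smul, ContinuousLinearMap.norm_smulRight_apply, innerSL_apply_norm,
            Real.norm_eq_abs, abs_div, abs_norm, abs_mul, abs_norm]
          rcases eq_or_ne ‖x‖ 0 with h | h
          · simp [h]
          · field_simp
        have h0' : ContinuousWithinAt (fun r => r * G' r) (Ici 0) 0 := by
          rw [← continuousWithinAt_Ioi_iff_Ici, ContinuousWithinAt, zero_mul]
          exact h0
        have h1 : Tendsto (fun x : E => |‖x‖ * G' ‖x‖|) (𝓝 0) (𝓝 0) := by
          simpa using (h0'.tendsto_comp_norm (E := E)).abs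
        rw [ContinuousAt]
        simp only [norm_zero, div_zero, zero_smul]
        exact squeeze_zero_norm (fun x => (hb x).le) h1
    · have hx' : 0 < ‖x‖ := norm_pos_iff.2 hx
      have c1 : ContinuousAt (fun y : E => G ‖y‖) x :=
        ContinuousAt.comp (g := G) (hd _ hx').continuousAt continuous_norm.continuousAt
      have c2 : ContinuousAt (fun y : E => G' ‖y‖) x :=
        ContinuousAt.comp (g := G') (hG'.continuousAt (Ioi_mem_nhds hx'))
          continuous_norm.continuousAt
      refine (c1.smul continuousAt_const).add ((c2.div continuous_norm.continuousAt hx'.ne').smul ?_)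
      have : Continuous fun y : E => (innerSL ℝ y).smulRight y := by fun_prop
      exact this.continuousAt
  · rcases eq_or_ne x 0 with rfl | hx
    · simpa using hasFDerivAt_radial_smul_zero (E := E) hG
    · exact hasFDerivAt_radial_smul_of_ne_zero hx (hd _ (norm_pos_iff.2 hx))

/-- Writing `F' = r G` turns the gradient into the field `G(‖x‖) x` without division by the norm. At
the origin `F' → 0` gives one-sided derivative zero. -/
lemma hasFDerivAt_radial {F G : ℝ → ℝ} (hF : Tendsto F (𝓝[>] 0) (𝓝 (F 0)))
    (hG : ContinuousWithinAt G (Ici 0) 0) (hd : ∀ r, 0 < r → HasDerivAt F (r * G r) r) (x : E) :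
    HasFDerivAt (fun y : E => F ‖y‖) (innerSL ℝ (G ‖x‖ • x)) x := by
  rcases eq_or_ne x 0 with rfl | hx
  · have h1 : Tendsto (deriv F) (𝓝[>] 0) (𝓝 0) := by
      have h2 : Tendsto (fun r => r * G r) (𝓝[>] 0) (𝓝 (0 * G 0)) :=
        (tendsto_id.mono_left nhdsWithin_le_nhds).mul (hG.mono Ioi_subset_Ici_self)
      rw [zero_mul] at h2
      refine h2.congr' ?_
      filter_upwards [self_mem_nhdsWithin] with r hr using (hd r hr).deriv.symm
    have h3 : HasDerivWithinAt F 0 (Ici 0) 0 :=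
      hasDerivWithinAt_Ici_of_tendsto_deriv (s := Ioi 0)
        (fun r hr => (hd r hr).differentiableAt.differentiableWithinAt) hF self_mem_nhdsWithin h1
    have h4 : (fun r => F r - F 0) =o[𝓝[≥] 0] fun r => r := by
      simpa using hasDerivWithinAt_iff_isLittleO.1 h3
    have h5 : Tendsto (fun y : E => ‖y‖) (𝓝 0) (𝓝[≥] 0) :=
      tendsto_nhdsWithin_iff.2 ⟨by simpa using (continuous_norm (E := E)).tendsto 0,
        Eventually.of_forall fun y => norm_nonneg y⟩
    rw [hasFDerivAt_iff_isLittleO_nhds_zero]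
    simpa [Function.comp_def] using (h4.comp_tendsto h5).of_norm_right
  · have hx' : 0 < ‖x‖ := norm_pos_iff.2 hx
    refine ((hd _ hx').comp_hasFDerivAt x (hasFDerivAt_norm_of_ne_zero hx)).congr_fderiv ?_
    rw [map_smul, smul_smul]
    congr 1
    field_simp

lemma contDiff_two_radial {F G G' : ℝ → ℝ} (hF : Tendsto F (𝓝[>] 0) (𝓝 (F 0)))
    (hG : ContinuousWithinAt G (Ici 0) 0) (hd : ∀ r, 0 < r → HasDerivAt F (r * G r) r)
    (hGd : ∀ r, 0 < r → HasDerivAt G (G' r) r) (hG' : ContinuousOn G' (Ioi 0))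
    (h0 : Tendsto (fun r => r * G' r) (𝓝[>] 0) (𝓝 0)) :
    ContDiff ℝ 2 (fun y : E => F ‖y‖) := by
  rw [show (2 : WithTop ℕ∞) = ((1 : ℕ) : WithTop ℕ∞) + 1 by norm_num,
    contDiff_succ_iff_hasFDerivAt]
  exact ⟨fun x => innerSL ℝ (G ‖x‖ • x),
    (innerSL ℝ : E →L[ℝ] E →L[ℝ] ℝ).contDiff.comp (contDiff_one_radial_smul hG hGd hG' h0),
    hasFDerivAt_radial hF hG hd⟩

end RadialFields

/-! ### The Laplace–Beltrami operator on radial functions. -/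

section ModelMetric

variable {n : ℕ} {ψ : ℝ → ℝ}

lemma modelMetric_zero : modelMetric n ψ 0 = 1 := if_pos rfl

/-- A scalar matrix times a rank-one perturbation of the identity, ready for the matrix determinant
lemma. -/
lemma modelMetric_of_ne_zero {x : EuclideanSpace ℝ (Fin n)} (hx : x ≠ 0)
    (hψ : ψ ‖x‖ ≠ 0) :
    modelMetric n ψ x = (ψ ‖x‖ / ‖x‖) ^ 2 • (1 + Matrix.replicateCol Unit
      (((1 - (ψ ‖x‖ / ‖x‖) ^ 2) / (ψ ‖x‖ / ‖x‖) ^ 2 / ‖x‖ ^ 2) • x.ofLp) *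
        Matrix.replicateRow Unit x.ofLp) := by
  have hx' := norm_ne_zero_iff.2 hx
  rw [modelMetric, if_neg hx]
  ext i j
  simp only [Matrix.of_apply, Matrix.smul_apply, Matrix.add_apply, Matrix.mul_apply,
    Matrix.replicateCol_apply, Matrix.replicateRow_apply, Finset.univ_unique, Finset.sum_singleton,
    Pi.smul_apply, smul_eq_mul, Matrix.one_apply]
  split_ifs <;> field_simp <;> ring

lemma sum_mul_self_eq_norm_sq (x : EuclideanSpace ℝ (Fin n)) : ∑ i, x i * x i = ‖x‖ ^ 2 := by
  rw [EuclideanSpace.real_norm_sq_eq]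
  exact Finset.sum_congr rfl fun i _ => (sq _).symm

lemma det_modelMetric_of_ne_zero {x : EuclideanSpace ℝ (Fin n)} (hx : x ≠ 0)
    (hψ : ψ ‖x‖ ≠ 0) (hn : 1 ≤ n) :
    (modelMetric n ψ x).det = ((ψ ‖x‖ / ‖x‖) ^ (n - 1)) ^ 2 := by
  have hx' := norm_ne_zero_iff.2 hx
  rw [modelMetric_of_ne_zero hx hψ, Matrix.det_smul,
    Matrix.det_one_add_replicateCol_mul_replicateRow, dotProduct_smul, dotProduct,
    sum_mul_self_eq_norm_sq, Fintype.card_fin]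
  obtain ⟨m, rfl⟩ := Nat.exists_eq_add_of_le' hn
  have hc : ψ ‖x‖ / ‖x‖ ≠ 0 := div_ne_zero hψ hx'
  rw [Nat.add_sub_cancel, smul_eq_mul, div_mul_cancel₀ _ (pow_ne_zero 2 hx'), pow_succ, ← pow_mul,
    ← pow_mul, mul_comm m 2, mul_assoc]
  field_simp
  ring

/-- The radial direction has eigenvalue `1`, so the inverse metric leaves radial gradients unchanged
and need not be computed. -/
lemma modelMetric_mulVec_self (x : EuclideanSpace ℝ (Fin n)) :
    (modelMetric n ψ x).mulVec x.ofLp = x.ofLp := by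
  rcases eq_or_ne x 0 with rfl | hx
  · rw [modelMetric_zero, Matrix.one_mulVec]
  have hx' := norm_ne_zero_iff.2 hx
  ext i
  rw [modelMetric, if_neg hx]
  simp only [Matrix.mulVec, dotProduct, Matrix.of_apply]
  have h : ∀ j, (x i * x j / ‖x‖ ^ 2 + (ψ ‖x‖ / ‖x‖) ^ 2 *
      ((if i = j then 1 else 0) - x i * x j / ‖x‖ ^ 2)) * x j =
      (1 - (ψ ‖x‖ / ‖x‖) ^ 2) * (x i / ‖x‖ ^ 2) * (x j * x j) +
        (ψ ‖x‖ / ‖x‖) ^ 2 * (if i = j then x j else 0) := fun j => by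
    split_ifs <;> ring
  rw [Finset.sum_congr rfl fun j _ => h j, Finset.sum_add_distrib, ← Finset.mul_sum,
    ← Finset.mul_sum, sum_mul_self_eq_norm_sq, Finset.sum_ite_eq, if_pos (Finset.mem_univ i)]
  field_simp
  ring

lemma sqrt_det_modelMetric (hψ : ∀ r, 0 < r → 0 < ψ r) (hn : 1 ≤ n)
    {x : EuclideanSpace ℝ (Fin n)} (hx : x ≠ 0) :
    √(modelMetric n ψ x).det = (ψ ‖x‖ / ‖x‖) ^ (n - 1) := by
  have hx' := norm_pos_iff.2 hx
  have := hψ _ hx'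
  rw [det_modelMetric_of_ne_zero hx this.ne' hn, Real.sqrt_sq (by positivity)]

lemma inv_modelMetric_mulVec_self (hψ : ∀ r, 0 < r → 0 < ψ r) (hn : 1 ≤ n)
    (x : EuclideanSpace ℝ (Fin n)) :
    (modelMetric n ψ x)⁻¹.mulVec x.ofLp = x.ofLp := by
  have hdet : IsUnit (modelMetric n ψ x).det := by
    rw [isUnit_iff_ne_zero]
    rcases eq_or_ne x 0 with rfl | hx
    · simp [modelMetric_zero]
    · have hx' := norm_pos_iff.2 hx
      have := hψ _ hx'
      rw [det_modelMetric_of_ne_zero hx this.ne' hn]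
      positivity
  conv_lhs => rw [← modelMetric_mulVec_self (ψ := ψ) x]
  rw [Matrix.mulVec_mulVec, Matrix.nonsing_inv_mul _ hdet, Matrix.one_mulVec]

/-- The Laplace-Beltrami operator of a model manifold on the radial function with profile `F`, in
terms of the profile `Γ` of the weighted gradient field `x ↦ Γ(‖x‖) x`. -/
lemma laplaceBeltrami_radial (hψ : ∀ r, 0 < r → 0 < ψ r) (hn : 1 ≤ n) {F G Γ Γ' : ℝ → ℝ}
    (hF : Tendsto F (𝓝[>] 0) (𝓝 (F 0))) (hG : ContinuousWithinAt G (Ici 0) 0)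
    (hd : ∀ r, 0 < r → HasDerivAt F (r * G r) r)
    (hΓ : ∀ r, 0 < r → Γ r = (ψ r / r) ^ (n - 1) * G r) (hΓ0 : Γ 0 = G 0)
    (hΓc : ContinuousWithinAt Γ (Ici 0) 0) (hΓd : ∀ r, 0 < r → HasDerivAt Γ (Γ' r) r)
    (x : EuclideanSpace ℝ (Fin n)) :
    laplaceBeltrami (modelMetric n ψ) (fun y => F ‖y‖) x =
      if x = 0 then n * G 0
      else ((ψ ‖x‖ / ‖x‖) ^ (n - 1))⁻¹ * (n * Γ ‖x‖ + ‖x‖ * Γ' ‖x‖) := by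
  have hpd : ∀ (j : Fin n) (y : EuclideanSpace ℝ (Fin n)),
      partialDeriv j (fun y => F ‖y‖) y = G ‖y‖ * y j := fun j y => by
    rw [partialDeriv, (hasFDerivAt_radial hF hG hd y).fderiv]
    simp [EuclideanSpace.inner_single_right]
  have hfield : ∀ i : Fin n, (fun y : EuclideanSpace ℝ (Fin n) => √(modelMetric n ψ y).det *
      ∑ j, (modelMetric n ψ y)⁻¹ i j * partialDeriv j (fun y => F ‖y‖) y) =
      fun y => (Γ ‖y‖ • y) i := fun i => by
    funext y
    have h1 : ∑ j, (modelMetric n ψ y)⁻¹ i j * partialDeriv j (fun y => F ‖y‖) y =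
        G ‖y‖ * y i := by
      have h2 := congrFun (inv_modelMetric_mulVec_self hψ hn y) i
      rw [Matrix.mulVec, dotProduct] at h2
      rw [← h2, Finset.mul_sum]
      refine Finset.sum_congr rfl fun j _ => ?_
      rw [hpd]
      ring
    rw [h1, PiLp.smul_apply, smul_eq_mul]
    rcases eq_or_ne y 0 with rfl | hy
    · simp
    · rw [sqrt_det_modelMetric hψ hn hy, hΓ _ (norm_pos_iff.2 hy), mul_assoc]
  have hcomp : ∀ {X' : EuclideanSpace ℝ (Fin n) →L[ℝ] EuclideanSpace ℝ (Fin n)} (i : Fin n),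
      HasFDerivAt (fun y : EuclideanSpace ℝ (Fin n) => Γ ‖y‖ • y) X' x →
      partialDeriv i (fun y : EuclideanSpace ℝ (Fin n) => (Γ ‖y‖ • y) i) x =
        X' (EuclideanSpace.single i 1) i := fun {X'} i h => by
    have := (EuclideanSpace.proj (𝕜 := ℝ) i).hasFDerivAt.comp x h
    rw [partialDeriv, show (fun y : EuclideanSpace ℝ (Fin n) => (Γ ‖y‖ • y) i) =
      (EuclideanSpace.proj (𝕜 := ℝ) i) ∘ fun y : EuclideanSpace ℝ (Fin n) => Γ ‖y‖ • y from rfl,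
      this.fderiv]
    rfl
  rw [laplaceBeltrami, Finset.sum_congr rfl fun i _ => by rw [hfield i]]
  split_ifs with hx
  · subst hx
    rw [Finset.sum_congr rfl fun i _ => hcomp i (hasFDerivAt_radial_smul_zero hΓc)]
    simp [modelMetric_zero, hΓ0]
  · have hx' := norm_pos_iff.2 hx
    rw [sqrt_det_modelMetric hψ hn hx, Finset.sum_congr rfl fun i _ =>
      hcomp i (hasFDerivAt_radial_smul_of_ne_zero hx (hΓd _ hx'))]
    congr 1
    have h3 : ∀ i : Fin n, ((Γ ‖x‖ • ContinuousLinearMap.id ℝ (EuclideanSpace ℝ (Fin n)) +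
        (Γ' ‖x‖ / ‖x‖) • (innerSL ℝ x).smulRight x) (EuclideanSpace.single i 1)) i =
        Γ ‖x‖ + Γ' ‖x‖ / ‖x‖ * (x i * x i) := fun i => by
      simp [EuclideanSpace.inner_single_right]
    rw [Finset.sum_congr rfl fun i _ => h3 i, Finset.sum_add_distrib, ← Finset.mul_sum,
      sum_mul_self_eq_norm_sq]
    simp
    field_simp

end ModelMetric

/-! ### From the flux equation to a classical solution. -/

section ClassicalSolution

variable {n m : ℕ} {ψ F : ℝ → ℝ} {p : ℝ}

lemma IsModelFunction.hasDerivAt (hψ : IsModelFunction ψ) {r : ℝ} (hr : 0 < r) :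
    HasDerivAt ψ (derivWithin ψ (Ici 0) r) r :=
  (((hψ.contDiffOn.differentiableOn (by simp)) r hr.le).hasDerivWithinAt).hasDerivAt
    (Ici_mem_nhds hr)

lemma IsModelFunction.continuousOn_derivWithin (hψ : IsModelFunction ψ) :
    ContinuousOn (derivWithin ψ (Ici 0)) (Ici 0) :=
  hψ.contDiffOn.continuousOn_derivWithin (uniqueDiffOn_Ici 0) (by simp)

lemma IsModelFunction.tendsto_div_inv_pow (hψ : IsModelFunction ψ) (m : ℕ) :
    Tendsto (fun r => ((ψ r / r) ^ m)⁻¹) (𝓝[>] 0) (𝓝 1) := by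
  simpa using (hψ.tendsto_div.pow m).inv₀ (by simp)

lemma IsModelFunction.tendsto_logDeriv (hψ : IsModelFunction ψ) :
    Tendsto (fun r => r * derivWithin ψ (Ici 0) r / ψ r) (𝓝[>] 0) (𝓝 1) := by
  have h1 : Tendsto (derivWithin ψ (Ici 0)) (𝓝[>] 0) (𝓝 1) := by
    have := (hψ.continuousOn_derivWithin 0 self_mem_Ici).mono Ioi_subset_Ici_self
    rwa [ContinuousWithinAt, hψ.deriv_zero] at this
  have h2 := h1.mul (hψ.tendsto_div.inv₀ one_ne_zero)
  rw [inv_one, mul_one] at h2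
  refine h2.congr fun r => ?_
  rw [inv_div]
  ring

/-- The flux through a small sphere around the pole. -/
lemma tendsto_flux_div_pow (hp : 1 ≤ p) (hψ : IsModelFunction ψ)
    (hF : Tendsto F (𝓝[>] 0) (𝓝 (F 0)))
    (hint : ∀ T, IntegrableOn (fun r => F r ^ (p - 1) * ψ r ^ m) (Ioc 0 T))
    (hA : ∀ r, 0 < r → HasDerivAt (flux (fun r => ψ r ^ m) F p) (F r ^ (p - 1) * ψ r ^ m) r) :
    Tendsto (fun r => flux (fun r => ψ r ^ m) F p r / r ^ (m + 1)) (𝓝[>] 0)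
      (𝓝 (F 0 ^ (p - 1) / (m + 1))) := by
  refine HasDerivAt.lhopital_zero_nhdsGT (f' := fun r => F r ^ (p - 1) * ψ r ^ m)
    (g' := fun r => ((m + 1 : ℕ) : ℝ) * r ^ m) ?_ ?_ ?_ ?_ ?_ ?_
  · filter_upwards [self_mem_nhdsWithin] with r hr using hA r hr
  · exact Eventually.of_forall fun r => hasDerivAt_pow (m + 1) r
  · filter_upwards [self_mem_nhdsWithin] with r hr
    have : (0 : ℝ) < r := hr
    positivity
  · have h1 := intervalIntegral.continuousOn_primitive_interval (a := 0) (b := 1)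
      (f := fun r => F r ^ (p - 1) * ψ r ^ m) (μ := volume) (by
        rw [uIcc_of_le zero_le_one, integrableOn_Icc_iff_integrableOn_Ioc]
        exact hint 1)
    have h2 := h1 0 left_mem_uIcc
    rw [uIcc_of_le zero_le_one, ContinuousWithinAt, intervalIntegral.integral_same,
      nhdsWithin_Icc_eq_nhdsGE zero_lt_one] at h2
    exact h2.mono_left (nhdsWithin_mono _ Ioi_subset_Ici_self)
  · have : Continuous fun r : ℝ => r ^ (m + 1) := by fun_prop
    simpa using (this.tendsto 0).mono_left nhdsWithin_le_nhds
  · have h1 := (hF.rpow_const (Or.inr (sub_nonneg.2 hp))).mul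
      ((hψ.tendsto_div.pow m).div_const ((m : ℝ) + 1))
    rw [one_pow, mul_one_div] at h1
    refine h1.congr' ?_
    filter_upwards [self_mem_nhdsWithin] with r hr
    have : (0 : ℝ) < r := hr
    rw [div_pow]
    push_cast
    field_simp

lemma continuousWithinAt_Ici_ite {f : ℝ → ℝ} {l : ℝ} (h : Tendsto f (𝓝[>] 0) (𝓝 l)) :
    ContinuousWithinAt (fun r => if 0 < r then f r else l) (Ici 0) 0 := by
  rw [← continuousWithinAt_Ioi_iff_Ici, ContinuousWithinAt, if_neg (lt_irrefl _)]
  refine h.congr' ?_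
  filter_upwards [self_mem_nhdsWithin] with r hr using (if_pos hr).symm

lemma hasDerivAt_ite_of_pos {f : ℝ → ℝ} {l f' r : ℝ} (hr : 0 < r) (h : HasDerivAt f f' r) :
    HasDerivAt (fun r => if 0 < r then f r else l) f' r := by
  refine h.congr_of_eventuallyEq ?_
  filter_upwards [lt_mem_nhds hr] with s hs using if_pos hs

/-- A positive profile solving the integrated radial equation and continuous at the pole is a
classical solution. -/
theorem isLaneEmdenSolution_of_flux (hn : 1 ≤ n) (hp : 1 ≤ p) (hψ : IsModelFunction ψ)
    (hpos : ∀ r, 0 < F r) (hF : Tendsto F (𝓝[>] 0) (𝓝 (F 0)))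
    (hint : ∀ T, IntegrableOn (fun r => F r ^ (p - 1) * ψ r ^ (n - 1)) (Ioc 0 T))
    (hA : ∀ r, 0 < r → HasDerivAt (flux (fun r => ψ r ^ (n - 1)) F p)
      (F r ^ (p - 1) * ψ r ^ (n - 1)) r)
    (hd : ∀ r, 0 < r → HasDerivAt F
      (-(flux (fun r => ψ r ^ (n - 1)) F p r / ψ r ^ (n - 1))) r) :
    IsLaneEmdenSolution n ψ (p - 1) (fun x : EuclideanSpace ℝ (Fin n) => F ‖x‖) := by
  obtain ⟨m, rfl⟩ := Nat.exists_eq_add_of_le' hn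
  rw [Nat.add_sub_cancel] at hint hA hd
  set A := flux (fun r => ψ r ^ m) F p with hAdef
  set D := derivWithin ψ (Ici 0) with hD
  have hlim := tendsto_flux_div_pow hp hψ hF hint hA
  -- The limit of `A / (ψ^m r)` at the pole; `(m+1) l = F(0)^(p-1)` is the equation at the pole.
  set l : ℝ := F 0 ^ (p - 1) / (m + 1) with hl
  set G : ℝ → ℝ := fun r => if 0 < r then -(A r / (ψ r ^ m * r)) else -l with hGdef
  -- `Γ = (ψ/r)^m G`: the weight cancels, so no `ψ'` enters the divergence, and `(m+1)Γ + rΓ' =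
  -- -F^(p-1) (ψ/r)^m`.
  set Γ : ℝ → ℝ := fun r => if 0 < r then -(A r / r ^ (m + 1)) else -l with hΓdef
  have hGpos : ∀ r, 0 < r → G r = -(A r / (ψ r ^ m * r)) := fun r hr => if_pos hr
  have hΓpos : ∀ r, 0 < r → Γ r = -(A r / r ^ (m + 1)) := fun r hr => if_pos hr
  have hG0 : G 0 = -l := if_neg (lt_irrefl _)
  have hquot : Tendsto (fun r => A r / (ψ r ^ m * r)) (𝓝[>] 0) (𝓝 l) := by
    have h1 := hlim.mul (hψ.tendsto_div_inv_pow m)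
    rw [mul_one] at h1
    refine h1.congr' ?_
    filter_upwards [self_mem_nhdsWithin] with r hr
    have : (0 : ℝ) < r := hr
    have := hψ.pos r hr
    rw [div_pow, ← hAdef]
    field_simp
    ring
  have hGc : ContinuousWithinAt G (Ici 0) 0 := continuousWithinAt_Ici_ite hquot.neg
  have hΓc : ContinuousWithinAt Γ (Ici 0) 0 := continuousWithinAt_Ici_ite hlim.neg
  set G' : ℝ → ℝ := fun r => (-(F r ^ (p - 1)) + A r / (ψ r ^ m * r) * (1 + m * (r * D r / ψ r))) / r
    with hG'def
  set Γ' : ℝ → ℝ := fun r => (-(F r ^ (p - 1) * (ψ r / r) ^ m) + (m + 1) * (A r / r ^ (m + 1))) / r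
    with hΓ'def
  have hGd : ∀ r, 0 < r → HasDerivAt G (G' r) r := fun r hr => by
    have hψr := hψ.pos r hr
    refine hasDerivAt_ite_of_pos hr (((hA r hr).div (((hψ.hasDerivAt hr).pow m).mul
      (hasDerivAt_id r)) (by simp; exact ⟨fun h => absurd h hψr.ne', hr.ne'⟩)).neg.congr_deriv ?_)
    simp only [hG'def, ← hD, id, Pi.mul_apply, Pi.pow_apply]
    rcases m with _ | k
    · simp
      field_simp
      ring
    · rw [Nat.add_sub_cancel]
      push_cast
      field_simp
      ring
  have hΓd : ∀ r, 0 < r → HasDerivAt Γ (Γ' r) r := fun r hr => by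
    refine hasDerivAt_ite_of_pos hr (((hA r hr).div (hasDerivAt_pow (m + 1) r)
      (by positivity)).neg.congr_deriv ?_)
    simp only [hΓ'def, Nat.add_sub_cancel, div_pow]
    push_cast
    field_simp
    ring
  have hFd : ∀ r, 0 < r → HasDerivAt F (r * G r) r := fun r hr => by
    have := hψ.pos r hr
    refine (hd r hr).congr_deriv ?_
    rw [hGpos r hr]
    field_simp
  have hFcont : ContinuousOn F (Ioi 0) := fun r hr => (hd r hr).continuousAt.continuousWithinAt
  have hAcont : ContinuousOn A (Ioi 0) := fun r hr => (hA r hr).continuousAt.continuousWithinAt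
  have hψcont : ContinuousOn ψ (Ioi 0) := hψ.continuousOn.mono Ioi_subset_Ici_self
  have hDcont : ContinuousOn D (Ioi 0) := hψ.continuousOn_derivWithin.mono Ioi_subset_Ici_self
  have hG'c : ContinuousOn G' (Ioi 0) := by
    have hψne : ∀ r ∈ Ioi (0 : ℝ), ψ r ≠ 0 := fun r hr => (hψ.pos r hr).ne'
    have hrne : ∀ r ∈ Ioi (0 : ℝ), r ≠ 0 := fun r hr => ne_of_gt hr
    exact ((hFcont.rpow_const fun r _ => Or.inl (hpos r).ne').neg.add ((hAcont.div
      ((hψcont.pow m).mul continuousOn_id)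
      fun r hr => mul_ne_zero (pow_ne_zero m (hψne r hr)) (hrne r hr)).mul
      (continuousOn_const.add (continuousOn_const.mul ((continuousOn_id.mul hDcont).div hψcont
        hψne))))).div continuousOn_id hrne
  -- The limit is `-F(0)^(p-1) + l (1 + m)`, which vanishes by the choice of `l`.
  have hG'0 : Tendsto (fun r => r * G' r) (𝓝[>] 0) (𝓝 0) := by
    have h1 := (hF.rpow_const (p := p - 1) (Or.inl (hpos 0).ne')).neg.add (hquot.mul
      (hψ.tendsto_logDeriv.const_mul (m : ℝ) |>.const_add 1))
    have h2 : -(F 0 ^ (p - 1)) + l * (1 + m * 1) = 0 := by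
      rw [hl]
      field_simp
      ring
    rw [h2] at h1
    refine h1.congr' ?_
    filter_upwards [self_mem_nhdsWithin] with r hr
    rw [hG'def]
    exact (mul_div_cancel₀ _ (ne_of_gt hr)).symm
  refine ⟨contDiff_two_radial hF hGc hFd hGd hG'c hG'0, fun x => hpos _, fun x => ?_⟩
  rw [laplaceBeltrami_radial hψ.pos hn hF hGc hFd (Γ := Γ) (Γ' := Γ') (fun r hr => ?_)
    (by simp [hΓdef, hG0]) hΓc hΓd]
  · split_ifs with hx
    · rw [hx, norm_zero, hG0, hl]
      push_cast
      field_simp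
    · have hx' := norm_pos_iff.2 hx
      have := hψ.pos _ hx'
      rw [hΓpos _ hx', Nat.add_sub_cancel]
      simp only [hΓ'def, div_pow]
      push_cast
      field_simp
      ring
  · have := hψ.pos r hr
    rw [hΓpos r hr, hGpos r hr, Nat.add_sub_cancel, div_pow]
    field_simp
    ring

end ClassicalSolution

theorem mainTheorem7 (n : ℕ) (hn : 2 ≤ n) (α κ : ℝ) (hα : 1 < α) (hκ : 0 < κ)
    (ψ : ℝ → ℝ) (hψ : IsModelFunction ψ)
    (hasymp : Tendsto (fun r : ℝ => ψ r / (κ * r ^ α)) atTop (𝓝 1))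
    (hI : sobolevInf n ψ (twoStar n α - 1) < asymptoticInf n α κ) :
    ∃ f : ℝ → ℝ,
      IsLaneEmdenSolution n ψ (twoStar n α - 1)
        (fun x : EuclideanSpace ℝ (Fin n) => f ‖x‖) ∧
      f ∈ D12rad n ψ ∧
      IsSobolevMinimizer n ψ (twoStar n α - 1) f := by
  have hp : 1 ≤ twoStar n α := by linarith [two_lt_twoStar hn hα]
  obtain ⟨F, hmin, hpos, hF, hint, hd⟩ := exists_positive_minimizer hn hα hκ hψ hasymp hI
  have hw : IsDecayWeight fun r => ψ r ^ (n - 1) := hψ.isDecayWeight hκ hα hasymp (by omega)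
  exact ⟨F, isLaneEmdenSolution_of_flux (by omega) hp hψ hpos hF hint
    (fun r hr => hasDerivAt_flux hp hw
      (fun s hs => (hd s hs).continuousAt.continuousWithinAt) hint hr) hd, hmin.1, hmin⟩
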